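/- **Setting.** Let $d\ge 1$. Norms are Euclidean norms of vectors and spectral norms of matrices; $\lambda_{\min},\lambda_{\max}$ are the extreme eigenvalues of a symmetric matrix. Let $v_1,v_2\in\mathbb R^d$, $\Gamma_1,\Gamma_2,W_1,W_2\in\mathbb R^{d\times d}$ and $h_i(\theta,w)=v_i-\Gamma_i\theta-W_iw$. Assume that $W_2$ and $X_1=\Gamma_1-W_1W_2^{-1}\Gamma_2$ are positive definite (not necessarily symmetric: $x^\top Ax>0$ for $x\ne0$). Put $\theta^*=X_1^{-1}(v_1-W_1W_2^{-1}v_2)$ and $w^*=W_2^{-1}(v_2-\Gamma_2\theta^*)$. Let $0<\beta<\alpha<1$, $\alpha_n=(n+1)^{-\alpha}$, $\beta_n=(n+1)^{-\beta}$. On a probability space consider random variables with $$\theta_{n+1}=\theta_n+\alpha_n[h_1(\theta_n,w_n)+M^{(1)}_{n+1}],\qquad w_{n+1}=w_n+\beta_n[h_2(\theta_n,w_n)+M^{(2)}_{n+1}]\qquad(n\ge0),$$ where $M^{(1)},M^{(2)}$ are (integrable) martingale difference sequences with respect to $\mathcal F_n=\sigma(\theta_0,w_0,M^{(1)}_1,M^{(2)}_1,\dots,M^{(1)}_n,M^{(2)}_n)$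 and, almost surely, $\|M^{(i)}_{n+1}\|\le m_i(1+\|\theta_n\|+\|w_n\|)$ for $i=1,2$, with constants $m_1,m_2>0$. Fix $p>1$, $R^\theta,R^w>0$, $\delta\in(0,1)$, and let $\nu(n,\gamma)=(n+1)^{-\gamma/2}\sqrt{\ln(4d^2(n+1)^p/\delta)}$. **Constants.** Let $q_1=\lambda_{\min}(X_1+X_1^\top)/4$, $q_2=\lambda_{\min}(W_2+W_2^\top)/4$, $q_{\min}=\min\{q_1,q_2\}$. For a positive definite matrix $A$, with $q=\lambda_{\min}(A+A^\top)/4$, $\lambda=\lambda_{\max}(A^\top A)$, and $\gamma\in(0,1)$, put $$C(A,\gamma)=\max\Big\{1,\Big(\max_{0\le\ell_1\le\ell_2\le K}\prod_{\ell=\ell_1}^{\ell_2}e^{(\ell+1)^{-\gamma}(\lambda-\lambda_{\min}(A+A^\top)+2q)}\Big)^{1/2}\Big\},\qquad K=\Big\lceil\Big(\tfrac{\lambda}{\lambda_{\min}(A+A^\top)-2q}\Big)^{1/\gamma}\Big\rceil ,$$ and let $S(A,\gamma)$ be the least integer $K\ge0$ with $(n+1)^{-\gamma}\le(\lambda_{\min}(A+A^\top)-2q)/\lambda$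 for all $n\ge K$. Put $C_\theta=C(X_1,\alpha)$, $C_w=C(W_2,\beta)$. Let $K_\theta\ge1$ be any integer such that $e^{-q_1\sum_{k=1}^{n-1}\alpha_k}\le n^{-\alpha}$ for all $n\ge K_\theta$ and $K_w\ge1$ any integer such that $e^{-q_2\sum_{k=1}^{n-1}\beta_k}\le n^{-\beta}$ for all $n\ge K_w$ (such integers exist), and $$D_\theta=\tfrac{e^{q_1}}{q_1}\max_{1\le i\le K_\theta}i^{\alpha}e^{-q_1\sum_{k=1}^{i-1}\alpha_k},\qquad D_w=\tfrac{e^{q_2}}{q_2}\max_{1\le i\le K_w}i^{\beta}e^{-q_2\sum_{k=1}^{i-1}\beta_k}.$$ Further - $C_R^\theta=3$, $C_R^w=\frac32+\frac{e^{q_2}}{q_2}\|\Gamma_2\|C_wC_R^\theta\frac{R^\theta}{R^w}$, $B=1+C_R^\theta R^\theta+C_R^wR^w+\|\theta^*\|+\|w^*\|$; - $L_\theta=2\,[C_\theta B(m_1+m_2\|W_1\|\|W_2^{-1}\|)]^2$, $L_w=2\,[C_wBm_2]^2$; - $\epsilon^\theta_n=\sqrt{d^3L_\theta D_\theta}\,\nu(n,\alpha)$,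 $\epsilon^w_n=\sqrt{d^3L_wD_w}\,\nu(n,\beta)$; - $C_T=\|X_1\|+2(\alpha-\beta)(1+\|X_1\|)$, $C_a=C_\theta\max\{\|W_1W_2^{-1}\|,1\}$, $C_b=\|W_1W_2^{-1}\|(1+\frac{2e^{q_1/2}}{q_1}C_TC_\theta)$, $C_I=2e^{q_2/2}/q_2$; - $C_c=\beta_{n_0}\|\theta_{n_0}-\theta^*\|+C_ae^{q_1}\frac2{q_{\min}}\big(\|\theta_{n_0}-\theta^*\|+\frac{\alpha_{n_0}}{\beta_{n_0}}\|w_{n_0}-w^*\|\big)$; - $A_1=e+\frac{e\,[C_w\|\Gamma_2\|C_c+C_w\|w_{n_0}-w^*\|]}{\epsilon^w_{n_0}}+e^2C_w\|\Gamma_2\|C_I$, $A_2=e^{q_1+2(\alpha-\beta)}C_w\|\Gamma_2\|C_b\frac{2e^{q_2/2}}{q_2}$, $A_3=C_R^wR^w$, $\ell^*=\lceil\frac{\beta}{2(\alpha-\beta)}\rceil$; - $A_{4,n_0}=\big(A_1\sum_{i=0}^{\ell^*-1}A_2^i\big)\sqrt{d^3L_wD_w}+A_3A_2^{\ell^*}$;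 - $A_{5,n_0}=2\Big[\frac{C_a(C_R^\theta R^\theta+C_R^wR^w)}{\epsilon^\theta_{n_0-1}}+1\Big]\sqrt{4d^3L_\theta D_\theta}+2C_bA_{4,n_0}$. (So $A_{4,n_0},A_{5,n_0}$ depend on the sample point only through $\|\theta_{n_0}-\theta^*\|$ and $\|w_{n_0}-w^*\|$.) **Lower bound on $n_0$.** For $z\ge0$ let $K_{2,\alpha}(z)=\max\big\{\lceil(\frac{q_1}{2(\alpha-\beta+z)})^{1/\alpha}\rceil,\lceil(\frac{4(\alpha-\beta+z)}{q_1})^{1/(1-\alpha)}\rceil\big\}$ and $K_{2,\beta}(z)=\max\big\{\lceil(\frac{q_2}{\alpha-\beta+z})^{1/\beta}\rceil,\lceil(\frac{4(\alpha-\beta+z)}{q_2})^{1/(1-\beta)}\rceil\big\}$. For $b>0$ let $\Lambda(b,\gamma)=b^{1/\gamma}\big[2\ln\big(2b(4d^2/\delta)^{\gamma/p}\big)\big]_+^{1/\gamma}$, where $[x]_+=\max\{0,x\}$; let $K_{3,\alpha}=\Lambda\big(\frac{4d^3L_\theta D_\theta p}{\alpha(R^\theta)^2},\alpha\big)$ and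 $K_{3,\beta}=\Lambda\big(\frac{4d^3L_wD_wp}{\beta(R^w)^2},\beta\big)$. Let $E_\theta=\|W_1\|\|W_2^{-1}\|\frac{e^{q_2}}{q_2}C_R^\theta\|\Gamma_2\|C_w$, $E_w=\|W_1\|\|W_2^{-1}\|\big[\frac52+\frac{2e^{q_1/2}}{q_1}C_TC_\theta C_R^w\big]$, $K_4=\big[\frac23E_\theta+\frac23E_w\frac{R^w}{R^\theta}\big]^{1/(\alpha-\beta)}$, $K_{5,a}=2^{1/(\alpha-\beta)}$, $K_{5,b}=(3\alpha/q_2)^{1/(1-\beta)}-2$, $K_{6,a}=\big(\frac{L_\theta D_\theta}{L_wD_w}\big)^{1/(\alpha-\beta)}$, $K_{6,b}=\big(1+\frac{\alpha}{2q_{\min}}\big)^{1/(1-\alpha)}$. Put $$N'=\max\{S(X_1,\alpha),S(W_2,\beta),K_{2,\alpha}(0),K_{3,\alpha},K_{3,\beta},K_4,(p-1)^{-1/(p-1)}\},$$ $$N''=\max\Big\{K_{2,\alpha}(\tfrac\beta2),K_{2,\beta}(\tfrac\beta2),\tfrac{e^{1/\beta}\delta^{1/p}}{(4d^2)^{1/p}},K_{5,a},K_{5,b},K_{6,a},K_{6,b}\Big\}+1,\qquad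 N=\max\{N',N''\}.$$ **Theorem.** Let $n_0\ge N$ and suppose that the event $\mathcal G'=\{\|\theta_{n_0}-\theta^*\|\le R^\theta,\ \|w_{n_0}-w^*\|\le R^w\}$ has positive probability. Then, conditionally on $\mathcal G'$, with probability larger than $1-\delta$, $$\|\theta_n-\theta^*\|\le A_{5,n_0}\,\nu(n,\alpha)\quad\text{and}\quad\|w_n-w^*\|\le A_{4,n_0}\,\nu(n,\beta)\qquad\text{for all }n\ge n_0 .$$ -/

import Mathlib

noncomputable section

namespace TwoTimescale

open MeasureTheory

/-- The space `ℝ^d` with its Euclidean norm. -/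
abbrev Vec (d : ℕ) := EuclideanSpace ℝ (Fin d)

/-- Real `d × d` matrices. -/
abbrev Mat (d : ℕ) := Matrix (Fin d) (Fin d) ℝ

/-- The matrix `A` as an operator on Euclidean space. -/
abbrev act {d : ℕ} (A : Mat d) : Vec d →L[ℝ] Vec d :=
  Matrix.toEuclideanCLM (n := Fin d) (𝕜 := ℝ) A

/-- The spectral norm `‖A‖`. -/
def opNorm {d : ℕ} (A : Mat d) : ℝ := ‖act A‖

/-- Positive definiteness of a matrix that need not be symmetric. -/
def IsPosDef {d : ℕ} (A : Mat d) : Prop :=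
  ∀ x : Vec d, x ≠ 0 → 0 < inner ℝ x (act A x)

/-- Smallest real eigenvalue (used for symmetric matrices only). -/
def lamMin {d : ℕ} (A : Mat d) : ℝ := sInf (spectrum ℝ A)

/-- Largest real eigenvalue (used for symmetric matrices only). -/
def lamMax {d : ℕ} (A : Mat d) : ℝ := sSup (spectrum ℝ A)

/-- The stepsizes `(n + 1)^(-γ)`. -/
def step (γ : ℝ) (n : ℕ) : ℝ := ((n : ℝ) + 1) ^ (-γ)

/-! ### Constants attached to a single matrix, exponent and rate -/

/-- The rate `q = λ_min(A + Aᵀ) / 4`. -/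
def rate {d : ℕ} (A : Mat d) : ℝ := lamMin (A + A.transpose) / 4

/-- The least index from which on
`(n+1)^(-γ) ≤ (λ_min(A + Aᵀ) - 2q) / λ_max(Aᵀ A)`. -/
def smallStepIndex {d : ℕ} (A : Mat d) (γ : ℝ) : ℕ :=
  sInf {K : ℕ | ∀ n : ℕ, K ≤ n →
    step γ n ≤ (lamMin (A + A.transpose) - 2 * rate A) / lamMax (A.transpose * A)}

/-- `⌈(λ_max(Aᵀ A) / (λ_min(A + Aᵀ) - 2q))^(1/γ)⌉`. -/
def prodIndex {d : ℕ} (A : Mat d) (γ : ℝ) : ℕ :=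
  ⌈(lamMax (A.transpose * A) / (lamMin (A + A.transpose) - 2 * rate A)) ^ (1 / γ)⌉₊

/-- The constant `C` in `∏_{k=i}^n ‖I - (k+1)^(-γ) A‖ ≤ C exp(-q ∑_{k=i}^n (k+1)^(-γ))`:
`max {1, √(max_{ℓ₁ ≤ ℓ₂ ≤ K} ∏_{ℓ=ℓ₁}^{ℓ₂} exp((ℓ+1)^(-γ) (μ + 2q)))}` with
`μ = -λ_min(A + Aᵀ) + λ_max(Aᵀ A)`. -/
def prodConst {d : ℕ} (A : Mat d) (γ : ℝ) : ℝ :=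
  max 1 (Real.sqrt
    ((Finset.Iic (prodIndex A γ)).sup' Finset.nonempty_Iic fun ℓ₂ =>
      (Finset.Iic ℓ₂).sup' Finset.nonempty_Iic fun ℓ₁ =>
        ∏ ℓ ∈ Finset.Icc ℓ₁ ℓ₂,
          Real.exp (step γ ℓ *
            (-lamMin (A + A.transpose) + lamMax (A.transpose * A) + 2 * rate A))))

/-- `K ≥ 1` is an index with `exp(-q ∑_{k=1}^{n-1} (k+1)^(-γ)) ≤ n^(-γ)` for all `n ≥ K`. -/
def IsDecayIndex (γ q : ℝ) (K : ℕ) : Prop :=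
  1 ≤ K ∧ ∀ n : ℕ, K ≤ n →
    Real.exp (-q * ∑ k ∈ Finset.Ico 1 n, step γ k) ≤ (n : ℝ) ^ (-γ)

/-- `max_{1 ≤ i ≤ K} i^γ exp(-q ∑_{k=1}^{i-1} (k+1)^(-γ)) * e^q / q`. -/
def noiseConst (γ q : ℝ) (K : ℕ) : ℝ :=
  (⨆ i : Finset.Icc 1 K,
    ((i : ℕ) : ℝ) ^ γ * Real.exp (-q * ∑ k ∈ Finset.Ico 1 (i : ℕ), step γ k)) *
      Real.exp q / q

/-! ### The data of the algorithm and of the bound -/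

/-- The data: the affine maps `h_i(θ, w) = v_i - Γ_i θ - W_i w`, the stepsize exponents `α, β`,
the noise parameters `m₁, m₂`, the radii `Rθ, Rw`, the free parameters `p, δ`, and two indices
`Kθ, Kw` that enter the constants of the bound. -/
structure Data (d : ℕ) where
  v₁ : Vec d
  v₂ : Vec d
  Γ₁ : Mat d
  Γ₂ : Mat d
  W₁ : Mat d
  W₂ : Mat d
  α : ℝ
  β : ℝ
  m₁ : ℝ
  m₂ : ℝ
  Rθ : ℝ
  Rw : ℝ
  p : ℝ
  δ : ℝ
  Kθ : ℕ
  Kw : ℕ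

namespace Data

variable {d : ℕ} (P : Data d)

def h₁ (θ w : Vec d) : Vec d := P.v₁ - act P.Γ₁ θ - act P.W₁ w

def h₂ (θ w : Vec d) : Vec d := P.v₂ - act P.Γ₂ θ - act P.W₂ w

/-- `X₁ = Γ₁ - W₁ W₂⁻¹ Γ₂`. -/
def X₁ : Mat d := P.Γ₁ - P.W₁ * P.W₂⁻¹ * P.Γ₂

/-- `b₁ = v₁ - W₁ W₂⁻¹ v₂`. -/
def b₁ : Vec d := P.v₁ - act (P.W₁ * P.W₂⁻¹) P.v₂

/-- `θ* = X₁⁻¹ b₁`. -/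
def θstar : Vec d := act P.X₁⁻¹ P.b₁

/-- `w* = W₂⁻¹ (v₂ - Γ₂ θ*)`. -/
def wstar : Vec d := act P.W₂⁻¹ (P.v₂ - act P.Γ₂ P.θstar)

/-- `ν(n; γ) = (n+1)^(-γ/2) √(ln(4 d² (n+1)^p / δ))`. -/
def ν (n : ℕ) (γ : ℝ) : ℝ :=
  ((n : ℝ) + 1) ^ (-γ / 2) *
    Real.sqrt (Real.log (4 * (d : ℝ) ^ 2 * ((n : ℝ) + 1) ^ P.p / P.δ))

/-! ### Constants -/

def q₁ : ℝ := rate P.X₁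

def q₂ : ℝ := rate P.W₂

def qmin : ℝ := min P.q₁ P.q₂

/-- `C_θ`, the product constant of `X₁`. -/
def Cθ : ℝ := prodConst P.X₁ P.α

/-- `C_w`, the product constant of `W₂`. -/
def Cw : ℝ := prodConst P.W₂ P.β

/-- The constant `D_θ` with `∑_{k<n} α_k² exp(-2 q₁ ∑_{k<j<n} α_j) ≤ D_θ n^(-α)`. -/
def Dθ : ℝ := noiseConst P.α P.q₁ P.Kθ

/-- The constant `D_w` with `∑_{k<n} β_k² exp(-2 q₂ ∑_{k<j<n} β_j) ≤ D_w n^(-β)`. -/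
def Dw : ℝ := noiseConst P.β P.q₂ P.Kw

/-- `C_R^θ = 3`. -/
def CRθ : ℝ := 3

/-- `C_R^w = 3/2 + (e^{q₂}/q₂) ‖Γ₂‖ C_w C_R^θ Rθ / Rw`. -/
def CRw : ℝ :=
  3 / 2 + (Real.exp P.q₂ / P.q₂ * opNorm P.Γ₂ * P.Cw) * CRθ * (P.Rθ / P.Rw)

/-- `1 + C_R^θ Rθ + C_R^w Rw + ‖θ*‖ + ‖w*‖`. -/
def size : ℝ := 1 + CRθ * P.Rθ + P.CRw * P.Rw + ‖P.θstar‖ + ‖P.wstar‖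

def Lθ : ℝ :=
  2 * (P.Cθ * P.size * (P.m₁ + P.m₂ * opNorm P.W₁ * opNorm P.W₂⁻¹)) ^ 2

def Lw : ℝ := 2 * (P.Cw * P.size * P.m₂) ^ 2

def εθ (n : ℕ) : ℝ := Real.sqrt ((d : ℝ) ^ 3 * P.Lθ * P.Dθ) * P.ν n P.α

def εw (n : ℕ) : ℝ := Real.sqrt ((d : ℝ) ^ 3 * P.Lw * P.Dw) * P.ν n P.β

/-- `C_T = ‖X₁‖ + 2 (α - β) (1 + ‖X₁‖)`. -/
def CT : ℝ := opNorm P.X₁ + 2 * (P.α - P.β) * (1 + opNorm P.X₁)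

/-- `C_a = C_θ max {‖W₁ W₂⁻¹‖, 1}`. -/
def Ca : ℝ := P.Cθ * max (opNorm (P.W₁ * P.W₂⁻¹)) 1

/-- `C_b = ‖W₁ W₂⁻¹‖ (1 + (2 e^{q₁/2}/q₁) C_T C_θ)`. -/
def Cb : ℝ :=
  opNorm (P.W₁ * P.W₂⁻¹) * (1 + 2 * Real.exp (P.q₁ / 2) / P.q₁ * P.CT * P.Cθ)

/-- `C_c(n₀)`; here and below `x` and `y` stand for `‖θ_{n₀} - θ*‖` and `‖w_{n₀} - w*‖`. -/
def Cc (n₀ : ℕ) (x y : ℝ) : ℝ :=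
  step P.β n₀ * x +
    P.Ca * Real.exp P.q₁ * (2 / P.qmin) * (x + step P.α n₀ / step P.β n₀ * y)

/-- `C_I = 2 e^{q₂/2} / q₂`. -/
def CI : ℝ := 2 * Real.exp (P.q₂ / 2) / P.q₂

def A₁ (n₀ : ℕ) (x y : ℝ) : ℝ :=
  Real.exp 1 +
    Real.exp 1 * (P.Cw * opNorm P.Γ₂ * P.Cc n₀ x y + P.Cw * y) / P.εw n₀ +
    Real.exp 2 * P.Cw * opNorm P.Γ₂ * P.CI

def A₂ : ℝ :=
  Real.exp (P.q₁ + 2 * (P.α - P.β)) * P.Cw * opNorm P.Γ₂ * P.Cb *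
    (2 * Real.exp (P.q₂ / 2) / P.q₂)

def A₃ : ℝ := P.CRw * P.Rw

/-- `ℓ* = ⌈β / (2 (α - β))⌉`. -/
def ℓstar : ℕ := ⌈P.β / (2 * (P.α - P.β))⌉₊

/-- `A_{4,n₀} = (A₁ ∑_{i<ℓ*} A₂^i) √(d³ L_w D_w) + A₃ A₂^{ℓ*}`. -/
def A₄ (n₀ : ℕ) (x y : ℝ) : ℝ :=
  (P.A₁ n₀ x y * ∑ i ∈ Finset.range P.ℓstar, P.A₂ ^ i) *
      Real.sqrt ((d : ℝ) ^ 3 * P.Lw * P.Dw) +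
    P.A₃ * P.A₂ ^ P.ℓstar

/-- `A_{5,n₀} = 2 (C_a (C_R^θ Rθ + C_R^w Rw) / ε^θ_{n₀-1} + 1) √(4 d³ L_θ D_θ) + 2 C_b A_{4,n₀}`. -/
def A₅ (n₀ : ℕ) (x y : ℝ) : ℝ :=
  2 * (P.Ca * (CRθ * P.Rθ + P.CRw * P.Rw) / P.εθ (n₀ - 1) + 1) *
      Real.sqrt (4 * (d : ℝ) ^ 3 * P.Lθ * P.Dθ) +
    2 * P.Cb * P.A₄ n₀ x y

/-! ### The lower bound on `n₀` -/

/-- `K_{2,α}(z)`. -/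
def K₂α (z : ℝ) : ℝ :=
  max (⌈(P.q₁ / (2 * (P.α - P.β + z))) ^ (1 / P.α)⌉₊ : ℝ)
    (⌈(4 * (P.α - P.β + z) / P.q₁) ^ (1 / (1 - P.α))⌉₊ : ℝ)

/-- `K_{2,β}(z)`. -/
def K₂β (z : ℝ) : ℝ :=
  max (⌈(P.q₂ / (P.α - P.β + z)) ^ (1 / P.β)⌉₊ : ℝ)
    (⌈(4 * (P.α - P.β + z) / P.q₂) ^ (1 / (1 - P.β))⌉₊ : ℝ)

/-- `B^{1/γ} [2 ln(2 B (4d²/δ)^{γ/p})]^{1/γ}`, read as `0` when the logarithm is negative. -/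
def logIndex (B γ : ℝ) : ℝ :=
  B ^ (1 / γ) *
    (max 0 (2 * Real.log (2 * B * (4 * (d : ℝ) ^ 2 / P.δ) ^ (γ / P.p)))) ^ (1 / γ)

def K₃α : ℝ :=
  P.logIndex (4 * (d : ℝ) ^ 3 * P.Lθ * P.Dθ * P.p / (P.α * P.Rθ ^ 2)) P.α

def K₃β : ℝ :=
  P.logIndex (4 * (d : ℝ) ^ 3 * P.Lw * P.Dw * P.p / (P.β * P.Rw ^ 2)) P.β

/-- `E_θ = ‖W₁‖ ‖W₂⁻¹‖ (e^{q₂}/q₂) C_R^θ ‖Γ₂‖ C_w`. -/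
def Eθ : ℝ :=
  opNorm P.W₁ * opNorm P.W₂⁻¹ * (Real.exp P.q₂ / P.q₂) * CRθ * opNorm P.Γ₂ * P.Cw

/-- `E_w = ‖W₁‖ ‖W₂⁻¹‖ (5/2 + (2 e^{q₁/2}/q₁) C_T C_θ C_R^w)`. -/
def Ew : ℝ :=
  opNorm P.W₁ * opNorm P.W₂⁻¹ *
    (5 / 2 + 2 * Real.exp (P.q₁ / 2) / P.q₁ * P.CT * P.Cθ * P.CRw)

def K₄ : ℝ :=
  (2 / 3 * P.Eθ + 2 / 3 * P.Ew * (P.Rw / P.Rθ)) ^ (1 / (P.α - P.β))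

def K₅a : ℝ := 2 ^ (1 / (P.α - P.β))

def K₅b : ℝ := (3 * P.α / P.q₂) ^ (1 / (1 - P.β)) - 2

def K₆a : ℝ := (P.Lθ * P.Dθ / (P.Lw * P.Dw)) ^ (1 / (P.α - P.β))

def K₆b : ℝ := (1 + P.α / (2 * P.qmin)) ^ (1 / (1 - P.α))

/-- The threshold for the high-probability boundedness of the iterates. -/
def Nbdd : ℝ :=
  max (smallStepIndex P.X₁ P.α : ℝ) (max (smallStepIndex P.W₂ P.β : ℝ)
    (max (P.K₂α 0) (max P.K₃α (max P.K₃β (max P.K₄ ((P.p - 1) ^ (-1 / (P.p - 1))))))))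

/-- The threshold for the deterministic improvement of the rate. -/
def Nrate : ℝ :=
  max (P.K₂α (P.β / 2)) (max (P.K₂β (P.β / 2))
    (max (Real.exp (1 / P.β) * P.δ ^ (1 / P.p) / (4 * (d : ℝ) ^ 2) ^ (1 / P.p))
      (max P.K₅a (max P.K₅b (max P.K₆a P.K₆b))))) + 1

/-- The lower bound on `n₀`. -/
def N : ℝ := max P.Nbdd P.Nrate

end Data

/-! ### Noise and iterates -/

/-- `𝓕_n = σ(θ₀, w₀, M¹_1, M²_1, …, M¹_n, M²_n)`. -/
abbrev history {d : ℕ} {Ω : Type*} (θ₀ w₀ : Ω → Vec d) (M₁ M₂ : ℕ → Ω → Vec d) (n : ℕ) :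
    MeasurableSpace Ω :=
  MeasurableSpace.comap θ₀ inferInstance ⊔ MeasurableSpace.comap w₀ inferInstance ⊔
    ⨆ k ∈ Finset.Icc 1 n, MeasurableSpace.comap (M₁ k) inferInstance ⊔
      MeasurableSpace.comap (M₂ k) inferInstance

/-- `M₁, M₂` are `(θ_n, w_n)`-dominated martingale differences with parameters `m₁, m₂`
(the entries `M₁ 0`, `M₂ 0` play no role). -/
structure DominatedMartingaleDifferences {d : ℕ} {Ω : Type*} [MeasurableSpace Ω]
    (μ : Measure Ω) (θ w M₁ M₂ : ℕ → Ω → Vec d) (m₁ m₂ : ℝ) : Prop where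
  measurable₁ : ∀ n, Measurable (M₁ (n + 1))
  measurable₂ : ∀ n, Measurable (M₂ (n + 1))
  integrable₁ : ∀ n, Integrable (M₁ (n + 1)) μ
  integrable₂ : ∀ n, Integrable (M₂ (n + 1)) μ
  condExp₁ : ∀ n, μ[M₁ (n + 1) | history (θ 0) (w 0) M₁ M₂ n] =ᵐ[μ] 0
  condExp₂ : ∀ n, μ[M₂ (n + 1) | history (θ 0) (w 0) M₁ M₂ n] =ᵐ[μ] 0
  bound₁ : ∀ n, ∀ᵐ ω ∂μ, ‖M₁ (n + 1) ω‖ ≤ m₁ * (1 + ‖θ n ω‖ + ‖w n ω‖)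
  bound₂ : ∀ n, ∀ᵐ ω ∂μ, ‖M₂ (n + 1) ω‖ ≤ m₂ * (1 + ‖θ n ω‖ + ‖w n ω‖)

/-- `(θ_n, w_n)` are the unprojected iterates, from a random initial point. -/
structure IsIterates {d : ℕ} {Ω : Type*} [MeasurableSpace Ω] (P : Data d)
    (θ w M₁ M₂ : ℕ → Ω → Vec d) : Prop where
  measurable_θ₀ : Measurable (θ 0)
  measurable_w₀ : Measurable (w 0)
  θ_succ : ∀ n ω, θ (n + 1) ω =
    θ n ω + step P.α n • (P.h₁ (θ n ω) (w n ω) + M₁ (n + 1) ω)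
  w_succ : ∀ n ω, w (n + 1) ω =
    w n ω + step P.β n • (P.h₂ (θ n ω) (w n ω) + M₂ (n + 1) ω)

/-- Decay indices exist. -/
theorem exists_isDecayIndex {γ q : ℝ} (hγ0 : 0 < γ) (hγ1 : γ < 1) (hq : 0 < q) :
    ∃ K, IsDecayIndex γ q K := by
  have hlo := (isLittleO_log_rpow_atTop (sub_pos.2 hγ1)).def
    (show (0 : ℝ) < q / (2 * γ) by positivity)
  obtain ⟨N, hN⟩ := Filter.eventually_atTop.1
    (tendsto_natCast_atTop_atTop.eventually hlo)
  refine ⟨max N 2, by omega, fun n hn => ?_⟩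
  have hn2 : 2 ≤ n := le_trans (le_max_right _ _) hn
  have hnR : (2 : ℝ) ≤ n := by exact_mod_cast hn2
  have hnp : (0 : ℝ) < n := by linarith
  have h1 := hN n (le_trans (le_max_left _ _) hn)
  rw [Real.norm_of_nonneg (Real.log_nonneg (by linarith)),
    Real.norm_of_nonneg (by positivity)] at h1
  have h2 : ((n : ℝ) - 1) * (n : ℝ) ^ (-γ) ≤ ∑ k ∈ Finset.Ico 1 n, step γ k := by
    have := Finset.card_nsmul_le_sum (Finset.Ico 1 n) (step γ) ((n : ℝ) ^ (-γ)) (by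
      intro k hk
      have hk2 : k + 1 ≤ n := (Finset.mem_Ico.1 hk).2
      have hk3 : (k : ℝ) + 1 ≤ n := by exact_mod_cast hk2
      exact Real.rpow_le_rpow_of_nonpos (by positivity) hk3 (by linarith))
    rw [Nat.card_Ico, nsmul_eq_mul, Nat.cast_sub (by omega)] at this
    simpa using this
  have h3 : (n : ℝ) ^ (1 - γ) = n * (n : ℝ) ^ (-γ) := by
    rw [sub_eq_add_neg, Real.rpow_add hnp, Real.rpow_one]
  rw [Real.rpow_def_of_pos hnp, Real.exp_le_exp]
  have h4 : γ * Real.log n ≤ q * (n / 2 * (n : ℝ) ^ (-γ)) := by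
    calc γ * Real.log n ≤ γ * (q / (2 * γ) * (n : ℝ) ^ (1 - γ)) := by gcongr
      _ = _ := by rw [h3]; field_simp
  have h5 : q * (n / 2 * (n : ℝ) ^ (-γ)) ≤ q * ∑ k ∈ Finset.Ico 1 n, step γ k := by
    gcongr
    refine le_trans ?_ h2
    gcongr
    linarith
  nlinarith

end TwoTimescale

end

/-! Write e = θ - θ*, f = w - w*, S = W₁W₂⁻¹ and r_n = α_n/β_n = (n+1)^(-(α-β)). Since r_n β_n =
α_n, subtracting r_n S f_{n+1} from e_{n+1} cancels the term W₁f and leaves the contraction 1 - α_n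
X₁, the noise M¹ - S M², and coupling errors of order α_n r_n ‖f_n‖. The fast variable contracts by
1 - β_n W₂ and is forced by Γ₂e. Splitting off the accumulated noises Lθ and Lw turns the problem
into scalar recursions for norms (`Data.Admissible.errorRecursion`).

Such a recursion t' ≤ e^{-qa} t + a f is solved by comparison (`le_of_linear_recursion`,
`supersolution_step`): a forcing that varies slowly compared with the contraction is reproduced up
to the factor e^κ/κ. The steps contract with constant 1 from n₀ on
(`norm_one_sub_step_smul_act_le`), so C_θ, C_w enter only through C ≥ 1, and D_θ, D_w only through D
≥ e^q/q.

Boundedness. While the errors are in range and the noise sums stay below ε_n, the recursions keep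
the errors in range one step longer (`Data.ErrorRecursion.inRange`).

Rate. A bound u_n on ‖f_n‖ yields ‖e‖ ≲ decay + noise + r_n u_n, hence ‖f_n‖ ≤ A₁ ε^w_n + A₂ r_n u_n
(`Data.ErrorRecursion.y_le_of_y_le`). Starting from the constant A₃, each round gains a factor
(n+1)^(-(α-β)); after ℓ* rounds the remainder is below ν(n, β) (`Data.ErrorRecursion.y_le_A₄`). The
bound on ‖e‖ follows from r_n ν(n, β) ≤ ν(n, α).

Probability. The noise is bounded only while the iterates are, so it is stopped on leaving the
range. The stopped sums have sub-Gaussian tails (`measure_norm_noiseSum_gt_le`), also conditionally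
on 𝒢', because 𝒢' belongs to 𝓕_{n₀}. A union bound over n ≥ n₀ leaves a bad event of probability
less than δ (`measureReal_smallNoiseEvent_compl_lt`). Off it the errors never leave the range, so
the stopped noise was the true noise all along (`errors_le_of_mem_smallNoiseEvent`). -/

namespace TwoTimescale

open MeasureTheory

/-! ### Spectral bounds and contraction of the one-step matrices. -/

section MatrixBounds

variable {d : ℕ}

theorem act_one : act (1 : Mat d) = 1 := map_one _

theorem act_mul (A B : Mat d) : act (A * B) = act A * act B := map_mul _ _ _

theorem act_add (A B : Mat d) : act (A + B) = act A + act B := map_add _ _ _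

theorem act_sub (A B : Mat d) : act (A - B) = act A - act B := map_sub _ _ _

theorem act_smul (a : ℝ) (A : Mat d) : act (a • A) = a • act A := map_smul _ _ _

theorem inner_act_transpose (A : Mat d) (x y : Vec d) :
    inner ℝ x (act A.transpose y) = inner ℝ (act A x) y := by
  rw [real_inner_comm y (act A x), Matrix.inner_toEuclideanCLM, Matrix.inner_toEuclideanCLM,
    Matrix.mulVec_transpose, dotProduct_comm, ← Matrix.dotProduct_mulVec]

theorem posSemidef_inner_nonneg {H : Mat d} (hH : H.PosSemidef) (x : Vec d) :
    0 ≤ inner ℝ x (act H x) := by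
  rw [Matrix.inner_toEuclideanCLM]
  simpa using hH.dotProduct_mulVec_nonneg x.ofLp

theorem spectrum_finite {H : Mat d} (hH : H.IsHermitian) : (spectrum ℝ H).Finite := by
  rw [hH.spectrum_real_eq_range_eigenvalues]
  exact Set.finite_range _

theorem spectrum_nonempty (hd : 1 ≤ d) {H : Mat d} (hH : H.IsHermitian) :
    (spectrum ℝ H).Nonempty := by
  have : Nonempty (Fin d) := ⟨⟨0, hd⟩⟩
  rw [hH.spectrum_real_eq_range_eigenvalues]
  exact Set.range_nonempty _

/-- Subtracting λ_min shifts the spectrum into [0, ∞), so H - λ_min is positive semidefinite. -/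
theorem lamMin_mul_le_inner {H : Mat d} (hH : H.IsHermitian) (x : Vec d) :
    lamMin H * ‖x‖ ^ 2 ≤ inner ℝ x (act H x) := by
  have hpsd : (H - algebraMap ℝ (Mat d) (lamMin H)).PosSemidef := by
    rw [Matrix.posSemidef_iff_isHermitian_and_spectrum_nonneg]
    refine ⟨hH.sub ?_, ?_⟩
    · rw [Matrix.algebraMap_eq_diagonal]
      exact Matrix.isHermitian_diagonal _
    · intro a ha
      have ha' : a + lamMin H ∈ spectrum ℝ H := by
        have := (spectrum.add_mem_add_iff (R := ℝ) (r := a) (s := lamMin H)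
          (a := H - algebraMap ℝ (Mat d) (lamMin H))).2 ha
        simpa [add_comm] using this
      have := csInf_le (spectrum_finite hH).bddBelow ha'
      simp only [lamMin] at this ⊢
      change 0 ≤ a
      linarith
  have := posSemidef_inner_nonneg hpsd x
  rw [act_sub, Algebra.algebraMap_eq_smul_one, act_smul, act_one] at this
  simp only [sub_apply, smul_apply,
    one_apply_eq_self, inner_sub_right, inner_smul_right,
    real_inner_self_eq_norm_sq] at this
  linarith

theorem inner_le_lamMax_mul {H : Mat d} (hH : H.IsHermitian) (x : Vec d) :
    inner ℝ x (act H x) ≤ lamMax H * ‖x‖ ^ 2 := by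
  have hpsd : (algebraMap ℝ (Mat d) (lamMax H) - H).PosSemidef := by
    rw [Matrix.posSemidef_iff_isHermitian_and_spectrum_nonneg]
    refine ⟨Matrix.IsHermitian.sub ?_ hH, ?_⟩
    · rw [Matrix.algebraMap_eq_diagonal]
      exact Matrix.isHermitian_diagonal _
    · intro a ha
      have ha' : lamMax H - a ∈ spectrum ℝ H := by
        have h1 := (spectrum.neg_eq (R := ℝ) (algebraMap ℝ (Mat d) (lamMax H) - H))
        have h2 : -a ∈ spectrum ℝ (H - algebraMap ℝ (Mat d) (lamMax H)) := by
          rw [← neg_sub, ← h1]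
          simpa using ha
        have := (spectrum.add_mem_add_iff (R := ℝ) (r := -a) (s := lamMax H)
          (a := H - algebraMap ℝ (Mat d) (lamMax H))).2 h2
        have h3 : -a + lamMax H = lamMax H - a := by ring
        rw [h3] at this
        simpa using this
      have := le_csSup (spectrum_finite hH).bddAbove ha'
      simp only [lamMax] at this ⊢
      change 0 ≤ a
      linarith
  have := posSemidef_inner_nonneg hpsd x
  rw [act_sub, Algebra.algebraMap_eq_smul_one, act_smul, act_one] at this
  simp only [sub_apply, smul_apply,
    one_apply_eq_self, inner_sub_right, inner_smul_right,
    real_inner_self_eq_norm_sq] at this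
  linarith

theorem isHermitian_add_transpose (A : Mat d) : (A + A.transpose).IsHermitian := by
  rw [← Matrix.conjTranspose_eq_transpose_of_trivial]
  exact Matrix.isHermitian_add_transpose_self A

theorem isHermitian_transpose_mul (A : Mat d) : (A.transpose * A).IsHermitian := by
  rw [← Matrix.conjTranspose_eq_transpose_of_trivial]
  exact Matrix.isHermitian_conjTranspose_mul_self A

theorem inner_act_add_transpose (A : Mat d) (x : Vec d) :
    inner ℝ x (act (A + A.transpose) x) = 2 * inner ℝ x (act A x) := by
  rw [act_add, add_apply, inner_add_right, inner_act_transpose,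
    real_inner_comm x (act A x)]
  ring

theorem inner_act_transpose_mul (A : Mat d) (x : Vec d) :
    inner ℝ x (act (A.transpose * A) x) = ‖act A x‖ ^ 2 := by
  rw [act_mul, mul_apply_eq_comp, inner_act_transpose, real_inner_self_eq_norm_sq]

/-- The spectrum is finite and nonempty, so λ_min is an eigenvalue; a unit eigenvector turns it into
2⟨x, Ax⟩ > 0. -/
theorem rate_pos (hd : 1 ≤ d) {A : Mat d} (hA : IsPosDef A) : 0 < rate A := by
  have hH := isHermitian_add_transpose A
  have hmem : lamMin (A + A.transpose) ∈ spectrum ℝ (A + A.transpose) :=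
    (spectrum_nonempty hd hH).csInf_mem (spectrum_finite hH)
  obtain ⟨i, hi⟩ := hH.spectrum_real_eq_range_eigenvalues ▸ hmem
  have hne : hH.eigenvectorBasis i ≠ 0 := hH.eigenvectorBasis.orthonormal.ne_zero i
  have hv := hA _ hne
  have h2 := inner_act_add_transpose A (hH.eigenvectorBasis i)
  have h3 : act (A + A.transpose) (hH.eigenvectorBasis i) =
      hH.eigenvalues i • hH.eigenvectorBasis i := by
    apply (WithLp.ofLp_injective 2)
    rw [Matrix.ofLp_toEuclideanCLM, hH.mulVec_eigenvectorBasis]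
    rfl
  rw [h3, inner_smul_right, real_inner_self_eq_norm_sq,
    hH.eigenvectorBasis.orthonormal.norm_eq_one] at h2
  unfold rate
  rw [← hi]
  linarith

theorem lamMax_transpose_mul_pos (hd : 1 ≤ d) {A : Mat d} (hA : IsPosDef A) :
    0 < lamMax (A.transpose * A) := by
  by_contra! hneg
  have : Nonempty (Fin d) := ⟨⟨0, hd⟩⟩
  obtain ⟨x, hx⟩ := exists_ne (0 : Vec d)
  have h1 := inner_le_lamMax_mul (isHermitian_transpose_mul A) x
  rw [inner_act_transpose_mul] at h1
  have h2 : ‖act A x‖ ^ 2 ≤ 0 := h1.trans (mul_nonpos_of_nonpos_of_nonneg hneg (by positivity))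
  have h3 : act A x = 0 := by
    rw [← norm_eq_zero]
    exact pow_eq_zero_iff two_ne_zero |>.1 (le_antisymm h2 (by positivity))
  have := hA x hx
  rw [h3, inner_zero_right] at this
  exact lt_irrefl _ this

/-- Expanding the square, ‖x - aAx‖² ≤ (1 - aλ_min + a²λ_max)‖x‖². The step condition says aλ_max ≤
λ_min - 2q, which leaves 1 - 2qa ≤ e^{-2qa}. -/
theorem norm_one_sub_smul_act_le (hd : 1 ≤ d) {A : Mat d} (hA : IsPosDef A) {a : ℝ} (ha : 0 ≤ a)
    (hle : a ≤ (lamMin (A + A.transpose) - 2 * rate A) / lamMax (A.transpose * A)) :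
    ‖(1 : Vec d →L[ℝ] Vec d) - a • act A‖ ≤ Real.exp (-(rate A * a)) := by
  refine ContinuousLinearMap.opNorm_le_bound _ (Real.exp_pos _).le fun x => ?_
  have hlam := lamMax_transpose_mul_pos hd hA
  rw [le_div_iff₀ hlam] at hle
  have hrate : lamMin (A + A.transpose) = 4 * rate A := by unfold rate; ring
  have h1 := lamMin_mul_le_inner (isHermitian_add_transpose A) x
  have h2 := inner_le_lamMax_mul (isHermitian_transpose_mul A) x
  rw [inner_act_add_transpose] at h1
  rw [inner_act_transpose_mul] at h2
  have h3 : ‖x - a • act A x‖ ^ 2 =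
      ‖x‖ ^ 2 - 2 * (a * inner ℝ x (act A x)) + a ^ 2 * ‖act A x‖ ^ 2 := by
    rw [norm_sub_sq_real, inner_smul_right, norm_smul, mul_pow, Real.norm_eq_abs, sq_abs]
  have hx2 : 0 ≤ ‖x‖ ^ 2 := by positivity
  have h4 : ‖x - a • act A x‖ ^ 2 ≤ (1 - 2 * rate A * a) * ‖x‖ ^ 2 := by
    rw [h3]
    have e1 := mul_le_mul_of_nonneg_left h1 ha
    have e2 := mul_le_mul_of_nonneg_left h2 (sq_nonneg a)
    have e3 := mul_le_mul_of_nonneg_right (mul_le_mul_of_nonneg_left hle ha) hx2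
    rw [hrate] at e1 e3
    nlinarith
  have h5 : (1 - 2 * rate A * a) ≤ Real.exp (-(rate A * a)) ^ 2 := by
    rw [← Real.exp_nat_mul]
    have := Real.add_one_le_exp (((2 : ℕ) : ℝ) * -(rate A * a))
    push_cast at this ⊢
    linarith
  change ‖x - a • act A x‖ ≤ _
  refine le_of_sq_le_sq ?_ (by positivity)
  rw [mul_pow]
  exact h4.trans (mul_le_mul_of_nonneg_right h5 hx2)

theorem step_pos (γ : ℝ) (n : ℕ) : 0 < step γ n := Real.rpow_pos_of_pos (by positivity) _

theorem step_le_one {γ : ℝ} (hγ : 0 ≤ γ) (n : ℕ) : step γ n ≤ 1 :=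
  Real.rpow_le_one_of_one_le_of_nonpos (by linarith [(Nat.cast_nonneg n : (0 : ℝ) ≤ n)])
    (by linarith)

theorem step_antitone {γ : ℝ} (hγ : 0 ≤ γ) : Antitone (step γ) := fun m n h =>
  Real.rpow_le_rpow_of_nonpos (by positivity) (by gcongr) (by linarith)

theorem norm_one_sub_step_smul_act_le (hd : 1 ≤ d) {A : Mat d} (hA : IsPosDef A) {γ : ℝ}
    (hγ : 0 < γ) {n : ℕ} (hn : smallStepIndex A γ ≤ n) :
    ‖(1 : Vec d →L[ℝ] Vec d) - step γ n • act A‖ ≤ Real.exp (-(rate A * step γ n)) := by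
  refine norm_one_sub_smul_act_le hd hA (step_pos γ n).le ?_
  have hpos : 0 < (lamMin (A + A.transpose) - 2 * rate A) / lamMax (A.transpose * A) := by
    refine div_pos ?_ (lamMax_transpose_mul_pos hd hA)
    have hrate : lamMin (A + A.transpose) = 4 * rate A := by unfold rate; ring
    have := rate_pos hd hA
    linarith
  have htend : Filter.Tendsto (step γ) Filter.atTop (nhds 0) :=
    (tendsto_rpow_neg_atTop hγ).comp
      (Filter.tendsto_atTop_add_const_right _ 1 tendsto_natCast_atTop_atTop)
  -- The infimum of an empty set of naturals would be the default 0, so the set must be shown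
  -- nonempty before its infimum is known to be a member.
  have hne : {K : ℕ | ∀ n : ℕ, K ≤ n →
    step γ n ≤ (lamMin (A + A.transpose) - 2 * rate A) / lamMax (A.transpose * A)}.Nonempty := by
    obtain ⟨K, hK⟩ := Filter.eventually_atTop.1 (htend.eventually (Iio_mem_nhds hpos))
    exact ⟨K, fun n hn => (hK n hn).le⟩
  exact Nat.sInf_mem hne n hn

theorem IsPosDef.isUnit_det {A : Mat d} (hA : IsPosDef A) : IsUnit A.det := by
  rw [isUnit_iff_ne_zero]
  intro h0
  obtain ⟨v, hv, hv0⟩ := Matrix.exists_mulVec_eq_zero_iff.2 h0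
  have := hA (WithLp.toLp 2 v) (by simpa using hv)
  rw [Matrix.toEuclideanCLM_toLp, hv0] at this
  simp at this

theorem one_le_prodConst (A : Mat d) (γ : ℝ) : 1 ≤ prodConst A γ := le_max_left _ _

/-- The term i = 1 of the maximum is 1, its sum being empty. This is all that is needed of D_θ and
D_w. -/
theorem exp_div_le_noiseConst {γ q : ℝ} {K : ℕ} (hq : 0 < q) (hK : 1 ≤ K) :
    Real.exp q / q ≤ noiseConst γ q K := by
  unfold noiseConst
  rw [mul_div_assoc]
  refine le_mul_of_one_le_left (by positivity) ?_
  have := le_ciSup (f := fun i : Finset.Icc 1 K => ((i : ℕ) : ℝ) ^ γ *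
    Real.exp (-q * ∑ k ∈ Finset.Ico 1 (i : ℕ), step γ k)) (Set.finite_range _).bddAbove
    ⟨1, Finset.mem_Icc.2 ⟨le_rfl, hK⟩⟩
  simpa using this

end MatrixBounds

/-! ### Comparison principle, exponential decay and slowly varying sequences. -/

section Comparison

/-- Discrete comparison with a supersolution B. The horizon N is finite because some recursions are
known only as long as the errors stay in range. -/
theorem le_of_linear_recursion {ρ f t B : ℕ → ℝ} {m N : ℕ} (h0 : t m ≤ B m)
    (hρ : ∀ n, 0 ≤ ρ n)
    (ht : ∀ n, m ≤ n → n < N → t (n + 1) ≤ ρ n * t n + f n)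
    (hB : ∀ n, m ≤ n → n < N → ρ n * B n + f n ≤ B (n + 1)) :
    ∀ n, m ≤ n → n ≤ N → t n ≤ B n := by
  intro n hmn
  induction n, hmn using Nat.le_induction with
  | base => exact fun _ => h0
  | succ n hn ih =>
    intro hN
    calc t (n + 1) ≤ ρ n * t n + f n := ht n hn (by omega)
      _ ≤ ρ n * B n + f n := by gcongr; exacts [hρ n, ih (by omega)]
      _ ≤ B (n + 1) := hB n hn (by omega)

/-- One step of a supersolution of `t' = e^{-qa} t + a f`. -/
theorem supersolution_step {q κ a f G G' : ℝ} (hκ : 0 < κ) (ha0 : 0 ≤ a) (ha1 : a ≤ 1)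
    (hG' : 0 ≤ G') (hf : f ≤ G') (hG : G ≤ Real.exp ((q - κ) * a) * G') :
    Real.exp (-(q * a)) * (Real.exp κ / κ * G) + a * f ≤ Real.exp κ / κ * G' := by
  have h1 : Real.exp (-(q * a)) * G ≤ Real.exp (-(κ * a)) * G' := by
    calc Real.exp (-(q * a)) * G
        ≤ Real.exp (-(q * a)) * (Real.exp ((q - κ) * a) * G') := by gcongr
      _ = Real.exp (-(κ * a)) * G' := by
        rw [← mul_assoc, ← Real.exp_add]; ring_nf
  -- One step of forcing is paid for by the loss 1 - e^{-κa}: use κa e^{-κa} ≤ 1 - e^{-κa}, and e^κ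
  -- e^{-κa} ≥ 1 since a ≤ 1.
  have h2 : a ≤ Real.exp κ / κ * (1 - Real.exp (-(κ * a))) := by
    have e1 : κ * a * Real.exp (-(κ * a)) ≤ 1 - Real.exp (-(κ * a)) := by
      have := Real.add_one_le_exp (κ * a)
      have h3 : Real.exp (κ * a) * Real.exp (-(κ * a)) = 1 := by
        rw [← Real.exp_add]; simp
      nlinarith [Real.exp_pos (-(κ * a))]
    have e2 : 1 ≤ Real.exp κ * Real.exp (-(κ * a)) := by
      rw [← Real.exp_add, ← Real.exp_zero]
      apply Real.exp_le_exp.2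
      nlinarith
    calc a ≤ a * (Real.exp κ * Real.exp (-(κ * a))) := le_mul_of_one_le_right ha0 e2
      _ = Real.exp κ / κ * (κ * a * Real.exp (-(κ * a))) := by field_simp
      _ ≤ _ := by gcongr
  have hK : 0 ≤ Real.exp κ / κ := by positivity
  have h3 := mul_le_mul_of_nonneg_left h1 hK
  have h4 := mul_le_mul_of_nonneg_left hf ha0
  have h5 := mul_le_mul_of_nonneg_right h2 hG'
  nlinarith

/-- The factor `exp(-q ∑_{m ≤ j < n} a_j)`. -/
noncomputable def decay (q : ℝ) (a : ℕ → ℝ) (m n : ℕ) : ℝ := Real.exp (-(q * ∑ j ∈ Finset.Ico m n, a j))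

theorem decay_pos (q : ℝ) (a : ℕ → ℝ) (m n : ℕ) : 0 < decay q a m n := Real.exp_pos _

theorem decay_self (q : ℝ) (a : ℕ → ℝ) (m : ℕ) : decay q a m m = 1 := by simp [decay]

theorem decay_succ (q : ℝ) (a : ℕ → ℝ) {m n : ℕ} (h : m ≤ n) :
    decay q a m (n + 1) = Real.exp (-(q * a n)) * decay q a m n := by
  rw [decay, decay, ← Real.exp_add, Finset.sum_Ico_succ_top h]
  ring_nf

theorem decay_eq_mul (q : ℝ) (a : ℕ → ℝ) {m n : ℕ} (h : m < n) :
    decay q a m n = Real.exp (-(q * a m)) * decay q a (m + 1) n := by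
  rw [decay, decay, ← Real.exp_add, Finset.sum_eq_sum_Ico_succ_bot h]
  ring_nf

theorem decay_le_decay {q q' : ℝ} {a a' : ℕ → ℝ} (m n : ℕ) (hq : 0 ≤ q) (hqq : q ≤ q')
    (ha : ∀ j, 0 ≤ a j) (haa : ∀ j, a j ≤ a' j) : decay q' a' m n ≤ decay q a m n := by
  apply Real.exp_le_exp.2
  have h1 : 0 ≤ ∑ j ∈ Finset.Ico m n, a j := Finset.sum_nonneg fun j _ => ha j
  have h2 : ∑ j ∈ Finset.Ico m n, a j ≤ ∑ j ∈ Finset.Ico m n, a' j :=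
    Finset.sum_le_sum fun j _ => haa j
  nlinarith

theorem decay_le_one {q : ℝ} {a : ℕ → ℝ} (m n : ℕ) (hq : 0 ≤ q) (ha : ∀ j, 0 ≤ a j) :
    decay q a m n ≤ 1 := by
  apply Real.exp_le_one_iff.2
  have h1 : 0 ≤ ∑ j ∈ Finset.Ico m n, a j := Finset.sum_nonneg fun j _ => ha j
  nlinarith

theorem step_mul_step (b c : ℝ) (n : ℕ) : step b n * step c n = step (b + c) n := by
  rw [step, step, step, ← Real.rpow_add (by positivity)]
  ring_nf

theorem step_div_step (b c : ℝ) (n : ℕ) : step b n / step c n = step (b - c) n := by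
  rw [div_eq_iff (step_pos c n).ne', step_mul_step]
  ring_nf

theorem step_zero (n : ℕ) : step 0 n = 1 := by simp [step]

theorem step_le_step {b c : ℝ} (h : b ≤ c) (n : ℕ) : step c n ≤ step b n :=
  Real.rpow_le_rpow_of_exponent_le (by linarith [(Nat.cast_nonneg n : (0 : ℝ) ≤ n)])
    (by linarith)

/-- The ratio of consecutive terms is (1 + 1/(n+1))^c, and 1 + s ≤ e^s. -/
theorem step_le_exp_mul_step_succ {c : ℝ} (hc : 0 ≤ c) (n : ℕ) :
    step c n ≤ Real.exp (c / (n + 1)) * step c (n + 1) := by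
  have hn : (0 : ℝ) < n + 1 := by positivity
  have h1 : ((n : ℝ) + 1 + 1) ≤ Real.exp (1 / (n + 1)) * (n + 1) := by
    have := Real.add_one_le_exp (1 / ((n : ℝ) + 1))
    calc (n : ℝ) + 1 + 1 = (1 / (n + 1) + 1) * (n + 1) := by field_simp; ring
      _ ≤ _ := by gcongr
  have h2 := Real.rpow_le_rpow (by positivity) h1 hc
  rw [Real.mul_rpow (by positivity) hn.le, ← Real.exp_mul] at h2
  unfold step
  push_cast
  rw [Real.rpow_neg hn.le, Real.rpow_neg (by positivity), inv_le_iff_one_le_mul₀ (by positivity),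
    mul_comm, ← mul_assoc, ← div_eq_mul_inv, one_le_div (by positivity)]
  rwa [one_div_mul_eq_div, mul_comm (Real.exp _)] at h2

/-- Nonnegative sequences that decrease at most like `(n+1)^(-c)`, from `n₀` on. -/
def IsSlow (c : ℝ) (n₀ : ℕ) (φ : ℕ → ℝ) : Prop :=
  ∀ n, n₀ ≤ n → 0 ≤ φ n ∧ φ n ≤ Real.exp (c / (n + 1)) * φ (n + 1)

theorem IsSlow.add {c : ℝ} {n₀ : ℕ} {φ ψ : ℕ → ℝ} (hφ : IsSlow c n₀ φ) (hψ : IsSlow c n₀ ψ) :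
    IsSlow c n₀ fun n => φ n + ψ n := fun n hn =>
  ⟨add_nonneg (hφ n hn).1 (hψ n hn).1, by
    rw [mul_add]; exact add_le_add (hφ n hn).2 (hψ n hn).2⟩

theorem IsSlow.const_mul {c : ℝ} {n₀ : ℕ} {φ : ℕ → ℝ} (hφ : IsSlow c n₀ φ) {a : ℝ} (ha : 0 ≤ a) :
    IsSlow c n₀ fun n => a * φ n := fun n hn =>
  ⟨mul_nonneg ha (hφ n hn).1, by
    rw [mul_left_comm]; exact mul_le_mul_of_nonneg_left (hφ n hn).2 ha⟩

/-- A monotone factor can only help, so the logarithm in ν costs nothing here. -/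
theorem isSlow_step_mul {b c : ℝ} {n₀ : ℕ} (hb : 0 ≤ b) (hbc : b ≤ c) {g : ℕ → ℝ}
    (hg0 : ∀ n, 0 ≤ g n) (hg : Monotone g) : IsSlow c n₀ fun n => step b n * g n := by
  refine fun n _ => ⟨mul_nonneg (step_pos _ _).le (hg0 n), ?_⟩
  calc step b n * g n ≤ (Real.exp (b / (n + 1)) * step b (n + 1)) * g (n + 1) :=
        mul_le_mul (step_le_exp_mul_step_succ hb n) (hg n.le_succ) (hg0 n)
          (mul_nonneg (Real.exp_pos _).le (step_pos _ _).le)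
    _ ≤ (Real.exp (c / (n + 1)) * step b (n + 1)) * g (n + 1) := by
        have := hg0 (n + 1)
        have := (step_pos b (n + 1)).le
        gcongr
    _ = _ := by ring

theorem isSlow_step {b c : ℝ} {n₀ : ℕ} (hb : 0 ≤ b) (hbc : b ≤ c) : IsSlow c n₀ (step b) := by
  simpa using isSlow_step_mul (n₀ := n₀) hb hbc (fun _ => zero_le_one) monotone_const

/-- Each contraction factor e^{-q a_j} is at most e^{-c/(j+1)}, which already outweighs the
polynomial decrease over one step. -/
theorem decay_mul_step_le {q c : ℝ} {a : ℕ → ℝ} (hc : 0 ≤ c) {m n : ℕ} (hmn : m ≤ n)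
    (h : ∀ j, m ≤ j → c / (j + 1) ≤ q * a j) :
    decay q a m n * step c m ≤ step c n := by
  induction n, hmn using Nat.le_induction with
  | base => simp [decay_self]
  | succ n hn ih =>
    rw [decay_succ _ _ hn, mul_assoc]
    calc Real.exp (-(q * a n)) * (decay q a m n * step c m)
        ≤ Real.exp (-(q * a n)) * step c n := by gcongr
      _ ≤ Real.exp (-(q * a n)) * (Real.exp (q * a n) * step c (n + 1)) := by
        gcongr
        refine (step_le_exp_mul_step_succ hc n).trans ?_
        have := step_pos c (n + 1)
        gcongr
        exact h n hn
      _ = step c (n + 1) := by rw [← mul_assoc, ← Real.exp_add]; simp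

/-- The variance proxy of a contracted noise sum. -/
theorem variance_recursion_le {q γ : ℝ} (hq : 0 < q) (hγ : 0 ≤ γ) {n₀ : ℕ} {V : ℕ → ℝ}
    (h0 : V n₀ = 0)
    (hV : ∀ n, n₀ ≤ n → V (n + 1) = Real.exp (-(q * step γ n)) ^ 2 * V n + step γ n ^ 2)
    (hslow : ∀ n, n₀ ≤ n → γ / (n + 1) ≤ q * step γ (n + 1)) :
    ∀ n, n₀ ≤ n → V (n + 1) ≤ Real.exp q / q * step γ n := by
  have hexp : ∀ n, Real.exp (-(q * step γ n)) ^ 2 = Real.exp (-(2 * q * step γ n)) := fun n => by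
    rw [← Real.exp_nat_mul]; congr 1; push_cast; ring
  intro n hn
  induction n, hn using Nat.le_induction with
  | base =>
    rw [hV n₀ le_rfl, h0, mul_zero, zero_add, sq]
    refine mul_le_mul_of_nonneg_right ((step_le_one hγ _).trans ?_) (step_pos _ _).le
    rw [le_div_iff₀ hq]
    linarith [Real.add_one_le_exp q]
  | succ n hn ih =>
    rw [hV (n + 1) (by omega), hexp]
    have hs := step_pos γ (n + 1)
    -- Squaring doubles the rate to 2q. One half, κ = q, produces e^q/q; the other half absorbs the
    -- decrease of the stepsizes.
    refine le_trans ?_ (supersolution_step (q := 2 * q) (f := step γ (n + 1)) (G := step γ n)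
      hq hs.le (step_le_one hγ _) hs.le le_rfl ?_)
    · rw [sq]
      gcongr
    · refine (step_le_exp_mul_step_succ hγ n).trans ?_
      gcongr
      have := hslow n hn
      linarith

end Comparison

/-! ### Elementary inequalities behind the index thresholds. -/

theorem opNorm_nonneg {d : ℕ} (A : Mat d) : 0 ≤ opNorm A := norm_nonneg _

theorem opNorm_mul_le {d : ℕ} (A B : Mat d) : opNorm (A * B) ≤ opNorm A * opNorm B := by
  unfold opNorm
  rw [act_mul]
  exact norm_mul_le _ _

theorem le_rpow_of_rpow_one_div_le {x y e : ℝ} (hx : 0 ≤ x) (he : 0 < e)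
    (h : x ^ (1 / e) ≤ y) : x ≤ y ^ e := by
  calc x = (x ^ (1 / e)) ^ e := by
        rw [← Real.rpow_mul hx, one_div_mul_cancel he.ne', Real.rpow_one]
    _ ≤ y ^ e := Real.rpow_le_rpow (Real.rpow_nonneg hx _) h he.le

/-- The factor 4 splits into 2 for the halved rate q/2 and 2 for the shifted index, (n+2)^γ ≤
2(n+1)^γ. -/
theorem div_le_half_mul_step {q c γ : ℝ} (hq : 0 < q) (hc : 0 ≤ c) (hγ0 : 0 < γ) (hγ1 : γ < 1)
    {n₀ n : ℕ} (h : (4 * c / q) ^ (1 / (1 - γ)) ≤ (n₀ : ℝ)) (hn : n₀ ≤ n) :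
    c / (n + 1) ≤ q / 2 * step γ (n + 1) := by
  have hnp : (0 : ℝ) < n + 1 := by positivity
  have hn' : (n₀ : ℝ) ≤ n + 1 := by
    have : (n₀ : ℝ) ≤ n := by exact_mod_cast hn
    linarith
  have h1 := le_rpow_of_rpow_one_div_le (by positivity) (by linarith) h
  have h2 : 4 * c / q ≤ ((n : ℝ) + 1) ^ (1 - γ) :=
    h1.trans (Real.rpow_le_rpow (by positivity) hn' (by linarith))
  rw [div_le_iff₀ hq] at h2
  have h3 : ((n : ℝ) + 1 + 1) ^ γ ≤ 2 * ((n : ℝ) + 1) ^ γ := by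
    calc ((n : ℝ) + 1 + 1) ^ γ ≤ (2 * ((n : ℝ) + 1)) ^ γ :=
          Real.rpow_le_rpow (by positivity) (by linarith [(Nat.cast_nonneg n : (0 : ℝ) ≤ n)]) hγ0.le
      _ = 2 ^ γ * ((n : ℝ) + 1) ^ γ := Real.mul_rpow (by norm_num) hnp.le
      _ ≤ 2 ^ (1 : ℝ) * ((n : ℝ) + 1) ^ γ := by
          gcongr
          norm_num
      _ = _ := by rw [Real.rpow_one]
  have h4 : ((n : ℝ) + 1) ^ (1 - γ) * ((n : ℝ) + 1) ^ γ = n + 1 := by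
    rw [← Real.rpow_add hnp]; simp
  have hg : 0 < ((n : ℝ) + 1) ^ γ := by positivity
  unfold step
  push_cast
  rw [Real.rpow_neg (by positivity), ← div_eq_mul_inv,
    div_le_div_iff₀ hnp (by positivity)]
  calc c * ((n : ℝ) + 1 + 1) ^ γ ≤ c * (2 * ((n : ℝ) + 1) ^ γ) := by gcongr
    _ = 1 / 2 * (4 * c * ((n : ℝ) + 1) ^ γ) := by ring
    _ ≤ 1 / 2 * (((n : ℝ) + 1) ^ (1 - γ) * q * ((n : ℝ) + 1) ^ γ) := by gcongr
    _ = q / 2 * (n + 1) := by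
      rw [mul_right_comm _ q, h4]; ring

theorem div_le_mul_step {q c γ : ℝ} {n : ℕ} (h : c ≤ q * ((n : ℝ) + 1) ^ (1 - γ)) :
    c / (n + 1) ≤ q * step γ n := by
  have hnp : (0 : ℝ) < n + 1 := by positivity
  rw [div_le_iff₀ hnp, step, mul_assoc]
  refine h.trans (le_of_eq ?_)
  rw [sub_eq_neg_add, Real.rpow_add hnp, Real.rpow_one]

/-- If `t ≥ 2 b ln(2bc)` then `t ≥ b ln(tc)`. -/
theorem mul_log_le_of_two_mul_log_le {b c t : ℝ} (hb : 0 < b) (hc : 0 < c) (ht : 0 < t)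
    (h : b * (2 * Real.log (2 * b * c)) ≤ t) : b * Real.log (t * c) ≤ t := by
  -- In this splitting ln s ≤ s - 1 bounds the first logarithm at a cost of t/2, and the hypothesis
  -- bounds the second by t/2.
  have h1 : t * c = t / (2 * b) * (2 * b * c) := by field_simp
  rw [h1, Real.log_mul (by positivity) (by positivity), mul_add]
  have h2 := Real.log_le_sub_one_of_pos (show 0 < t / (2 * b) by positivity)
  have h3 : b * Real.log (t / (2 * b)) ≤ b * (t / (2 * b)) := by gcongr; linarith
  have h4 : b * (t / (2 * b)) = t / 2 := by field_simp
  linarith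

/-- The standing assumptions on the data. -/
structure Data.Valid {d : ℕ} (P : Data d) : Prop where
  one_le_dim : 1 ≤ d
  posDef_W₂ : IsPosDef P.W₂
  posDef_X₁ : IsPosDef P.X₁
  β_pos : 0 < P.β
  β_lt_α : P.β < P.α
  α_lt_one : P.α < 1
  m₁_pos : 0 < P.m₁
  m₂_pos : 0 < P.m₂
  Rθ_pos : 0 < P.Rθ
  Rw_pos : 0 < P.Rw
  one_lt_p : 1 < P.p
  δ_pos : 0 < P.δ
  δ_lt_one : P.δ < 1
  one_le_Kθ : 1 ≤ P.Kθ
  one_le_Kw : 1 ≤ P.Kw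

/-! ### Signs of the constants and properties of ν. -/

namespace Data

variable {d : ℕ} {P : Data d}

/-- The factor `√(ln(4 d² (n+1)^p / δ))` of `ν`. -/
noncomputable def logFactor (P : Data d) (n : ℕ) : ℝ :=
  Real.sqrt (Real.log (4 * (d : ℝ) ^ 2 * ((n : ℝ) + 1) ^ P.p / P.δ))

theorem ν_eq (n : ℕ) (γ : ℝ) : P.ν n γ = step (γ / 2) n * P.logFactor n := by
  rw [ν, logFactor, step, neg_div]

theorem Cθ_pos : 0 < P.Cθ := zero_lt_one.trans_le (one_le_prodConst _ _)

theorem Cw_pos : 0 < P.Cw := zero_lt_one.trans_le (one_le_prodConst _ _)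

theorem Ca_pos : 0 < P.Ca := mul_pos (Cθ_pos (P := P)) (zero_lt_one.trans_le (le_max_right _ _))

namespace Valid

variable (h : P.Valid)
include h

theorem α_pos : 0 < P.α := h.β_pos.trans h.β_lt_α

theorem q₁_pos : 0 < P.q₁ := rate_pos h.one_le_dim h.posDef_X₁

theorem q₂_pos : 0 < P.q₂ := rate_pos h.one_le_dim h.posDef_W₂

theorem qmin_pos : 0 < P.qmin := lt_min h.q₁_pos h.q₂_pos

theorem dim_pos : (0 : ℝ) < d := by exact_mod_cast h.one_le_dim

theorem exp_div_le_Dθ : Real.exp P.q₁ / P.q₁ ≤ P.Dθ := exp_div_le_noiseConst h.q₁_pos h.one_le_Kθ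

theorem exp_div_le_Dw : Real.exp P.q₂ / P.q₂ ≤ P.Dw := exp_div_le_noiseConst h.q₂_pos h.one_le_Kw

theorem Dθ_pos : 0 < P.Dθ := (div_pos (Real.exp_pos _) h.q₁_pos).trans_le h.exp_div_le_Dθ

theorem Dw_pos : 0 < P.Dw := (div_pos (Real.exp_pos _) h.q₂_pos).trans_le h.exp_div_le_Dw

theorem CRw_pos : 0 < P.CRw := by
  have := h.q₂_pos
  have := Cw_pos (P := P)
  have := h.Rθ_pos
  have := h.Rw_pos
  have := opNorm_nonneg P.Γ₂
  unfold CRw CRθ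
  positivity

theorem size_pos : 0 < P.size := by
  have := h.CRw_pos
  have := h.Rθ_pos
  have := h.Rw_pos
  unfold size CRθ
  positivity

theorem Lθ_pos : 0 < P.Lθ := by
  have := h.size_pos
  have := Cθ_pos (P := P)
  have := h.m₁_pos
  have := h.m₂_pos
  have := opNorm_nonneg P.W₁
  have := opNorm_nonneg P.W₂⁻¹
  unfold Lθ
  positivity

theorem Lw_pos : 0 < P.Lw := by
  have := h.size_pos
  have := Cw_pos (P := P)
  have := h.m₂_pos
  unfold Lw
  positivity

theorem CT_nonneg : 0 ≤ P.CT := by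
  have := opNorm_nonneg P.X₁
  have := h.β_lt_α
  unfold CT
  have : 0 ≤ P.α - P.β := by linarith
  positivity

theorem Eθ_nonneg : 0 ≤ P.Eθ := by
  have := h.q₂_pos
  have := Cw_pos (P := P)
  have := opNorm_nonneg P.W₁
  have := opNorm_nonneg P.W₂⁻¹
  have := opNorm_nonneg P.Γ₂
  unfold Eθ CRθ
  positivity

theorem Ew_nonneg : 0 ≤ P.Ew := by
  have := h.q₁_pos
  have := Cθ_pos (P := P)
  have := h.CRw_pos
  have := h.CT_nonneg
  have := opNorm_nonneg P.W₁
  have := opNorm_nonneg P.W₂⁻¹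
  unfold Ew
  positivity

theorem Cb_nonneg : 0 ≤ P.Cb := by
  have := h.q₁_pos
  have := Cθ_pos (P := P)
  have := h.CT_nonneg
  have := opNorm_nonneg (P.W₁ * P.W₂⁻¹)
  unfold Cb
  positivity

theorem A₂_nonneg : 0 ≤ P.A₂ := by
  have := h.q₂_pos
  have := Cw_pos (P := P)
  have := h.Cb_nonneg
  have := opNorm_nonneg P.Γ₂
  unfold A₂
  positivity

theorem log_arg_pos (n : ℕ) : 0 < 4 * (d : ℝ) ^ 2 * ((n : ℝ) + 1) ^ P.p / P.δ := by
  have := h.dim_pos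
  have := h.δ_pos
  positivity

theorem four_le_log_arg (n : ℕ) : 4 ≤ 4 * (d : ℝ) ^ 2 * ((n : ℝ) + 1) ^ P.p / P.δ := by
  have hd : (1 : ℝ) ≤ d := by exact_mod_cast h.one_le_dim
  have hδ := h.δ_pos
  rw [le_div_iff₀ hδ]
  have h1 : (1 : ℝ) ≤ ((n : ℝ) + 1) ^ P.p :=
    Real.one_le_rpow (by linarith [(Nat.cast_nonneg n : (0 : ℝ) ≤ n)]) (by linarith [h.one_lt_p])
  have h2 : (1 : ℝ) ≤ (d : ℝ) ^ 2 := one_le_pow₀ hd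
  have h3 := h.δ_lt_one
  nlinarith [mul_le_mul h2 h1 zero_le_one (by positivity)]

theorem one_le_log (n : ℕ) : 1 ≤ Real.log (4 * (d : ℝ) ^ 2 * ((n : ℝ) + 1) ^ P.p / P.δ) := by
  rw [Real.le_log_iff_exp_le (h.log_arg_pos n)]
  linarith [h.four_le_log_arg n, Real.exp_one_lt_d9]

theorem one_le_logFactor (n : ℕ) : 1 ≤ P.logFactor n := by
  rw [logFactor, Real.one_le_sqrt]
  exact h.one_le_log n

theorem logFactor_nonneg (n : ℕ) : 0 ≤ P.logFactor n := zero_le_one.trans (h.one_le_logFactor n)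

theorem logFactor_mono : Monotone P.logFactor := by
  intro m n hmn
  have hm := h.log_arg_pos m
  have hδ := h.δ_pos
  have hp := h.one_lt_p
  unfold logFactor
  gcongr

theorem ν_pos (n : ℕ) (γ : ℝ) : 0 < P.ν n γ := by
  rw [ν_eq]
  exact mul_pos (step_pos _ _) (zero_lt_one.trans_le (h.one_le_logFactor n))

theorem εw_pos (n : ℕ) : 0 < P.εw n := by
  have := h.Lw_pos
  have := h.Dw_pos
  have := h.dim_pos
  have := h.ν_pos n P.β
  unfold εw
  positivity

theorem ν_sq (n : ℕ) (γ : ℝ) : P.ν n γ ^ 2 =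
    step γ n * Real.log (4 * (d : ℝ) ^ 2 * ((n : ℝ) + 1) ^ P.p / P.δ) := by
  rw [ν_eq, mul_pow, logFactor, Real.sq_sqrt (zero_le_one.trans (h.one_le_log n)), sq,
    step_mul_step, add_halves]

theorem ν_isSlow {γ c : ℝ} (hγ : 0 ≤ γ) (hc : γ / 2 ≤ c) (n₀ : ℕ) :
    IsSlow c n₀ fun n => P.ν n γ := by
  have := isSlow_step_mul (n₀ := n₀) (by positivity) hc h.logFactor_nonneg h.logFactor_mono
  simpa only [ν_eq] using this

/-- Apply `mul_log_le_of_two_mul_log_le` with t = (n+1)^γ and c = (4d²/δ)^(γ/p): then tc is the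
(γ/p)-th power of the argument of the logarithm in ν. -/
theorem mul_log_le_of_logIndex_le {B γ : ℝ} (hB : 0 < B) (hγ : 0 < γ) {n : ℕ}
    (hn : P.logIndex B γ ≤ (n : ℝ) + 1) :
    B * (γ / P.p * Real.log (4 * (d : ℝ) ^ 2 * ((n : ℝ) + 1) ^ P.p / P.δ)) ≤
      ((n : ℝ) + 1) ^ γ := by
  have hd := h.dim_pos
  have hδ := h.δ_pos
  have hp : 0 < P.p := by linarith [h.one_lt_p]
  have hnp : (0 : ℝ) < n + 1 := by positivity
  unfold logIndex at hn
  rw [← Real.mul_rpow hB.le (le_max_left _ _)] at hn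
  have h1 := le_rpow_of_rpow_one_div_le (mul_nonneg hB.le (le_max_left _ _)) hγ hn
  have h2 := mul_log_le_of_two_mul_log_le (c := (4 * (d : ℝ) ^ 2 / P.δ) ^ (γ / P.p)) hB
    (by positivity) (show 0 < ((n : ℝ) + 1) ^ γ by positivity)
    ((mul_le_mul_of_nonneg_left (le_max_right _ _) hB.le).trans h1)
  convert h2 using 2
  rw [← Real.log_rpow (h.log_arg_pos n)]
  congr 1
  rw [mul_div_right_comm, Real.mul_rpow (by positivity) (by positivity), ← Real.rpow_mul hnp.le,
    mul_comm]
  congr 2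
  field_simp

theorem sqrt_mul_ν_le {L D R γ : ℝ} (hL : 0 < L) (hD : 0 < D) (hR : 0 < R) (hγ : 0 < γ) {n : ℕ}
    (hn : P.logIndex (4 * (d : ℝ) ^ 3 * L * D * P.p / (γ * R ^ 2)) γ ≤ (n : ℝ) + 1) :
    Real.sqrt ((d : ℝ) ^ 3 * L * D) * P.ν n γ ≤ R / 2 := by
  have hd := h.dim_pos
  have hp : 0 < P.p := by linarith [h.one_lt_p]
  have h1 := h.mul_log_le_of_logIndex_le (by positivity) hγ hn
  refine le_of_sq_le_sq ?_ (by positivity)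
  rw [mul_pow, Real.sq_sqrt (by positivity), h.ν_sq, step, Real.rpow_neg (by positivity),
    inv_mul_eq_div, ← mul_div_assoc, div_le_iff₀ (by positivity)]
  set l := Real.log (4 * (d : ℝ) ^ 2 * ((n : ℝ) + 1) ^ P.p / P.δ)
  have h2 : 4 * (d : ℝ) ^ 3 * L * D * P.p / (γ * R ^ 2) * (γ / P.p * l) =
      4 / R ^ 2 * ((d : ℝ) ^ 3 * L * D * l) := by field_simp
  rw [h2, div_mul_eq_mul_div, div_le_iff₀ (by positivity)] at h1
  nlinarith

end Valid

end Data

/-! ### Consequences of the lower bound on n₀. -/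

namespace Data

variable {d : ℕ} {P : Data d}

/-- The quantitative consequences of `N ≤ n₀`. -/
structure Admissible (P : Data d) (n₀ : ℕ) : Prop extends P.Valid where
  three_le : 3 ≤ n₀
  contract₁ : ∀ n, n₀ ≤ n →
    ‖(1 : Vec d →L[ℝ] Vec d) - step P.α n • act P.X₁‖ ≤ Real.exp (-(P.q₁ * step P.α n))
  contract₂ : ∀ n, n₀ ≤ n →
    ‖(1 : Vec d →L[ℝ] Vec d) - step P.β n • act P.W₂‖ ≤ Real.exp (-(P.q₂ * step P.β n))
  slow₁ : ∀ n, n₀ ≤ n → (P.α - P.β / 2) / (n + 1) ≤ P.q₁ / 2 * step P.α (n + 1)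
  slow₂ : ∀ n, n₀ ≤ n → (P.α - P.β / 2) / (n + 1) ≤ P.q₂ / 2 * step P.β (n + 1)
  slow_le_sub : ∀ n, n₀ ≤ n → (P.α - P.β / 2) / (n + 1) ≤ P.α - P.β
  slow_le_half : ∀ n, n₀ ≤ n → (P.α - P.β / 2) / (n + 1) ≤ 1 / 2
  step_α_le : ∀ n, n₀ ≤ n → step P.α n ≤ step P.β n / 2
  q₂_mul_step_le : ∀ n, n₀ ≤ n → P.q₂ * step P.β n ≤ 1
  half_α_div_le : ∀ n, n₀ ≤ n → P.α / 2 / (n + 1) ≤ P.qmin * step P.α n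
  εθ_le : ∀ n, n₀ ≤ n → P.εθ n ≤ P.Rθ / 2
  εw_le : ∀ n, n₀ ≤ n → P.εw n ≤ P.Rw / 2
  εθ_le_εw : ∀ n, n₀ ≤ n → P.εθ n ≤ P.εw n
  ν_succ_le : ∀ n, n₀ ≤ n → P.ν (n + 1) P.β ≤ P.ν n P.β
  step_mul_le : ∀ n, n₀ ≤ n →
    step (P.α - P.β) n * (P.Eθ * P.Rθ + P.Ew * P.Rw) ≤ 3 / 2 * P.Rθ

theorem log_arg_succ (hP : P.Valid) (n : ℕ) :
    Real.log (4 * (d : ℝ) ^ 2 * (((n + 1 : ℕ) : ℝ) + 1) ^ P.p / P.δ) =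
      Real.log (4 * (d : ℝ) ^ 2 * ((n : ℝ) + 1) ^ P.p / P.δ) +
        P.p * Real.log (((n + 1 : ℕ) + 1) / ((n : ℝ) + 1)) := by
  have hd := hP.dim_pos
  have hδ := hP.δ_pos
  rw [← Real.log_rpow (by positivity), ← Real.log_mul (hP.log_arg_pos n).ne' (by positivity),
    Real.div_rpow (by positivity) (by positivity)]
  congr 1
  field_simp

/-- With τ = ln((n+2)/(n+1)), passing to n+1 divides the power in ν² by e^{βτ} and adds pτ to the
logarithm l. If p ≤ βl, then l + pτ ≤ (1 + βτ)l ≤ e^{βτ}l. -/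
theorem ν_succ_le_of_p_le (hP : P.Valid) {n : ℕ}
    (hn : P.p ≤ P.β * Real.log (4 * (d : ℝ) ^ 2 * ((n : ℝ) + 1) ^ P.p / P.δ)) :
    P.ν (n + 1) P.β ≤ P.ν n P.β := by
  refine le_of_sq_le_sq ?_ (hP.ν_pos n _).le
  rw [hP.ν_sq, hP.ν_sq, log_arg_succ hP]
  set l := Real.log (4 * (d : ℝ) ^ 2 * ((n : ℝ) + 1) ^ P.p / P.δ)
  set τ := Real.log (((n + 1 : ℕ) + 1) / ((n : ℝ) + 1)) with hτ
  have hnp : (0 : ℝ) < n + 1 := by positivity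
  have hτ0 : 0 ≤ τ := Real.log_nonneg (by rw [one_le_div hnp]; push_cast; linarith)
  have h1 : step P.β n = Real.exp (P.β * τ) * step P.β (n + 1) := by
    have e1 : ((n + 1 : ℕ) : ℝ) + 1 = (n + 1) * Real.exp τ := by
      rw [hτ, Real.exp_log (by positivity)]; field_simp
    unfold step
    rw [e1, Real.mul_rpow hnp.le (Real.exp_pos _).le, ← Real.exp_mul, mul_left_comm,
      ← Real.exp_add]
    ring_nf
    simp
  rw [h1, mul_comm (Real.exp _), mul_assoc]
  have hl := zero_le_one.trans (hP.one_le_log n)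
  refine mul_le_mul_of_nonneg_left ?_ (step_pos _ _).le
  calc l + P.p * τ ≤ l + P.β * l * τ := by gcongr
    _ = (P.β * τ + 1) * l := by ring
    _ ≤ _ := by gcongr; exact Real.add_one_le_exp _

/-- The threshold is the real x at which β ln(4d²x^p/δ) equals p. -/
theorem p_le_of_le (hP : P.Valid) {n₀ n : ℕ}
    (h : Real.exp (1 / P.β) * P.δ ^ (1 / P.p) / (4 * (d : ℝ) ^ 2) ^ (1 / P.p) ≤ n₀)
    (hn : n₀ ≤ n) : P.p ≤ P.β * Real.log (4 * (d : ℝ) ^ 2 * ((n : ℝ) + 1) ^ P.p / P.δ) := by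
  have hd := hP.dim_pos
  have hδ := hP.δ_pos
  have hβ := hP.β_pos
  have hp : 0 < P.p := by linarith [hP.one_lt_p]
  have hn' : (n₀ : ℝ) ≤ n + 1 := by
    have : (n₀ : ℝ) ≤ n := by exact_mod_cast hn
    linarith
  have h1 := Real.log_le_log (by positivity) (h.trans hn')
  rw [Real.log_div (by positivity) (by positivity), Real.log_mul (by positivity) (by positivity),
    Real.log_exp, Real.log_rpow (by positivity), Real.log_rpow (by positivity)] at h1
  rw [Real.log_div (by positivity) (by positivity), Real.log_mul (by positivity) (by positivity),
    Real.log_rpow (by positivity)]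
  set x := Real.log P.δ
  set y := Real.log (4 * (d : ℝ) ^ 2)
  set z := Real.log ((n : ℝ) + 1)
  have h2 := mul_le_mul_of_nonneg_left h1 (mul_pos hβ hp).le
  have h3 : P.β * P.p * (1 / P.β + 1 / P.p * x - 1 / P.p * y) = P.p + P.β * x - P.β * y := by
    field_simp
  rw [h3] at h2
  linarith

theorem εθ_le_εw_of_le (hP : P.Valid) {n₀ n : ℕ} (h : P.K₆a ≤ n₀) (hn : n₀ ≤ n) :
    P.εθ n ≤ P.εw n := by
  have hd := hP.dim_pos
  have hLθ := hP.Lθ_pos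
  have hLw := hP.Lw_pos
  have hDθ := hP.Dθ_pos
  have hDw := hP.Dw_pos
  have hαβ : 0 < P.α - P.β := by linarith [hP.β_lt_α]
  have hnp : (0 : ℝ) < n + 1 := by positivity
  have hn' : (n₀ : ℝ) ≤ n + 1 := by
    have : (n₀ : ℝ) ≤ n := by exact_mod_cast hn
    linarith
  have h1 := le_rpow_of_rpow_one_div_le (by positivity) hαβ (h.trans hn')
  rw [div_le_iff₀ (by positivity)] at h1
  have h2 : P.Lθ * P.Dθ * step P.α n ≤ P.Lw * P.Dw * step P.β n := by
    have e1 : ((n : ℝ) + 1) ^ (P.α - P.β) * step P.α n = step P.β n := by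
      rw [step, step, ← Real.rpow_add hnp]; ring_nf
    calc P.Lθ * P.Dθ * step P.α n ≤
        ((n : ℝ) + 1) ^ (P.α - P.β) * (P.Lw * P.Dw) * step P.α n :=
          mul_le_mul_of_nonneg_right h1 (step_pos _ _).le
      _ = P.Lw * P.Dw * (((n : ℝ) + 1) ^ (P.α - P.β) * step P.α n) := by ring
      _ = _ := by rw [e1]
  refine le_of_sq_le_sq ?_ (hP.εw_pos n).le
  rw [εθ, εw, mul_pow, mul_pow, Real.sq_sqrt (by positivity), Real.sq_sqrt (by positivity),
    hP.ν_sq, hP.ν_sq]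
  have hl := zero_le_one.trans (hP.one_le_log n)
  set l := Real.log (4 * (d : ℝ) ^ 2 * ((n : ℝ) + 1) ^ P.p / P.δ)
  calc (d : ℝ) ^ 3 * P.Lθ * P.Dθ * (step P.α n * l)
      = (d : ℝ) ^ 3 * (P.Lθ * P.Dθ * step P.α n) * l := by ring
    _ ≤ (d : ℝ) ^ 3 * (P.Lw * P.Dw * step P.β n) * l := by gcongr
    _ = _ := by ring

theorem Valid.admissible (hP : P.Valid) {n₀ : ℕ} (hn₀ : P.N ≤ n₀) : P.Admissible n₀ := by
  have hβ := hP.β_pos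
  have hβα := hP.β_lt_α
  have hα := hP.α_lt_one
  have hα0 := hP.α_pos
  have hq₁ := hP.q₁_pos
  have hq₂ := hP.q₂_pos
  have hqm := hP.qmin_pos
  have hRθ := hP.Rθ_pos
  have hRw := hP.Rw_pos
  have hαβ : 0 < P.α - P.β := by linarith
  have hc0 : 0 < P.α - P.β / 2 := by linarith
  have hc1 : P.α - P.β / 2 ≤ 1 := by linarith
  obtain ⟨hb, hr⟩ := max_le_iff.1 hn₀
  unfold Nbdd at hb
  unfold Nrate at hr
  have hr' := le_sub_iff_add_le.2 hr
  simp only [max_le_iff] at hb hr'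
  obtain ⟨hS₁, hS₂, -, hK₃α, hK₃β, hK₄, -⟩ := hb
  obtain ⟨hK₂α, hK₂β, hexp, hK₅a, -, hK₆a, hK₆b⟩ := hr'
  have hsub : P.α - P.β + P.β / 2 = P.α - P.β / 2 := by ring
  rw [K₂α, max_le_iff, hsub] at hK₂α
  rw [K₂β, max_le_iff, hsub] at hK₂β
  have hK₂α2 := (Nat.le_ceil _).trans hK₂α.2
  have hK₂β1 := (Nat.le_ceil _).trans hK₂β.1
  have hK₂β2 := (Nat.le_ceil _).trans hK₂β.2
  have hle : (n₀ : ℝ) - 1 ≤ n₀ := by linarith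
  have hcast : ∀ n, n₀ ≤ n → (n₀ : ℝ) ≤ n + 1 := fun n hn => by
    have : (n₀ : ℝ) ≤ n := by exact_mod_cast hn
    linarith
  have hinv : 1 ≤ 1 / (P.α - P.β) := by
    rw [le_div_iff₀ hαβ]; linarith
  -- Bernoulli's inequality for (1 + 1)^(1/(α-β)) makes `K₅a` also dominate 1/(α-β), as
  -- `slow_le_sub` requires.
  have hbern : 1 + 1 / (P.α - P.β) ≤ n₀ := by
    have := one_add_mul_self_le_rpow_one_add (s := 1) (by norm_num) hinv
    have e : (1 : ℝ) + 1 = 2 := by norm_num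
    rw [mul_one, e] at this
    exact this.trans (hK₅a.trans hle)
  -- The final +1 in N'' matters here: it upgrades `K₅a` ≥ 2 to n₀ ≥ 3.
  have h2le : (2 : ℝ) ≤ (n₀ : ℝ) - 1 := by
    refine le_trans ?_ hK₅a
    calc (2 : ℝ) = 2 ^ (1 : ℝ) := (Real.rpow_one _).symm
      _ ≤ 2 ^ (1 / (P.α - P.β)) := Real.rpow_le_rpow_of_exponent_le (by norm_num) hinv
  have hn₀p : (0 : ℝ) < n₀ := by linarith
  refine
    { toValid := hP
      three_le := ?_
      contract₁ := fun n hn => norm_one_sub_step_smul_act_le hP.one_le_dim hP.posDef_X₁ hα0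
        (le_trans (by exact_mod_cast hS₁) hn)
      contract₂ := fun n hn => norm_one_sub_step_smul_act_le hP.one_le_dim hP.posDef_W₂ hβ
        (le_trans (by exact_mod_cast hS₂) hn)
      slow₁ := fun n hn => div_le_half_mul_step hq₁ hc0.le hα0 hα (hK₂α2.trans hle) hn
      slow₂ := fun n hn =>
        div_le_half_mul_step hq₂ hc0.le hβ (by linarith) (hK₂β2.trans hle) hn
      slow_le_sub := fun n hn => ?_
      slow_le_half := fun n hn => ?_
      step_α_le := fun n hn => ?_
      q₂_mul_step_le := fun n hn => ?_
      half_α_div_le := fun n hn => ?_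
      εθ_le := fun n hn => hP.sqrt_mul_ν_le hP.Lθ_pos hP.Dθ_pos hRθ hα0
        (hK₃α.trans (hcast n hn))
      εw_le := fun n hn => hP.sqrt_mul_ν_le hP.Lw_pos hP.Dw_pos hRw hβ
        (hK₃β.trans (hcast n hn))
      εθ_le_εw := fun n hn => εθ_le_εw_of_le hP (hK₆a.trans hle) hn
      ν_succ_le := fun n hn => ν_succ_le_of_p_le hP (p_le_of_le hP (hexp.trans hle) hn)
      step_mul_le := fun n hn => ?_ }
  · have : (3 : ℝ) ≤ n₀ := by linarith
    exact_mod_cast this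
  · have hnp : (0 : ℝ) < n + 1 := by positivity
    rw [div_le_iff₀ hnp]
    have h1 : 1 / (P.α - P.β) ≤ (n : ℝ) + 1 := by linarith [hcast n hn]
    rw [div_le_iff₀ hαβ] at h1
    linarith
  · rw [div_le_iff₀ (by positivity)]
    linarith [hcast n hn]
  · have hnp : (0 : ℝ) < n + 1 := by positivity
    have h1 := le_rpow_of_rpow_one_div_le (by norm_num) hαβ ((hK₅a.trans hle).trans (hcast n hn))
    have h2 : step P.β n = ((n : ℝ) + 1) ^ (P.α - P.β) * step P.α n := by
      rw [step, step, ← Real.rpow_add hnp]; ring_nf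
    rw [h2]
    nlinarith [step_pos P.α n]
  · have h1 := le_rpow_of_rpow_one_div_le (by positivity) hβ ((hK₂β1.trans hle).trans (hcast n hn))
    rw [div_le_iff₀ hc0] at h1
    rw [step, Real.rpow_neg (by positivity), ← div_eq_mul_inv, div_le_one (by positivity)]
    refine h1.trans (mul_le_of_le_one_right (by positivity) hc1)
  · apply div_le_mul_step
    have h1 := le_rpow_of_rpow_one_div_le (by positivity) (by linarith)
      ((hK₆b.trans hle).trans (hcast n hn))
    have h2 := mul_le_mul_of_nonneg_left h1 hqm.le
    have h3 : P.qmin * (1 + P.α / (2 * P.qmin)) = P.qmin + P.α / 2 := by field_simp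
    linarith
  · have hEθ := hP.Eθ_nonneg
    have hEw := hP.Ew_nonneg
    have h1 := le_rpow_of_rpow_one_div_le (by positivity) hαβ (hK₄.trans (hcast n hn))
    have h2 : step (P.α - P.β) n * ((n : ℝ) + 1) ^ (P.α - P.β) = 1 := by
      rw [step, ← Real.rpow_add (by positivity)]; simp
    have h3 := mul_le_mul_of_nonneg_left h1 (step_pos (P.α - P.β) n).le
    rw [h2] at h3
    have h4 : step (P.α - P.β) n * (P.Eθ * P.Rθ + P.Ew * P.Rw) =
        3 / 2 * (step (P.α - P.β) n * (2 / 3 * P.Eθ + 2 / 3 * P.Ew * (P.Rw / P.Rθ))) * P.Rθ := by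
      field_simp
    rw [h4]
    nlinarith

/-- This quotient is the integral of x^(-p) over [n₀, ∞), which controls the union bound over n ≥
n₀. -/
theorem Valid.one_le_mul_rpow (hP : P.Valid) {n₀ : ℕ} (hn₀ : P.N ≤ n₀) :
    (n₀ : ℝ) ^ (1 - P.p) / (P.p - 1) ≤ 1 := by
  have hp : 0 < P.p - 1 := by linarith [hP.one_lt_p]
  obtain ⟨hb, hr⟩ := max_le_iff.1 hn₀
  unfold Nbdd at hb
  simp only [max_le_iff] at hb
  have h1 := hb.2.2.2.2.2.2
  have h2 := Real.rpow_le_rpow (by positivity) h1 hp.le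
  rw [← Real.rpow_mul hp.le, div_mul_cancel₀ _ hp.ne', Real.rpow_neg_one] at h2
  have h0 : (0 : ℝ) < n₀ := lt_of_lt_of_le (by positivity) h1
  have h3 : (n₀ : ℝ) ^ (1 - P.p) = ((n₀ : ℝ) ^ (P.p - 1))⁻¹ := by
    rw [← Real.rpow_neg h0.le]; ring_nf
  rw [h3, div_le_one hp]
  exact inv_le_of_inv_le₀ hp h2

end Data

/-! ### Scalar error recursions and persistence of the range. -/

namespace Data

variable {d : ℕ} {P : Data d} {n₀ : ℕ} {x y z t : ℕ → ℝ}

/-- The bounds `x ≤ C_R^θ Rθ`, `y ≤ C_R^w Rw` hold on `[n₀, n]`. -/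
def InRange (P : Data d) (n₀ : ℕ) (x y : ℕ → ℝ) (n : ℕ) : Prop :=
  ∀ k, n₀ ≤ k → k ≤ n → x k ≤ CRθ * P.Rθ ∧ y k ≤ P.CRw * P.Rw

/-- Scalar inequalities between the error norms `x`, `y` and the noise-free parts `z`, `t`. They
are assumed as long as the errors stay in range. -/
structure ErrorRecursion (P : Data d) (n₀ : ℕ) (x y z t : ℕ → ℝ) : Prop where
  x_nonneg : ∀ n, 0 ≤ x n
  y_nonneg : ∀ n, 0 ≤ y n
  z_init : P.InRange n₀ x y n₀ → z (n₀ + 1) ≤ Real.exp (-(P.q₁ * step P.α n₀)) * x n₀ +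
    opNorm (P.W₁ * P.W₂⁻¹) * step (P.α - P.β) n₀ * y n₀
  z_succ : ∀ n, n₀ ≤ n → P.InRange n₀ x y (n + 1) →
    z (n + 2) ≤ Real.exp (-(P.q₁ * step P.α (n + 1))) * z (n + 1) + step P.α (n + 1) *
      (P.CT * opNorm (P.W₁ * P.W₂⁻¹) * (step (P.α - P.β) (n + 1) * y (n + 1)))
  x_le : ∀ n, n₀ ≤ n → x (n + 1) ≤
    z (n + 1) + P.εθ n + opNorm (P.W₁ * P.W₂⁻¹) * (step (P.α - P.β) n * y (n + 1))
  t_init : t n₀ ≤ y n₀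
  t_succ : ∀ n, n₀ ≤ n → P.InRange n₀ x y n →
    t (n + 1) ≤ Real.exp (-(P.q₂ * step P.β n)) * t n + step P.β n * (opNorm P.Γ₂ * x n)
  y_le : ∀ n, n₀ ≤ n → y (n + 1) ≤ t (n + 1) + P.εw n

theorem exp_le_of_le_mul {a b c : ℝ} (h : a ≤ b) (hc : 0 ≤ c) :
    Real.exp a * c ≤ Real.exp b * c := by gcongr

/-- Half the rate (κ = q₁/2) sums the forcing; the other half compensates the decrease of r_k u_k,
by `slow₁`. -/
theorem ErrorRecursion.z_le (h : P.Admissible n₀) (hr : P.ErrorRecursion n₀ x y z t) {u : ℕ → ℝ}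
    {n : ℕ} (hn : n₀ ≤ n) (hin : P.InRange n₀ x y n) (hyu : ∀ k, n₀ ≤ k → k ≤ n → y k ≤ u k)
    (hu : IsSlow (P.α - P.β / 2) n₀ fun k => step (P.α - P.β) k * u k) :
    z (n + 1) ≤ decay P.q₁ (step P.α) (n₀ + 1) (n + 1) *
        (Real.exp (-(P.q₁ * step P.α n₀)) * x n₀ +
          opNorm (P.W₁ * P.W₂⁻¹) * step (P.α - P.β) n₀ * y n₀) +
      Real.exp (P.q₁ / 2) / (P.q₁ / 2) *
        (P.CT * opNorm (P.W₁ * P.W₂⁻¹) * (step (P.α - P.β) n * u n)) := by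
  have hq := h.q₁_pos
  have hs : 0 ≤ P.CT * opNorm (P.W₁ * P.W₂⁻¹) := mul_nonneg h.CT_nonneg (opNorm_nonneg _)
  set J := Real.exp (-(P.q₁ * step P.α n₀)) * x n₀ +
    opNorm (P.W₁ * P.W₂⁻¹) * step (P.α - P.β) n₀ * y n₀
  -- The correction inside z(k+1) carries r_k, so the first datum is z(n₀ + 1) and the comparison
  -- runs along shifted indices.
  have key := le_of_linear_recursion (m := n₀) (N := n) (t := fun k => z (k + 1))
    (ρ := fun k => Real.exp (-(P.q₁ * step P.α (k + 1))))
    (f := fun k => step P.α (k + 1) *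
      (P.CT * opNorm (P.W₁ * P.W₂⁻¹) * (step (P.α - P.β) (k + 1) * y (k + 1))))
    (B := fun k => decay P.q₁ (step P.α) (n₀ + 1) (k + 1) * J +
      Real.exp (P.q₁ / 2) / (P.q₁ / 2) *
        (P.CT * opNorm (P.W₁ * P.W₂⁻¹) * (step (P.α - P.β) k * u k)))
    ?_ (fun _ => (Real.exp_pos _).le) ?_ ?_ n hn le_rfl
  · exact key
  · simp only [decay_self, one_mul]
    refine (hr.z_init fun k hk1 hk2 => hin k hk1 (by omega)).trans (le_add_of_nonneg_right ?_)
    have := (hu n₀ le_rfl).1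
    positivity
  · exact fun k hk hkn => hr.z_succ k hk fun j hj1 hj2 => hin j hj1 (by omega)
  · intro k hk hkn
    rw [decay_succ _ _ (show n₀ + 1 ≤ k + 1 by omega), mul_add, add_assoc]
    refine add_le_add (by rw [mul_assoc]) (supersolution_step (by positivity) (step_pos _ _).le
      (step_le_one h.α_pos.le _) ?_ ?_ ?_)
    · exact mul_nonneg hs (hu (k + 1) (by omega)).1
    · have := hyu (k + 1) (by omega) (by omega)
      have := (step_pos (P.α - P.β) (k + 1)).le
      gcongr
    · rw [mul_left_comm (Real.exp _)]
      refine mul_le_mul_of_nonneg_left ((hu k hk).2.trans ?_) hs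
      apply exp_le_of_le_mul _ (hu (k + 1) (by omega)).1
      have := h.slow₁ k hk
      linarith

/-- Induction on time. For y: Rw from the start, Rw/2 from noise, the rest of C_R^w Rw from the
forcing by x ≤ 3Rθ. For x: Rθ from the start, Rθ/2 from noise, and at most 3Rθ/2 from the coupling,
by the threshold `K₄`; together 3Rθ. -/
theorem ErrorRecursion.inRange (h : P.Admissible n₀) (hr : P.ErrorRecursion n₀ x y z t)
    (hx₀ : x n₀ ≤ P.Rθ) (hy₀ : y n₀ ≤ P.Rw) : ∀ n, n₀ ≤ n → P.InRange n₀ x y n := by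
  have hq₁ := h.q₁_pos
  have hq₂ := h.q₂_pos
  have hRθ := h.Rθ_pos
  have hRw := h.Rw_pos
  have hg := opNorm_nonneg P.Γ₂
  have hCw : 1 ≤ P.Cw := one_le_prodConst _ _
  have hCθ : 1 ≤ P.Cθ := one_le_prodConst _ _
  have hCRw : P.CRw * P.Rw =
      3 / 2 * P.Rw + Real.exp P.q₂ / P.q₂ * (P.Cw * (opNorm P.Γ₂ * (CRθ * P.Rθ))) := by
    unfold CRw CRθ; field_simp
  have hstep1 : ∀ n, Real.exp (-(P.q₁ * step P.α n)) ≤ 1 := fun n =>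
    Real.exp_le_one_iff.2 (by nlinarith [step_pos P.α n])
  intro n hn
  induction n, hn using Nat.le_induction with
  | base =>
    intro k hk1 hk2
    obtain rfl : k = n₀ := le_antisymm hk2 hk1
    refine ⟨by unfold CRθ; linarith, ?_⟩
    have : 0 ≤ Real.exp P.q₂ / P.q₂ * (P.Cw * (opNorm P.Γ₂ * (CRθ * P.Rθ))) := by
      unfold CRθ; positivity
    linarith
  | succ n hn ih =>
    have hCRθ : 0 ≤ CRθ * P.Rθ := by unfold CRθ; positivity
    have ht := le_of_linear_recursion (m := n₀) (N := n + 1) (t := t)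
      (ρ := fun k => Real.exp (-(P.q₂ * step P.β k)))
      (f := fun k => step P.β k * (opNorm P.Γ₂ * x k))
      (B := fun k => decay P.q₂ (step P.β) n₀ k * y n₀ +
        Real.exp P.q₂ / P.q₂ * (opNorm P.Γ₂ * (CRθ * P.Rθ)))
      (by
        simp only [decay_self, one_mul]
        exact hr.t_init.trans (le_add_of_nonneg_right (by positivity)))
      (fun _ => (Real.exp_pos _).le)
      (fun k hk hkn => hr.t_succ k hk fun j hj1 hj2 => ih j hj1 (by omega))
      (fun k hk hkn => by
        rw [decay_succ _ _ hk, mul_add, add_assoc]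
        refine add_le_add (by rw [mul_assoc]) (supersolution_step hq₂ (step_pos _ _).le
          (step_le_one h.β_pos.le _) (by positivity) ?_ (by simp))
        have := (ih k hk (by omega)).1
        gcongr)
      (n + 1) (by omega) le_rfl
    have hy : y (n + 1) ≤ 3 / 2 * P.Rw +
        Real.exp P.q₂ / P.q₂ * (opNorm P.Γ₂ * (CRθ * P.Rθ)) := by
      have h1 := hr.y_le n hn
      have h2 := h.εw_le n hn
      have h3 : decay P.q₂ (step P.β) n₀ (n + 1) * y n₀ ≤ P.Rw :=
        (mul_le_of_le_one_left (hr.y_nonneg _)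
          (decay_le_one _ _ hq₂.le fun j => (step_pos _ j).le)).trans hy₀
      linarith
    have hCw' : Real.exp P.q₂ / P.q₂ * (opNorm P.Γ₂ * (CRθ * P.Rθ)) ≤
        Real.exp P.q₂ / P.q₂ * (P.Cw * (opNorm P.Γ₂ * (CRθ * P.Rθ))) :=
      mul_le_mul_of_nonneg_left (le_mul_of_one_le_left (by positivity) hCw) (by positivity)
    have hy' : y (n + 1) ≤ P.CRw * P.Rw := by linarith
    have hx : x (n + 1) ≤ CRθ * P.Rθ := by
      have hz := hr.z_le h hn ih (fun k hk1 hk2 => (ih k hk1 hk2).2)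
        (isSlow_step_mul (by linarith [h.β_lt_α]) (by linarith [h.β_pos])
          (fun _ => mul_nonneg h.CRw_pos.le hRw.le) monotone_const)
      have h1 := hr.x_le n hn
      have h2 := h.εθ_le n hn
      have hs := opNorm_nonneg (P.W₁ * P.W₂⁻¹)
      have hCT := h.CT_nonneg
      have hr0 := (step_pos (P.α - P.β) n₀).le
      have hrn := (step_pos (P.α - P.β) n).le
      have hYR := mul_nonneg h.CRw_pos.le hRw.le
      have h3 : decay P.q₁ (step P.α) (n₀ + 1) (n + 1) *
        (Real.exp (-(P.q₁ * step P.α n₀)) * x n₀ +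
          opNorm (P.W₁ * P.W₂⁻¹) * step (P.α - P.β) n₀ * y n₀) ≤
          P.Rθ + opNorm (P.W₁ * P.W₂⁻¹) * step (P.α - P.β) n₀ * P.Rw := by
        have hx0 := hr.x_nonneg n₀
        have hy0 := hr.y_nonneg n₀
        refine (mul_le_of_le_one_left (by positivity)
          (decay_le_one _ _ hq₁.le fun j => (step_pos _ j).le)).trans ?_
        gcongr
        exact (mul_le_of_le_one_left hx0 (hstep1 _)).trans hx₀
      have hanti : step (P.α - P.β) n ≤ step (P.α - P.β) n₀ :=
        step_antitone (by linarith [h.β_lt_α]) hn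
      have h4 : opNorm (P.W₁ * P.W₂⁻¹) * (step (P.α - P.β) n * y (n + 1)) ≤
          opNorm (P.W₁ * P.W₂⁻¹) * (step (P.α - P.β) n₀ * (3 / 2 * P.Rw +
            Real.exp P.q₂ / P.q₂ * (P.Cw * (opNorm P.Γ₂ * (CRθ * P.Rθ))))) := by
        have := hr.y_nonneg (n + 1)
        gcongr
        linarith
      have h5 : Real.exp (P.q₁ / 2) / (P.q₁ / 2) * (P.CT * opNorm (P.W₁ * P.W₂⁻¹) *
          (step (P.α - P.β) n * (P.CRw * P.Rw))) ≤
          2 * Real.exp (P.q₁ / 2) / P.q₁ * P.CT * P.Cθ * opNorm (P.W₁ * P.W₂⁻¹) *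
          (step (P.α - P.β) n₀ * (P.CRw * P.Rw)) := by
        calc Real.exp (P.q₁ / 2) / (P.q₁ / 2) * (P.CT * opNorm (P.W₁ * P.W₂⁻¹) *
              (step (P.α - P.β) n * (P.CRw * P.Rw)))
            = 2 * Real.exp (P.q₁ / 2) / P.q₁ * P.CT * 1 * opNorm (P.W₁ * P.W₂⁻¹) *
              (step (P.α - P.β) n * (P.CRw * P.Rw)) := by field_simp
          _ ≤ _ := by gcongr
      have h6 := h.step_mul_le n₀ le_rfl
      have hsW : opNorm (P.W₁ * P.W₂⁻¹) ≤ opNorm P.W₁ * opNorm P.W₂⁻¹ := opNorm_mul_le _ _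
      set s := opNorm (P.W₁ * P.W₂⁻¹)
      set r₀ := step (P.α - P.β) n₀
      set K := 2 * Real.exp (P.q₁ / 2) / P.q₁ * P.CT * P.Cθ
      have hK : 0 ≤ K := by positivity
      have hCR := h.CRw_pos
      -- All coupling terms at once: 5/2 is 1 from the initial value of z plus 3/2 from the
      -- correction r S f.
      have h7 : s * (r₀ * (5 / 2 * P.Rw +
          Real.exp P.q₂ / P.q₂ * (P.Cw * (opNorm P.Γ₂ * (CRθ * P.Rθ))) + K * P.CRw * P.Rw)) ≤
          r₀ * (P.Eθ * P.Rθ + P.Ew * P.Rw) := by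
        calc s * (r₀ * (5 / 2 * P.Rw +
          Real.exp P.q₂ / P.q₂ * (P.Cw * (opNorm P.Γ₂ * (CRθ * P.Rθ))) + K * P.CRw * P.Rw)) ≤
          (opNorm P.W₁ * opNorm P.W₂⁻¹) * (r₀ * (5 / 2 * P.Rw +
          Real.exp P.q₂ / P.q₂ * (P.Cw * (opNorm P.Γ₂ * (CRθ * P.Rθ))) + K * P.CRw * P.Rw)) := by
              gcongr
          _ = _ := by unfold Eθ Ew; ring
      have h8 : P.Rθ + s * r₀ * P.Rw + K * s * (r₀ * (P.CRw * P.Rw)) +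
          s * (r₀ * (3 / 2 * P.Rw +
            Real.exp P.q₂ / P.q₂ * (P.Cw * (opNorm P.Γ₂ * (CRθ * P.Rθ))))) =
          P.Rθ + s * (r₀ * (5 / 2 * P.Rw +
            Real.exp P.q₂ / P.q₂ * (P.Cw * (opNorm P.Γ₂ * (CRθ * P.Rθ))) +
              K * P.CRw * P.Rw)) := by ring
      have h9 : CRθ * P.Rθ = 3 * P.Rθ := rfl
      linarith
    intro k hk1 hk2
    rcases Nat.lt_or_ge k (n + 1) with hk | hk
    · exact ih k hk1 (by omega)
    · obtain rfl : k = n + 1 := le_antisymm hk2 hk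
      exact ⟨hx, hy'⟩

end Data

/-! ### One round of rate improvement. -/

namespace Data

variable {d : ℕ} {P : Data d} {n₀ : ℕ} {x y z t : ℕ → ℝ}

/-- In C_b the summand 1 pays for the correction r S f and the other summand for the forcing of z.
Monotonicity of u moves the correction from index n+1 back to n. -/
theorem ErrorRecursion.x_le_of_y_le (h : P.Admissible n₀) (hr : P.ErrorRecursion n₀ x y z t)
    (hin : ∀ n, n₀ ≤ n → P.InRange n₀ x y n) {u : ℕ → ℝ} (hyu : ∀ k, n₀ ≤ k → y k ≤ u k)
    (hu : IsSlow (P.α - P.β / 2) n₀ fun k => step (P.α - P.β) k * u k)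
    (hanti : ∀ k, n₀ ≤ k → u (k + 1) ≤ u k) {n : ℕ} (hn : n₀ ≤ n) :
    x (n + 1) ≤ decay P.q₁ (step P.α) (n₀ + 1) (n + 1) *
        (P.Ca * (x n₀ + step (P.α - P.β) n₀ * y n₀)) +
      P.εθ n + P.Cb * (step (P.α - P.β) n * u n) := by
  have hq₁ := h.q₁_pos
  have hs := opNorm_nonneg (P.W₁ * P.W₂⁻¹)
  have hCT := h.CT_nonneg
  have hCθ : 1 ≤ P.Cθ := one_le_prodConst _ _
  have hx0 := hr.x_nonneg n₀
  have hy0 := hr.y_nonneg n₀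
  have hr0 := (step_pos (P.α - P.β) n₀).le
  have hrn := (step_pos (P.α - P.β) n).le
  have hdec := (decay_pos P.q₁ (step P.α) (n₀ + 1) (n + 1)).le
  have hun := (hu n hn).1
  have h1 := hr.x_le n hn
  have h2 := hr.z_le h hn (hin n hn) (fun k hk _ => hyu k hk) hu
  have h3 : y (n + 1) ≤ u n := (hyu _ (by omega)).trans (hanti n hn)
  have h4 : Real.exp (-(P.q₁ * step P.α n₀)) * x n₀ +
      opNorm (P.W₁ * P.W₂⁻¹) * step (P.α - P.β) n₀ * y n₀ ≤
      P.Ca * (x n₀ + step (P.α - P.β) n₀ * y n₀) := by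
    have e1 : Real.exp (-(P.q₁ * step P.α n₀)) ≤ P.Ca := by
      refine (Real.exp_le_one_iff.2 (by nlinarith [step_pos P.α n₀])).trans ?_
      exact one_le_mul_of_one_le_of_one_le hCθ (le_max_right _ _)
    have e2 : opNorm (P.W₁ * P.W₂⁻¹) ≤ P.Ca :=
      (le_max_left _ _).trans (le_mul_of_one_le_left (hs.trans (le_max_left _ _)) hCθ)
    rw [mul_add, ← mul_assoc P.Ca]
    gcongr
  have h5 : opNorm (P.W₁ * P.W₂⁻¹) * (step (P.α - P.β) n * y (n + 1)) ≤
      opNorm (P.W₁ * P.W₂⁻¹) * (step (P.α - P.β) n * u n) := by gcongr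
  have h6 : Real.exp (P.q₁ / 2) / (P.q₁ / 2) * (P.CT * opNorm (P.W₁ * P.W₂⁻¹) *
      (step (P.α - P.β) n * u n)) ≤ opNorm (P.W₁ * P.W₂⁻¹) *
        (2 * Real.exp (P.q₁ / 2) / P.q₁ * P.CT * P.Cθ) * (step (P.α - P.β) n * u n) := by
    calc Real.exp (P.q₁ / 2) / (P.q₁ / 2) * (P.CT * opNorm (P.W₁ * P.W₂⁻¹) *
          (step (P.α - P.β) n * u n)) = opNorm (P.W₁ * P.W₂⁻¹) *
          (2 * Real.exp (P.q₁ / 2) / P.q₁ * P.CT * 1) * (step (P.α - P.β) n * u n) := by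
            field_simp
      _ ≤ _ := by gcongr
  have h7 := mul_le_mul_of_nonneg_left h4 hdec
  have h8 : P.Cb * (step (P.α - P.β) n * u n) =
      opNorm (P.W₁ * P.W₂⁻¹) * (step (P.α - P.β) n * u n) + opNorm (P.W₁ * P.W₂⁻¹) *
        (2 * Real.exp (P.q₁ / 2) / P.q₁ * P.CT * P.Cθ) * (step (P.α - P.β) n * u n) := by
    unfold Cb; ring
  linarith

theorem Admissible.decay_mul_le (h : P.Admissible n₀) {c : ℝ} (hc : 0 ≤ c) (hcα : c ≤ P.α / 2)
    {m n : ℕ} (hm : n₀ ≤ m) (hmn : m ≤ n) :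
    decay P.qmin (step P.α) m n * (step c m * P.logFactor m) ≤ step c n * P.logFactor n := by
  have h1 := decay_mul_step_le (q := P.qmin) (a := step P.α) hc hmn fun j hj => by
    refine le_trans ?_ (h.half_α_div_le j (hm.trans hj))
    gcongr
  rw [← mul_assoc]
  exact mul_le_mul h1 (h.logFactor_mono hmn) (h.logFactor_nonneg _) (step_pos _ _).le

/-- This lets initial errors be written as multiples of ε^w_n, at the price of the division by
ε^w_{n₀} in A₁. -/
theorem Admissible.decay_le_εw_div (h : P.Admissible n₀) {n : ℕ} (hn : n₀ ≤ n) :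
    decay P.qmin (step P.α) n₀ n ≤ P.εw n / P.εw n₀ := by
  rw [le_div_iff₀ (h.εw_pos n₀), εw, εw, ν_eq, ν_eq, mul_left_comm]
  refine mul_le_mul_of_nonneg_left (h.decay_mul_le (by linarith [h.β_pos])
    (by linarith [h.β_lt_α]) le_rfl hn) (Real.sqrt_nonneg _)

theorem Admissible.εw_isSlow (h : P.Admissible n₀) : IsSlow (P.α - P.β / 2) n₀ P.εw :=
  (h.ν_isSlow h.β_pos.le (by linarith [h.β_lt_α]) n₀).const_mul (Real.sqrt_nonneg _)

/-- The bound on x splits the forcing of t into the decaying initial error, the slow noise and the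
coupling. By linearity each receives its own supersolution. -/
theorem ErrorRecursion.t_le (h : P.Admissible n₀) (hr : P.ErrorRecursion n₀ x y z t)
    (hin : ∀ n, n₀ ≤ n → P.InRange n₀ x y n) {u : ℕ → ℝ} (hyu : ∀ k, n₀ ≤ k → y k ≤ u k)
    (hu : IsSlow (P.α - P.β / 2) n₀ fun k => step (P.α - P.β) k * u k)
    (hanti : ∀ k, n₀ ≤ k → u (k + 1) ≤ u k) {n : ℕ} (hn : n₀ ≤ n) :
    t (n + 1) ≤ decay P.q₂ (step P.β) (n₀ + 1) (n + 1) *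
        (Real.exp (-(P.q₂ * step P.β n₀)) * y n₀ + step P.β n₀ * (opNorm P.Γ₂ * x n₀)) +
      Real.exp (P.qmin / 2) / (P.qmin / 2) * (opNorm P.Γ₂ * (Real.exp (P.q₁ * step P.α n₀) *
        (P.Ca * (x n₀ + step (P.α - P.β) n₀ * y n₀)) *
        (Real.exp (P.qmin * step P.α n₀) * decay P.qmin (step P.α) n₀ (n + 1)))) +
      Real.exp (P.q₂ / 2) / (P.q₂ / 2) * (opNorm P.Γ₂ * (Real.exp (1 / 2) * P.εw n)) +
      Real.exp (P.q₂ / 2) / (P.q₂ / 2) * (opNorm P.Γ₂ * (P.Cb * (Real.exp (P.α - P.β) *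
        (step (P.α - P.β) n * u n)))) := by
  have hq₁ := h.q₁_pos
  have hq₂ := h.q₂_pos
  have hqm := h.qmin_pos
  have hqm₁ : P.qmin ≤ P.q₁ := min_le_left _ _
  have hqm₂ : P.qmin ≤ P.q₂ := min_le_right _ _
  have hg := opNorm_nonneg P.Γ₂
  have hCa := Ca_pos (P := P)
  have hCb := h.Cb_nonneg
  have hx0 := hr.x_nonneg n₀
  have hy0 := hr.y_nonneg n₀
  have hr0 := (step_pos (P.α - P.β) n₀).le
  have hα0 : ∀ j, 0 ≤ step P.α j := fun j => (step_pos _ j).le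
  have hβ0 : ∀ j, 0 ≤ step P.β j := fun j => (step_pos _ j).le
  set J := P.Ca * (x n₀ + step (P.α - P.β) n₀ * y n₀) with hJ
  have hJ0 : 0 ≤ J := by positivity
  set E := decay P.qmin (step P.α) n₀ with hE
  have hE0 : ∀ k, 0 ≤ E k := fun k => (decay_pos _ _ _ k).le
  set I₀ := Real.exp (-(P.q₂ * step P.β n₀)) * y n₀ + step P.β n₀ * (opNorm P.Γ₂ * x n₀) with hI₀
  have hI₀0 : 0 ≤ I₀ := by have := hβ0 n₀; positivity
  set g := opNorm P.Γ₂
  set r : ℕ → ℝ := step (P.α - P.β) with hrdef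
  have hdecay : ∀ k, n₀ ≤ k → decay P.q₁ (step P.α) (n₀ + 1) (k + 1) ≤
      Real.exp (P.q₁ * step P.α n₀) * E (k + 1) := fun k hk => by
    have e1 := decay_eq_mul P.q₁ (step P.α) (show n₀ < k + 1 by omega)
    have e2 := decay_le_decay n₀ (k + 1) hqm.le hqm₁ hα0 (fun _ => le_rfl)
    calc decay P.q₁ (step P.α) (n₀ + 1) (k + 1)
        = Real.exp (P.q₁ * step P.α n₀) * decay P.q₁ (step P.α) n₀ (k + 1) := by
          rw [e1, ← mul_assoc, ← Real.exp_add]; simp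
      _ ≤ _ := by gcongr
  have hEsucc : ∀ k, n₀ ≤ k → E (k + 1) = Real.exp (-(P.qmin * step P.α k)) * E k :=
    fun k hk => decay_succ _ _ hk
  have hG₁ : ∀ k, n₀ ≤ k → 0 ≤ g * (Real.exp (P.q₁ * step P.α n₀) * J *
      (Real.exp (P.qmin * step P.α n₀) * E (k + 1))) := fun k _ => by
    have := hE0 (k + 1); positivity
  have hG₂ : ∀ k, n₀ ≤ k → 0 ≤ g * (Real.exp (1 / 2) * P.εw k) := fun k _ => by
    have := h.εw_pos k; positivity
  have hG₃ : ∀ k, n₀ ≤ k → 0 ≤ g * (P.Cb * (Real.exp (P.α - P.β) * (r k * u k))) := fun k hk => by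
    have := (hu k hk).1
    positivity
  have key := le_of_linear_recursion (m := n₀) (N := n) (t := fun k => t (k + 1))
    (ρ := fun k => Real.exp (-(P.q₂ * step P.β (k + 1))))
    (f := fun k => step P.β (k + 1) * (g * x (k + 1)))
    (B := fun k => decay P.q₂ (step P.β) (n₀ + 1) (k + 1) * I₀ +
      Real.exp (P.qmin / 2) / (P.qmin / 2) * (g * (Real.exp (P.q₁ * step P.α n₀) * J *
        (Real.exp (P.qmin * step P.α n₀) * E (k + 1)))) +
      Real.exp (P.q₂ / 2) / (P.q₂ / 2) * (g * (Real.exp (1 / 2) * P.εw k)) +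
      Real.exp (P.q₂ / 2) / (P.q₂ / 2) * (g * (P.Cb * (Real.exp (P.α - P.β) * (r k * u k)))))
    ?_ (fun _ => (Real.exp_pos _).le) ?_ ?_ n hn le_rfl
  · exact key
  · simp only [decay_self, one_mul]
    have e1 := hr.t_succ n₀ le_rfl (hin n₀ le_rfl)
    have e2 : Real.exp (-(P.q₂ * step P.β n₀)) * t n₀ ≤
        Real.exp (-(P.q₂ * step P.β n₀)) * y n₀ :=
      mul_le_mul_of_nonneg_left hr.t_init (Real.exp_pos _).le
    have e3 := hG₁ n₀ le_rfl
    have e4 := hG₂ n₀ le_rfl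
    have e5 := hG₃ n₀ le_rfl
    have e6 : 0 ≤ Real.exp (P.qmin / 2) / (P.qmin / 2) := by positivity
    have e7 : 0 ≤ Real.exp (P.q₂ / 2) / (P.q₂ / 2) := by positivity
    have := mul_nonneg e6 e3
    have := mul_nonneg e7 e4
    have := mul_nonneg e7 e5
    linarith
  · exact fun k hk _ => hr.t_succ (k + 1) (by omega) (hin _ (by omega))
  · intro k hk _
    have hk' : n₀ ≤ k + 1 := by omega
    have hxk := hr.x_le_of_y_le h hin hyu hu hanti hk
    have hslow₂ : (P.α - P.β / 2) / (k + 1) ≤ (P.q₂ - P.q₂ / 2) * step P.β (k + 1) := by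
      have := h.slow₂ k hk
      linarith
    -- This forcing decays exponentially itself, at rate qmin α_k. Since α_k ≤ β_k/2, that rate fits
    -- into (q₂ - qmin/2)β_k. The factor exp(qmin α_{n₀}) covers the offset by one index between
    -- forcing and majorant.
    have s₁ := supersolution_step (q := P.q₂) (κ := P.qmin / 2) (a := step P.β (k + 1))
      (f := g * (Real.exp (P.q₁ * step P.α n₀) * J * E (k + 1)))
      (G := g * (Real.exp (P.q₁ * step P.α n₀) * J *
        (Real.exp (P.qmin * step P.α n₀) * E (k + 1)))) (by positivity) (hβ0 _)
      (step_le_one h.β_pos.le _) (hG₁ (k + 1) hk')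
      (by
        rw [hEsucc (k + 1) hk', ← mul_assoc (Real.exp (P.qmin * _)), ← Real.exp_add]
        have e1 : step P.α (k + 1) ≤ step P.α n₀ := step_antitone h.α_pos.le hk'
        have e2 : 1 ≤ Real.exp (P.qmin * step P.α n₀ + -(P.qmin * step P.α (k + 1))) :=
          Real.one_le_exp (by nlinarith)
        have := hE0 (k + 1)
        gcongr
        exact le_mul_of_one_le_left this e2)
      (by
        rw [hEsucc (k + 1) hk']
        have e1 : P.qmin * step P.α (k + 1) ≤ (P.q₂ - P.qmin / 2) * step P.β (k + 1) := by
          have := h.step_α_le (k + 1) hk'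
          nlinarith [hβ0 (k + 1)]
        have e2 : 1 ≤ Real.exp ((P.q₂ - P.qmin / 2) * step P.β (k + 1)) *
            Real.exp (-(P.qmin * step P.α (k + 1))) := by
          rw [← Real.exp_add]
          exact Real.one_le_exp (by linarith)
        have e3 : 0 ≤ g * (Real.exp (P.q₁ * step P.α n₀) * J *
          (Real.exp (P.qmin * step P.α n₀) * E (k + 1))) := hG₁ k hk
        refine (le_mul_of_one_le_left e3 e2).trans (le_of_eq ?_)
        ring)
    -- Here, and in the coupling term below, the constants e^{1/2} and e^{α-β} pay for moving a slow
    -- sequence from k to k+1; `slow₂` supplies the other half of the rate.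
    have s₂ := supersolution_step (q := P.q₂) (κ := P.q₂ / 2) (a := step P.β (k + 1))
      (f := g * P.εθ k) (G := g * (Real.exp (1 / 2) * P.εw k)) (by positivity) (hβ0 _)
      (step_le_one h.β_pos.le _) (hG₂ (k + 1) hk')
      (by
        refine mul_le_mul_of_nonneg_left ((h.εθ_le_εw k hk).trans ?_) hg
        refine (h.εw_isSlow k hk).2.trans ?_
        exact exp_le_of_le_mul (h.slow_le_half k hk) (h.εw_pos _).le)
      (by
        have := mul_le_mul_of_nonneg_left ((h.εw_isSlow k hk).2.trans
          (exp_le_of_le_mul hslow₂ (h.εw_pos _).le)) (mul_nonneg hg (Real.exp_pos (1 / 2)).le)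
        linarith)
    have s₃ := supersolution_step (q := P.q₂) (κ := P.q₂ / 2) (a := step P.β (k + 1))
      (f := g * (P.Cb * (r k * u k)))
      (G := g * (P.Cb * (Real.exp (P.α - P.β) * (r k * u k)))) (by positivity) (hβ0 _)
      (step_le_one h.β_pos.le _) (hG₃ (k + 1) hk')
      (by
        refine mul_le_mul_of_nonneg_left (mul_le_mul_of_nonneg_left ?_ hCb) hg
        exact (hu k hk).2.trans (exp_le_of_le_mul (h.slow_le_sub k hk) (hu (k + 1) hk').1))
      (by
        have := mul_le_mul_of_nonneg_left ((hu k hk).2.trans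
          (exp_le_of_le_mul hslow₂ (hu (k + 1) hk').1))
          (mul_nonneg hg (mul_nonneg hCb (Real.exp_pos (P.α - P.β)).le))
        linarith)
    have hgx : g * x (k + 1) ≤ g * (Real.exp (P.q₁ * step P.α n₀) * J * E (k + 1)) +
        g * P.εθ k + g * (P.Cb * (r k * u k)) := by
      rw [← mul_add, ← mul_add]
      refine mul_le_mul_of_nonneg_left (hxk.trans ?_) hg
      have := mul_le_mul_of_nonneg_right (hdecay k hk) hJ0
      linarith
    have hgx' := mul_le_mul_of_nonneg_left hgx (hβ0 (k + 1))
    rw [decay_succ _ _ (show n₀ + 1 ≤ k + 1 by omega)]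
    simp only [mul_add] at hgx' ⊢
    linarith

/-- The improvement step: the two time scales feed back into each other with the small factor r_n,
so any admissible majorant of y may be multiplied by r_n, up to the noise level. -/
theorem ErrorRecursion.y_le_of_y_le (h : P.Admissible n₀) (hr : P.ErrorRecursion n₀ x y z t)
    (hin : ∀ n, n₀ ≤ n → P.InRange n₀ x y n) {u : ℕ → ℝ} (hyu : ∀ k, n₀ ≤ k → y k ≤ u k)
    (hu : IsSlow (P.α - P.β / 2) n₀ fun k => step (P.α - P.β) k * u k)
    (hanti : ∀ k, n₀ ≤ k → u (k + 1) ≤ u k) :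
    ∀ n, n₀ ≤ n →
      y n ≤ P.A₁ n₀ (x n₀) (y n₀) * P.εw n + P.A₂ * (step (P.α - P.β) n * u n) := by
  have hq₁ := h.q₁_pos
  have hq₂ := h.q₂_pos
  have hqm := h.qmin_pos
  have hqm₁ : P.qmin ≤ P.q₁ := min_le_left _ _
  have hqm₂ : P.qmin ≤ P.q₂ := min_le_right _ _
  have hg := opNorm_nonneg P.Γ₂
  have hCa := Ca_pos (P := P)
  have hCb := h.Cb_nonneg
  have hCw : 1 ≤ P.Cw := one_le_prodConst _ _
  have hx0 := hr.x_nonneg n₀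
  have hy0 := hr.y_nonneg n₀
  have hA₂ := h.A₂_nonneg
  have hε0 := h.εw_pos n₀
  have hβ0 := (step_pos P.β n₀).le
  have hr0 := (step_pos (P.α - P.β) n₀).le
  have he1 : (1 : ℝ) ≤ Real.exp 1 := Real.one_le_exp zero_le_one
  have hCc : 0 ≤ P.Cc n₀ (x n₀) (y n₀) := by
    unfold Cc
    rw [step_div_step]
    positivity
  intro n hn
  -- The estimate of t starts at n₀ + 1. At n₀ the middle term of A₁, multiplied by ε^w_{n₀},
  -- already dominates y(n₀).
  rcases hn.eq_or_lt with rfl | hlt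
  · have hun := (hu n₀ le_rfl).1
    have e1 : y n₀ ≤ Real.exp 1 * (P.Cw * opNorm P.Γ₂ * P.Cc n₀ (x n₀) (y n₀) + P.Cw * y n₀) /
        P.εw n₀ * P.εw n₀ := by
      rw [div_mul_cancel₀ _ hε0.ne']
      calc y n₀ ≤ P.Cw * y n₀ := le_mul_of_one_le_left hy0 hCw
        _ ≤ P.Cw * opNorm P.Γ₂ * P.Cc n₀ (x n₀) (y n₀) + P.Cw * y n₀ :=
          le_add_of_nonneg_left (by positivity)
        _ ≤ _ := le_mul_of_one_le_left (by positivity) he1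
    have e2 : 0 ≤ P.CI := by unfold CI; positivity
    refine e1.trans (le_add_of_le_of_nonneg ?_ (by positivity))
    refine mul_le_mul_of_nonneg_right ?_ hε0.le
    unfold A₁
    have : 0 ≤ Real.exp 2 * P.Cw * opNorm P.Γ₂ * P.CI := by positivity
    linarith
  · obtain ⟨m, rfl⟩ : ∃ m, n = m + 1 := ⟨n - 1, by omega⟩
    have hm : n₀ ≤ m := by omega
    have ht := hr.t_le h hin hyu hu hanti hm
    have hy := hr.y_le m hm
    have hE := h.decay_le_εw_div hn
    have hEpos := decay_pos P.qmin (step P.α) n₀ (m + 1)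
    have hεm : P.εw m ≤ Real.exp (1 / 2) * P.εw (m + 1) :=
      (h.εw_isSlow m hm).2.trans (exp_le_of_le_mul (h.slow_le_half m hm) (h.εw_pos _).le)
    have hum : step (P.α - P.β) m * u m ≤
        Real.exp (P.α - P.β) * (step (P.α - P.β) (m + 1) * u (m + 1)) :=
      (hu m hm).2.trans (exp_le_of_le_mul (h.slow_le_sub m hm) (hu _ hn).1)
    have hum0 := (hu _ hn).1
    have hεp := h.εw_pos (m + 1)
    set e := P.εw (m + 1)
    set ru := step (P.α - P.β) (m + 1) * u (m + 1)
    set E := decay P.qmin (step P.α) n₀ (m + 1)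
    -- the initial error of `w`, and the first forcing term
    have t₁ : decay P.q₂ (step P.β) (n₀ + 1) (m + 1) *
        (Real.exp (-(P.q₂ * step P.β n₀)) * y n₀ + step P.β n₀ * (opNorm P.Γ₂ * x n₀)) ≤
        E * (Real.exp 1 * (P.Cw * y n₀ + P.Cw * opNorm P.Γ₂ * (step P.β n₀ * x n₀))) := by
      have e1 := decay_eq_mul P.q₂ (step P.β) (show n₀ < m + 1 by omega)
      have e2 : decay P.q₂ (step P.β) n₀ (m + 1) ≤ E :=
        decay_le_decay _ _ hqm.le hqm₂ (fun j => (step_pos _ j).le)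
          fun j => step_le_step h.β_lt_α.le j
      have e3 : decay P.q₂ (step P.β) (n₀ + 1) (m + 1) ≤ E * Real.exp 1 := by
        calc decay P.q₂ (step P.β) (n₀ + 1) (m + 1)
            = Real.exp (P.q₂ * step P.β n₀) * decay P.q₂ (step P.β) n₀ (m + 1) := by
              rw [e1, ← mul_assoc, ← Real.exp_add]; simp
          _ ≤ Real.exp 1 * E :=
              mul_le_mul (Real.exp_le_exp.2 (h.q₂_mul_step_le n₀ le_rfl)) e2
                (decay_pos _ _ _ _).le (Real.exp_pos _).le
          _ = _ := mul_comm _ _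
      have e4 : Real.exp (-(P.q₂ * step P.β n₀)) ≤ P.Cw :=
        (Real.exp_le_one_iff.2 (by nlinarith)).trans hCw
      have e5 : step P.β n₀ * (opNorm P.Γ₂ * x n₀) ≤
          P.Cw * opNorm P.Γ₂ * (step P.β n₀ * x n₀) := by
        calc step P.β n₀ * (opNorm P.Γ₂ * x n₀) = 1 * (opNorm P.Γ₂ * (step P.β n₀ * x n₀)) := by
              ring
          _ ≤ P.Cw * (opNorm P.Γ₂ * (step P.β n₀ * x n₀)) := by gcongr
          _ = _ := by ring
      refine (mul_le_mul_of_nonneg_right e3 (by positivity)).trans ?_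
      rw [mul_assoc]
      gcongr
    -- the initial error of `θ`
    have t₂ : Real.exp (P.qmin / 2) / (P.qmin / 2) *
        (opNorm P.Γ₂ * (Real.exp (P.q₁ * step P.α n₀) *
        (P.Ca * (x n₀ + step (P.α - P.β) n₀ * y n₀)) * (Real.exp (P.qmin * step P.α n₀) * E))) ≤
        E * (Real.exp 1 * (P.Cw * opNorm P.Γ₂ * (P.Ca * Real.exp P.q₁ * (2 / P.qmin) *
          (x n₀ + step (P.α - P.β) n₀ * y n₀)))) := by
      -- The three exponents are at most q₁/2, q₁/2 and 1/2, because α_{n₀} ≤ β_{n₀}/2 ≤ 1/2 and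
      -- q₂β_{n₀} ≤ 1.
      have hexp : Real.exp (P.qmin / 2) * Real.exp (P.q₁ * step P.α n₀) *
          Real.exp (P.qmin * step P.α n₀) ≤ Real.exp 1 * Real.exp P.q₁ := by
        rw [← Real.exp_add, ← Real.exp_add, ← Real.exp_add]
        apply Real.exp_le_exp.2
        have a1 := h.step_α_le n₀ le_rfl
        have a2 : step P.β n₀ ≤ 1 := step_le_one h.β_pos.le _
        have a3 := h.q₂_mul_step_le n₀ le_rfl
        have a4 : P.q₁ * step P.α n₀ ≤ P.q₁ * (1 / 2) := by gcongr; linarith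
        have a0 := (step_pos P.α n₀).le
        have a5 : P.qmin * step P.α n₀ ≤ P.q₂ * (step P.β n₀ / 2) := by gcongr
        linarith
      have hrest : 0 ≤ opNorm P.Γ₂ * (P.Ca * (x n₀ + step (P.α - P.β) n₀ * y n₀)) *
          (2 / P.qmin) * E := by positivity
      calc Real.exp (P.qmin / 2) / (P.qmin / 2) *
        (opNorm P.Γ₂ * (Real.exp (P.q₁ * step P.α n₀) *
        (P.Ca * (x n₀ + step (P.α - P.β) n₀ * y n₀)) * (Real.exp (P.qmin * step P.α n₀) * E)))
          = (Real.exp (P.qmin / 2) * Real.exp (P.q₁ * step P.α n₀) *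
          Real.exp (P.qmin * step P.α n₀)) *
            (opNorm P.Γ₂ * (P.Ca * (x n₀ + step (P.α - P.β) n₀ * y n₀)) *
          (2 / P.qmin) * E) := by field_simp
        _ ≤ P.Cw * (Real.exp 1 * Real.exp P.q₁) *
            (opNorm P.Γ₂ * (P.Ca * (x n₀ + step (P.α - P.β) n₀ * y n₀)) *
          (2 / P.qmin) * E) :=
            mul_le_mul_of_nonneg_right
              (hexp.trans (le_mul_of_one_le_left (by positivity) hCw)) hrest
        _ = _ := by ring
    -- the noise of `θ`
    have t₃ : Real.exp (P.q₂ / 2) / (P.q₂ / 2) * (opNorm P.Γ₂ * (Real.exp (1 / 2) * P.εw m)) ≤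
        Real.exp 2 * P.Cw * opNorm P.Γ₂ * P.CI * e := by
      have e1 : Real.exp (1 / 2) * (Real.exp (1 / 2) * e) ≤ Real.exp 2 * P.Cw * e := by
        rw [← mul_assoc, ← Real.exp_add]
        gcongr
        refine le_trans ?_ (le_mul_of_one_le_right (by positivity) hCw)
        apply Real.exp_le_exp.2; norm_num
      calc Real.exp (P.q₂ / 2) / (P.q₂ / 2) * (opNorm P.Γ₂ * (Real.exp (1 / 2) * P.εw m))
          ≤ Real.exp (P.q₂ / 2) / (P.q₂ / 2) *
            (opNorm P.Γ₂ * (Real.exp (1 / 2) * (Real.exp (1 / 2) * e))) := by gcongr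
        _ ≤ Real.exp (P.q₂ / 2) / (P.q₂ / 2) * (opNorm P.Γ₂ * (Real.exp 2 * P.Cw * e)) := by
            gcongr
        _ = _ := by unfold CI; field_simp
    -- the coupling
    have t₄ : Real.exp (P.q₂ / 2) / (P.q₂ / 2) * (opNorm P.Γ₂ * (P.Cb * (Real.exp (P.α - P.β) *
        (step (P.α - P.β) m * u m)))) ≤ P.A₂ * ru := by
      have e1 : Real.exp (P.α - P.β) * (Real.exp (P.α - P.β) * ru) ≤
          Real.exp (P.q₁ + 2 * (P.α - P.β)) * P.Cw * ru := by
        rw [← mul_assoc, ← Real.exp_add]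
        gcongr
        refine le_trans ?_ (le_mul_of_one_le_right (by positivity) hCw)
        apply Real.exp_le_exp.2; linarith
      calc Real.exp (P.q₂ / 2) / (P.q₂ / 2) * (opNorm P.Γ₂ * (P.Cb * (Real.exp (P.α - P.β) *
            (step (P.α - P.β) m * u m))))
          ≤ Real.exp (P.q₂ / 2) / (P.q₂ / 2) * (opNorm P.Γ₂ * (P.Cb * (Real.exp (P.α - P.β) *
            (Real.exp (P.α - P.β) * ru)))) := by gcongr
        _ ≤ Real.exp (P.q₂ / 2) / (P.q₂ / 2) * (opNorm P.Γ₂ * (P.Cb *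
            (Real.exp (P.q₁ + 2 * (P.α - P.β)) * P.Cw * ru))) := by gcongr
        _ = _ := by unfold A₂; field_simp
    have t₅ : P.εw m ≤ Real.exp 1 * e :=
      hεm.trans (exp_le_of_le_mul (by norm_num) hεp.le)
    have t₆ : E * (Real.exp 1 * (P.Cw * opNorm P.Γ₂ * P.Cc n₀ (x n₀) (y n₀) + P.Cw * y n₀)) ≤
        Real.exp 1 * (P.Cw * opNorm P.Γ₂ * P.Cc n₀ (x n₀) (y n₀) + P.Cw * y n₀) / P.εw n₀ * e := by
      calc E * (Real.exp 1 * (P.Cw * opNorm P.Γ₂ * P.Cc n₀ (x n₀) (y n₀) + P.Cw * y n₀))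
          ≤ e / P.εw n₀ * (Real.exp 1 * (P.Cw * opNorm P.Γ₂ * P.Cc n₀ (x n₀) (y n₀) +
            P.Cw * y n₀)) := by gcongr
        _ = _ := by ring
    have t₇ : E * (Real.exp 1 * (P.Cw * opNorm P.Γ₂ * P.Cc n₀ (x n₀) (y n₀) + P.Cw * y n₀)) =
        E * (Real.exp 1 * (P.Cw * y n₀ + P.Cw * opNorm P.Γ₂ * (step P.β n₀ * x n₀))) +
        E * (Real.exp 1 * (P.Cw * opNorm P.Γ₂ * (P.Ca * Real.exp P.q₁ * (2 / P.qmin) *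
          (x n₀ + step (P.α - P.β) n₀ * y n₀)))) := by
      unfold Cc
      rw [step_div_step]
      ring
    have t₈ : P.A₁ n₀ (x n₀) (y n₀) * e = Real.exp 1 * e +
        Real.exp 1 * (P.Cw * opNorm P.Γ₂ * P.Cc n₀ (x n₀) (y n₀) + P.Cw * y n₀) / P.εw n₀ * e +
        Real.exp 2 * P.Cw * opNorm P.Γ₂ * P.CI * e := by
      unfold A₁; ring
    linarith

end Data

/-! ### Iterating the improvement up to the final rates. -/

namespace Data

variable {d : ℕ} {P : Data d} {n₀ : ℕ} {x y z t : ℕ → ℝ}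

theorem Admissible.ν_antitone (h : P.Admissible n₀) {n : ℕ} (hn : n₀ ≤ n) {a : ℝ} (ha : 0 ≤ a) :
    a * P.ν (n + 1) P.β ≤ a * P.ν n P.β :=
  mul_le_mul_of_nonneg_left (h.ν_succ_le n hn) ha

theorem step_mul_ν (n : ℕ) :
    step (P.α - P.β) n * P.ν n P.β = step (P.α - P.β / 2) n * P.logFactor n := by
  rw [ν_eq, ← mul_assoc, step_mul_step]
  ring_nf

theorem Admissible.isSlow_step_mul_ν (h : P.Admissible n₀) :
    IsSlow (P.α - P.β / 2) n₀ fun n => step (P.α - P.β) n * P.ν n P.β := by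
  simp only [step_mul_ν]
  exact isSlow_step_mul (by linarith [h.β_lt_α, h.β_pos]) le_rfl h.logFactor_nonneg
    h.logFactor_mono

theorem Admissible.A₁_nonneg (h : P.Admissible n₀) {a b : ℝ} (ha : 0 ≤ a) (hb : 0 ≤ b) :
    0 ≤ P.A₁ n₀ a b := by
  have := h.q₂_pos
  have := h.qmin_pos
  have := Cw_pos (P := P)
  have := Ca_pos (P := P)
  have := opNorm_nonneg P.Γ₂
  have := h.εw_pos n₀
  have := step_pos P.β n₀
  have := step_pos P.α n₀
  unfold A₁ CI Cc
  positivity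

theorem Admissible.A₄_nonneg (h : P.Admissible n₀) {a b : ℝ} (ha : 0 ≤ a) (hb : 0 ≤ b) :
    0 ≤ P.A₄ n₀ a b := by
  have := h.A₁_nonneg ha hb
  have := h.A₂_nonneg
  have := h.CRw_pos
  have := h.Rw_pos
  unfold A₄ A₃
  positivity

/-- Induction starts from the range bound A₃. Each round multiplies the remainder by A₂ r_n and adds
one more term to the geometric sum in front of the noise level. -/
theorem ErrorRecursion.y_le_iterate (h : P.Admissible n₀) (hr : P.ErrorRecursion n₀ x y z t)
    (hin : ∀ n, n₀ ≤ n → P.InRange n₀ x y n) (l : ℕ) (hl : l ≤ P.ℓstar) :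
    ∀ n, n₀ ≤ n → y n ≤ P.A₁ n₀ (x n₀) (y n₀) * (∑ i ∈ Finset.range l, P.A₂ ^ i) * P.εw n +
      P.A₃ * P.A₂ ^ l * step ((P.α - P.β) * l) n := by
  have hαβ : 0 < P.α - P.β := by linarith [h.β_lt_α]
  have hA₁ := h.A₁_nonneg (hr.x_nonneg n₀) (hr.y_nonneg n₀)
  have hA₂ := h.A₂_nonneg
  have hA₃ : 0 ≤ P.A₃ := mul_nonneg h.CRw_pos.le h.Rw_pos.le
  induction l with
  | zero =>
    intro n hn
    simpa [step_zero, A₃] using (hin n hn n hn le_rfl).2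
  | succ l ih =>
    -- Another round needs r_n u_n to decrease no faster than (n+1)^(-(α-β/2)); this holds exactly
    -- until the exponent of u passes β/2, hence the choice of ℓ*.
    have hl' : (P.α - P.β) * l ≤ P.β / 2 := by
      have := (Nat.lt_ceil.1 (show l < ⌈P.β / (2 * (P.α - P.β))⌉₊ from hl)).le
      rw [le_div_iff₀ (by positivity)] at this
      linarith
    have hl0 : 0 ≤ (P.α - P.β) * l := by positivity
    have ih' := ih (by omega)
    set a := P.A₁ n₀ (x n₀) (y n₀) * ∑ i ∈ Finset.range l, P.A₂ ^ i with ha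
    have ha0 : 0 ≤ a := by positivity
    set s := Real.sqrt ((d : ℝ) ^ 3 * P.Lw * P.Dw)
    have hs : 0 ≤ s := Real.sqrt_nonneg _
    have hε : ∀ n, P.εw n = s * P.ν n P.β := fun _ => rfl
    have hb0 : 0 ≤ P.A₃ * P.A₂ ^ l := by positivity
    have hru : ∀ n, step (P.α - P.β) n * (a * P.εw n + P.A₃ * P.A₂ ^ l *
        step ((P.α - P.β) * l) n) = a * s * (step (P.α - P.β) n * P.ν n P.β) +
        P.A₃ * P.A₂ ^ l * step (P.α - P.β + (P.α - P.β) * l) n := fun n => by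
      rw [← step_mul_step, hε]; ring
    have key := hr.y_le_of_y_le h hin ih'
      (by
        simp only [hru]
        exact (h.isSlow_step_mul_ν.const_mul (by positivity)).add
          ((isSlow_step (by linarith) (by linarith)).const_mul hb0))
      (fun k hk => by
        have e1 := h.ν_antitone hk hs
        have e2 := step_antitone hl0 k.le_succ
        rw [hε, hε]
        gcongr)
    intro n hn
    refine (key n hn).trans ?_
    have e1 : step (P.α - P.β) n ≤ 1 := step_le_one hαβ.le n
    have e2 := h.εw_pos n
    -- The gain r_n on the noise part is discarded: the fresh noise of the round has order ε^w_n
    -- anyway.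
    have e3 : step (P.α - P.β) n * (a * P.εw n) ≤ a * P.εw n :=
      mul_le_of_le_one_left (by positivity) e1
    have e4 : (P.α - P.β) * ((l + 1 : ℕ) : ℝ) = P.α - P.β + (P.α - P.β) * l := by
      push_cast; ring
    rw [e4, ← step_mul_step, geom_sum_succ]
    calc P.A₁ n₀ (x n₀) (y n₀) * P.εw n + P.A₂ * (step (P.α - P.β) n *
          (a * P.εw n + P.A₃ * P.A₂ ^ l * step ((P.α - P.β) * l) n))
        = P.A₁ n₀ (x n₀) (y n₀) * P.εw n + P.A₂ * (step (P.α - P.β) n * (a * P.εw n)) +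
          P.A₃ * P.A₂ ^ (l + 1) * (step (P.α - P.β) n * step ((P.α - P.β) * l) n) := by ring
      _ ≤ P.A₁ n₀ (x n₀) (y n₀) * P.εw n + P.A₂ * (a * P.εw n) +
          P.A₃ * P.A₂ ^ (l + 1) * (step (P.α - P.β) n * step ((P.α - P.β) * l) n) := by gcongr
      _ = _ := by rw [ha]; ring

theorem ErrorRecursion.y_le_A₄ (h : P.Admissible n₀) (hr : P.ErrorRecursion n₀ x y z t)
    (hin : ∀ n, n₀ ≤ n → P.InRange n₀ x y n) {n : ℕ} (hn : n₀ ≤ n) :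
    y n ≤ P.A₄ n₀ (x n₀) (y n₀) * P.ν n P.β := by
  have hαβ : 0 < P.α - P.β := by linarith [h.β_lt_α]
  have hA₂ := h.A₂_nonneg
  have hA₃ : 0 ≤ P.A₃ := mul_nonneg h.CRw_pos.le h.Rw_pos.le
  refine (hr.y_le_iterate h hin P.ℓstar le_rfl n hn).trans ?_
  have hl : P.β / 2 ≤ (P.α - P.β) * P.ℓstar := by
    have : P.β / (2 * (P.α - P.β)) ≤ P.ℓstar := Nat.le_ceil _
    rw [div_le_iff₀ (by positivity)] at this
    linarith
  have hstep : step ((P.α - P.β) * P.ℓstar) n ≤ P.ν n P.β := by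
    rw [ν_eq]
    exact (step_le_step hl n).trans
      (le_mul_of_one_le_right (step_pos _ _).le (h.one_le_logFactor n))
  unfold A₄
  rw [add_mul]
  refine add_le_add (le_of_eq ?_) (mul_le_mul_of_nonneg_left hstep (by positivity))
  unfold εw
  ring

theorem Valid.ν_le_two_mul (hP : P.Valid) (n : ℕ) : P.ν n P.α ≤ 2 * P.ν (n + 1) P.α := by
  have h0 := hP.α_pos
  have h1 := hP.α_lt_one
  refine (hP.ν_isSlow h0.le le_rfl n n le_rfl).2.trans
    (mul_le_mul_of_nonneg_right ?_ (hP.ν_pos _ _).le)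
  have h2 : Real.exp (P.α / 2 / (n + 1)) ≤ Real.exp (1 / 2) := by
    apply Real.exp_le_exp.2
    rw [div_le_iff₀ (by positivity)]
    have : (0 : ℝ) ≤ n := Nat.cast_nonneg n
    linarith
  refine h2.trans ?_
  have h3 : Real.exp (1 / 2) * Real.exp (1 / 2) = Real.exp 1 := by
    rw [← Real.exp_add]; norm_num
  nlinarith [Real.exp_one_lt_d9, Real.exp_pos (1 / 2)]

/-- Feed the final bound on y into `x_le_of_y_le`. All three terms are of order ν(n, α), and the
shift from m to m+1 costs a factor 2. -/
theorem ErrorRecursion.x_le_A₅ (h : P.Admissible n₀) (hr : P.ErrorRecursion n₀ x y z t)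
    (hin : ∀ n, n₀ ≤ n → P.InRange n₀ x y n) {n : ℕ} (hn : n₀ ≤ n) :
    x n ≤ P.A₅ n₀ (x n₀) (y n₀) * P.ν n P.α := by
  have hαβ : 0 < P.α - P.β := by linarith [h.β_lt_α]
  have hA₄ := h.A₄_nonneg (hr.x_nonneg n₀) (hr.y_nonneg n₀)
  have hCa : 1 ≤ P.Ca :=
    one_le_mul_of_one_le_of_one_le (one_le_prodConst _ _) (le_max_right _ _)
  have hCb := h.Cb_nonneg
  have hd := h.dim_pos
  have hLθ := h.Lθ_pos
  have hDθ := h.Dθ_pos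
  have h3 := h.three_le
  obtain ⟨hx₀, hy₀⟩ := hin n₀ le_rfl n₀ le_rfl le_rfl
  have hx0 := hr.x_nonneg n₀
  have hy0 := hr.y_nonneg n₀
  set s := Real.sqrt ((d : ℝ) ^ 3 * P.Lθ * P.Dθ) with hs_def
  have hs : 0 < s := by positivity
  have hεθ : ∀ n, P.εθ n = s * P.ν n P.α := fun _ => rfl
  set R := CRθ * P.Rθ + P.CRw * P.Rw
  have hsqrt : Real.sqrt (4 * (d : ℝ) ^ 3 * P.Lθ * P.Dθ) = 2 * s := by
    rw [mul_assoc, mul_assoc, ← mul_assoc ((d : ℝ) ^ 3), Real.sqrt_mul (by norm_num)]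
    congr 1
    rw [Real.sqrt_eq_iff_mul_self_eq_of_pos] <;> norm_num
  have hν0 := h.ν_pos (n₀ - 1) P.α
  have hνn := h.ν_pos n P.α
  have hprev : P.ν (n₀ - 1) P.α ≤ 2 * P.ν n₀ P.α := by
    have := h.ν_le_two_mul (n₀ - 1)
    rwa [Nat.sub_add_cancel (by omega)] at this
  have hA₅ : P.A₅ n₀ (x n₀) (y n₀) * P.ν n P.α =
      4 * (P.Ca * R) * (P.ν n P.α / P.ν (n₀ - 1) P.α) + 4 * s * P.ν n P.α +
        2 * P.Cb * P.A₄ n₀ (x n₀) (y n₀) * P.ν n P.α := by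
    unfold A₅
    rw [hsqrt, hεθ]
    field_simp
    ring
  have hRx : x n₀ + y n₀ ≤ R := add_le_add hx₀ hy₀
  rw [hA₅]
  rcases hn.eq_or_lt with rfl | hlt
  -- At n = n₀ the first term of A₅ is at least 2 C_a R, which exceeds x(n₀) by the range bound
  -- alone.
  · have e1 : 1 / 2 ≤ P.ν n₀ P.α / P.ν (n₀ - 1) P.α := by
      rw [le_div_iff₀ hν0]; linarith
    have e2 : x n₀ ≤ P.Ca * R := by nlinarith
    have e3 : 4 * (P.Ca * R) * (1 / 2) ≤ 4 * (P.Ca * R) * (P.ν n₀ P.α / P.ν (n₀ - 1) P.α) :=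
      mul_le_mul_of_nonneg_left e1 (by linarith)
    have e4 : 0 ≤ 4 * s * P.ν n₀ P.α := by positivity
    have e5 : 0 ≤ 2 * P.Cb * P.A₄ n₀ (x n₀) (y n₀) * P.ν n₀ P.α := by positivity
    linarith
  · obtain ⟨m, rfl⟩ : ∃ m, n = m + 1 := ⟨n - 1, by omega⟩
    have hm : n₀ ≤ m := by omega
    have hxm := hr.x_le_of_y_le h hin (u := fun n => P.A₄ n₀ (x n₀) (y n₀) * P.ν n P.β)
      (fun k hk => hr.y_le_A₄ h hin hk)
      (by
        convert h.isSlow_step_mul_ν.const_mul hA₄ using 2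
        ring)
      (fun k hk => h.ν_antitone hk hA₄) hm
    have hν2 := h.ν_le_two_mul m
    -- The 4 comes from the two index shifts n₀ - 1, n₀, n₀ + 1, each costing a factor 2.
    have e1 : decay P.q₁ (step P.α) (n₀ + 1) (m + 1) ≤
        4 * (P.ν (m + 1) P.α / P.ν (n₀ - 1) P.α) := by
      have a1 := h.decay_mul_le (c := P.α / 2) (by linarith [h.α_pos]) le_rfl
        (show n₀ ≤ n₀ + 1 by omega) (show n₀ + 1 ≤ m + 1 by omega)
      rw [← ν_eq, ← ν_eq] at a1
      have a2 := decay_le_decay (n₀ + 1) (m + 1) h.qmin_pos.le (min_le_left P.q₁ P.q₂)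
        (fun j => (step_pos P.α j).le) (fun _ => le_rfl)
      have a3 := h.ν_le_two_mul n₀
      have a4 := (decay_pos P.q₁ (step P.α) (n₀ + 1) (m + 1)).le
      have a5 := h.ν_pos (n₀ + 1) P.α
      rw [mul_div_assoc', le_div_iff₀ hν0]
      calc decay P.q₁ (step P.α) (n₀ + 1) (m + 1) * P.ν (n₀ - 1) P.α
          ≤ decay P.qmin (step P.α) (n₀ + 1) (m + 1) * (4 * P.ν (n₀ + 1) P.α) := by
            refine mul_le_mul a2 (by linarith) hν0.le (decay_pos _ _ _ _).le
        _ ≤ 4 * P.ν (m + 1) P.α := by linarith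
    have e2 : P.Ca * (x n₀ + step (P.α - P.β) n₀ * y n₀) ≤ P.Ca * R := by
      have : step (P.α - P.β) n₀ * y n₀ ≤ y n₀ :=
        mul_le_of_le_one_left hy0 (step_le_one hαβ.le _)
      gcongr
      linarith
    have e3 := mul_le_mul e1 e2
      (mul_nonneg (by linarith) (add_nonneg hx0 (mul_nonneg (step_pos _ _).le hy0)))
      (by positivity)
    have e4 : P.Cb * (step (P.α - P.β) m * (P.A₄ n₀ (x n₀) (y n₀) * P.ν m P.β)) ≤
        2 * P.Cb * P.A₄ n₀ (x n₀) (y n₀) * P.ν (m + 1) P.α := by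
      -- The combined exponent α - β/2 is at least α/2.
      have a1 : step (P.α - P.β) m * P.ν m P.β ≤ 2 * P.ν (m + 1) P.α := by
        rw [step_mul_ν]
        refine le_trans ?_ hν2
        rw [ν_eq]
        exact mul_le_mul_of_nonneg_right (step_le_step (by linarith) m) (h.logFactor_nonneg m)
      have a2 := mul_le_mul_of_nonneg_left a1 (mul_nonneg hCb hA₄)
      linarith
    have e5 : P.εθ m ≤ 4 * s * P.ν (m + 1) P.α := by
      rw [hεθ]
      nlinarith
    linarith

end Data

/-! ### Concentration of contracted noise sums. -/

section Concentration

/-- By convexity exp lies below its chord on [-c, c]. For c = 0 the quotient is the default 0, and ξ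
= 0. -/
theorem exp_le_cosh_add {ξ c : ℝ} (h : |ξ| ≤ c) :
    Real.exp ξ ≤ Real.cosh c + ξ * (Real.sinh c / c) := by
  rcases (abs_nonneg ξ |>.trans h).eq_or_lt with rfl | hc
  · have : ξ = 0 := abs_eq_zero.1 (le_antisymm h (abs_nonneg _))
    simp [this]
  · have h1 : |ξ / c| ≤ 1 := by
      rw [abs_div, abs_of_pos hc, div_le_one hc]
      exact h
    have h2 := Real.exp_mul_le_cosh_add_mul_sinh h1 c
    rw [div_mul_cancel₀ _ hc.ne'] at h2
    refine h2.trans (le_of_eq ?_)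
    ring

/-- A martingale difference is orthogonal to bounded functions of the past, on past events. -/
theorem setIntegral_mul_inner_eq_zero {d : ℕ} {Ω : Type*} {m mΩ : MeasurableSpace Ω} (hm : m ≤ mΩ) {μ : Measure Ω}
    [IsFiniteMeasure μ] {M : Ω → Vec d} (hM : Integrable M μ) (hM0 : μ[M|m] =ᵐ[μ] 0)
    {Y : Ω → ℝ} (hY : Measurable[m] Y) {C : ℝ} (hYC : ∀ ω, |Y ω| ≤ C) (u : Vec d) {s : Set Ω}
    (hs : MeasurableSet[m] s) :
    Integrable (fun ω => Y ω * inner ℝ u (M ω)) μ ∧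
      ∫ ω in s, Y ω * inner ℝ u (M ω) ∂μ = 0 := by
  have hMu : Integrable (fun ω => inner ℝ u (M ω)) μ := hM.const_inner u
  have hint : Integrable (fun ω => Y ω * inner ℝ u (M ω)) μ :=
    hMu.bdd_mul (hY.mono hm le_rfl).aestronglyMeasurable (Filter.Eventually.of_forall hYC)
  refine ⟨hint, ?_⟩
  have hYu : StronglyMeasurable[m] fun ω => Y ω • u := hY.stronglyMeasurable.smul_const u
  -- The factor Yu is measurable with respect to the past, so it comes out of the conditional
  -- expectation.
  have hce := condExp_stronglyMeasurable_bilin_of_bound (innerSL ℝ (E := Vec d)) hm hYu hM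
    (C * ‖u‖) (Filter.Eventually.of_forall fun ω => by
      rw [norm_smul]
      exact mul_le_mul_of_nonneg_right (hYC ω) (norm_nonneg u))
  have hfun : (fun ω => innerSL ℝ (Y ω • u) (M ω)) = fun ω => Y ω * inner ℝ u (M ω) := by
    ext ω
    rw [innerSL_apply_apply, real_inner_smul_left]
  rw [hfun] at hce
  rw [← setIntegral_condExp hm hint hs]
  refine (setIntegral_congr_ae (g := fun _ => 0) (hm s hs) ?_).trans (by simp)
  filter_upwards [hce, hM0] with ω h1 h2 _
  rw [h1, h2]
  simp

variable {d : ℕ} {Ω : Type*}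

/-- `L_0 = 0`, `L_{n+1} = (1 - a_n A) L_n + a_n N_n`. -/
noncomputable def noiseSum (A : Vec d →L[ℝ] Vec d) (a : ℕ → ℝ) (N : ℕ → Ω → Vec d) : ℕ → Ω → Vec d
  | 0 => 0
  | n + 1 => fun ω =>
    ((1 : Vec d →L[ℝ] Vec d) - a n • A) (noiseSum A a N n ω) + a n • N n ω

/-- `V_{n+1} = ρ_n² V_n + a_n²` from `V_{n₀} = 0` on. -/
noncomputable def varianceSeq (ρ a : ℕ → ℝ) (n₀ : ℕ) : ℕ → ℝ
  | 0 => 0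
  | n + 1 => if n < n₀ then 0 else ρ n ^ 2 * varianceSeq ρ a n₀ n + a n ^ 2

theorem varianceSeq_self (ρ a : ℕ → ℝ) (n₀ : ℕ) : varianceSeq ρ a n₀ n₀ = 0 := by
  cases n₀ <;> simp [varianceSeq]

theorem varianceSeq_succ (ρ a : ℕ → ℝ) {n₀ n : ℕ} (h : n₀ ≤ n) :
    varianceSeq ρ a n₀ (n + 1) = ρ n ^ 2 * varianceSeq ρ a n₀ n + a n ^ 2 := by
  rw [varianceSeq, if_neg (by omega)]

theorem noiseSum_eq_zero (A : Vec d →L[ℝ] Vec d) (a : ℕ → ℝ) {N : ℕ → Ω → Vec d} {n₀ : ℕ}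
    (hN : ∀ n, n < n₀ → N n = 0) : ∀ n, n ≤ n₀ → noiseSum A a N n = 0
  | 0, _ => rfl
  | n + 1, h => by
    ext1 ω
    rw [noiseSum, noiseSum_eq_zero A a hN n (by omega), hN n (by omega)]
    simp

theorem measurable_noiseSum {𝓕 : ℕ → MeasurableSpace Ω} (h𝓕 : Monotone 𝓕)
    {A : Vec d →L[ℝ] Vec d} {a : ℕ → ℝ} {N : ℕ → Ω → Vec d}
    (hN : ∀ n, Measurable[𝓕 (n + 1)] (N n)) : ∀ n, Measurable[𝓕 n] (noiseSum A a N n)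
  | 0 => measurable_const
  | n + 1 => by
    have ih := (measurable_noiseSum (A := A) (a := a) h𝓕 hN n).mono (h𝓕 n.le_succ) le_rfl
    exact (((1 : Vec d →L[ℝ] Vec d) - a n • A).continuous.measurable.comp ih).add
      ((hN n).const_smul (a n))

variable [mΩ : MeasurableSpace Ω]

/-- Noise adapted to `𝓕`, bounded by `b` from `n₀` on and orthogonal to the past. -/
structure IsBoundedNoise (ν : Measure Ω) (𝓕 : ℕ → MeasurableSpace Ω) (n₀ : ℕ) (b : ℝ)
    (N : ℕ → Ω → Vec d) : Prop where
  measurable : ∀ n, Measurable[𝓕 (n + 1)] (N n)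
  bound : ∀ n, n₀ ≤ n → ∀ᵐ ω ∂ν, ‖N n ω‖ ≤ b
  orthogonal : ∀ n, n₀ ≤ n → ∀ (Y : Ω → ℝ) (C : ℝ) (u : Vec d), Measurable[𝓕 n] Y →
    (∀ ω, |Y ω| ≤ C) → ∫ ω, Y ω * inner ℝ u (N n ω) ∂ν = 0

variable {ν : Measure Ω} {𝓕 : ℕ → MeasurableSpace Ω} {n₀ : ℕ} {b : ℝ}
  {N : ℕ → Ω → Vec d} {A : Vec d →L[ℝ] Vec d} {a ρ : ℕ → ℝ}

/-- A crude bound that may grow with n; it serves only integrability and the truncation of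
exponential weights. -/
theorem exists_noiseSum_bound (hN : IsBoundedNoise ν 𝓕 n₀ b N)
    (h0 : noiseSum A a N n₀ = 0) (n : ℕ) (hn : n₀ ≤ n) :
    ∃ C, ∀ᵐ ω ∂ν, ‖noiseSum A a N n ω‖ ≤ C := by
  induction n, hn using Nat.le_induction with
  | base => exact ⟨0, by rw [h0]; simp⟩
  | succ n hn ih =>
    obtain ⟨C, hC⟩ := ih
    refine ⟨‖(1 : Vec d →L[ℝ] Vec d) - a n • A‖ * C + ‖a n‖ * b, ?_⟩
    filter_upwards [hC, hN.bound n hn] with ω h1 h2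
    rw [noiseSum]
    refine (norm_add_le _ _).trans (add_le_add ?_ ?_)
    · exact (ContinuousLinearMap.le_opNorm _ _).trans
        (mul_le_mul_of_nonneg_left h1 (norm_nonneg _))
    · rw [norm_smul]
      exact mul_le_mul_of_nonneg_left h2 (norm_nonneg _)

variable [IsProbabilityMeasure ν]

theorem integrable_of_ae_bound {f : Ω → ℝ} (hf : Measurable f) {C : ℝ} (h : ∀ᵐ ω ∂ν, |f ω| ≤ C) :
    Integrable f ν :=
  Integrable.of_bound hf.aestronglyMeasurable C h

/-- The adjoint moves the contraction onto the test vector: ⟨u, L_{n+1}⟩ = ⟨T*u, L_n⟩ + a_n⟨u, N_n⟩.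
So the induction runs over all u at once, and each step contributes cosh(c) ≤ e^{c²/2} after the
linear term integrates to 0. -/
theorem integral_exp_inner_noiseSum_le (h𝓕 : Monotone 𝓕) (h𝓕Ω : ∀ n, 𝓕 n ≤ mΩ)
    (hN : IsBoundedNoise ν 𝓕 n₀ b N) (h0 : noiseSum A a N n₀ = 0) (ha : ∀ n, 0 ≤ a n)
    (hρ : ∀ n, n₀ ≤ n → ‖(1 : Vec d →L[ℝ] Vec d) - a n • A‖ ≤ ρ n) (n : ℕ) (hn : n₀ ≤ n) :
    ∀ u : Vec d, Integrable (fun ω => Real.exp (inner ℝ u (noiseSum A a N n ω))) ν ∧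
      ∫ ω, Real.exp (inner ℝ u (noiseSum A a N n ω)) ∂ν ≤
        Real.exp (b ^ 2 * varianceSeq ρ a n₀ n * ‖u‖ ^ 2 / 2) := by
  have hb : 0 ≤ b := by
    obtain ⟨ω, hω⟩ := (hN.bound n₀ le_rfl).exists
    exact (norm_nonneg _).trans hω
  have hint : ∀ n, n₀ ≤ n → ∀ u : Vec d, ∃ C, (∀ᵐ ω ∂ν,
      |Real.exp (inner ℝ u (noiseSum A a N n ω))| ≤ C) := by
    intro n hn u
    obtain ⟨C, hC⟩ := exists_noiseSum_bound hN h0 n hn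
    refine ⟨Real.exp (‖u‖ * C), ?_⟩
    filter_upwards [hC] with ω h1
    rw [Real.abs_exp]
    exact Real.exp_le_exp.2 ((real_inner_le_norm _ _).trans
      (mul_le_mul_of_nonneg_left h1 (norm_nonneg _)))
  have hmeas𝓕 : ∀ n (u : Vec d),
      Measurable[𝓕 n] fun ω => Real.exp (inner ℝ u (noiseSum A a N n ω)) := fun n u =>
    Real.measurable_exp.comp
      ((innerSL ℝ u).continuous.measurable.comp (measurable_noiseSum h𝓕 hN.measurable n))
  have hmeas : ∀ n (u : Vec d), Measurable fun ω => Real.exp (inner ℝ u (noiseSum A a N n ω)) :=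
    fun n u => (hmeas𝓕 n u).mono (h𝓕Ω n) le_rfl
  induction n, hn using Nat.le_induction with
  | base =>
    intro u
    rw [h0, varianceSeq_self]
    simp
  | succ n hn ih =>
    intro u
    obtain ⟨C', hC'⟩ := hint (n + 1) (by omega) u
    refine ⟨integrable_of_ae_bound (hmeas _ _) hC', ?_⟩
    set T := (1 : Vec d →L[ℝ] Vec d) - a n • A with hT
    set v := ContinuousLinearMap.adjoint T u with hv
    set c := a n * b * ‖u‖ with hc
    have hv_norm : ‖v‖ ≤ ρ n * ‖u‖ := by
      refine (ContinuousLinearMap.le_opNorm _ _).trans ?_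
      rw [LinearIsometryEquiv.norm_map]
      exact mul_le_mul_of_nonneg_right (hρ n hn) (norm_nonneg _)
    obtain ⟨hYint, hYle⟩ := ih v
    obtain ⟨C, hC⟩ := hint n hn v
    set Y : Ω → ℝ := fun ω => Real.exp (inner ℝ v (noiseSum A a N n ω)) with hY
    -- Orthogonality is available for weights bounded everywhere, while Y is bounded only almost
    -- surely; hence the truncation min(Y, C).
    have horth : ∫ ω, Y ω * inner ℝ u (N n ω) ∂ν = 0 := by
      rw [← hN.orthogonal n hn (fun ω => min (Y ω) C) |C| u ((hmeas𝓕 n v).min measurable_const)]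
      · refine integral_congr_ae ?_
        filter_upwards [hC] with ω hω
        rw [min_eq_left ((le_abs_self _).trans hω)]
      · intro ω
        have hYpos : 0 < Y ω := Real.exp_pos _
        rcases le_total (Y ω) C with h | h
        · rw [min_eq_left h, abs_of_pos hYpos]
          exact h.trans (le_abs_self _)
        · rw [min_eq_right h]
    have hNmeas : Measurable (N n) := (hN.measurable n).mono (h𝓕Ω _) le_rfl
    have hYN : Integrable (fun ω => Y ω * inner ℝ u (N n ω)) ν := by
      refine integrable_of_ae_bound (C := C * (‖u‖ * b))
        ((hmeas n v).mul ((innerSL ℝ u).continuous.measurable.comp hNmeas)) ?_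
      filter_upwards [hC, hN.bound n hn] with ω h1 h2
      rw [abs_mul]
      refine mul_le_mul h1 ((abs_real_inner_le_norm _ _).trans ?_) (abs_nonneg _)
        ((abs_nonneg _).trans h1)
      exact mul_le_mul_of_nonneg_left h2 (norm_nonneg _)
    have hpt : ∀ᵐ ω ∂ν, Real.exp (inner ℝ u (noiseSum A a N (n + 1) ω)) ≤
        Real.cosh c * Y ω + (a n * (Real.sinh c / c)) * (Y ω * inner ℝ u (N n ω)) := by
      filter_upwards [hN.bound n hn] with ω hω
      have hsplit : inner ℝ u (noiseSum A a N (n + 1) ω) =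
          inner ℝ v (noiseSum A a N n ω) + a n * inner ℝ u (N n ω) := by
        rw [noiseSum, inner_add_right, inner_smul_right, hv,
          ContinuousLinearMap.adjoint_inner_left]
      have habs : |a n * inner ℝ u (N n ω)| ≤ c := by
        rw [abs_mul, abs_of_nonneg (ha n), hc, mul_assoc]
        refine mul_le_mul_of_nonneg_left ((abs_real_inner_le_norm _ _).trans ?_) (ha n)
        rw [mul_comm]
        exact mul_le_mul_of_nonneg_right hω (norm_nonneg _)
      rw [hsplit, Real.exp_add]
      have := mul_le_mul_of_nonneg_left (exp_le_cosh_add habs) (Real.exp_pos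
        (inner ℝ v (noiseSum A a N n ω))).le
      refine this.trans (le_of_eq ?_)
      rw [hY]
      ring
    calc ∫ ω, Real.exp (inner ℝ u (noiseSum A a N (n + 1) ω)) ∂ν
        ≤ ∫ ω, (Real.cosh c * Y ω +
            (a n * (Real.sinh c / c)) * (Y ω * inner ℝ u (N n ω))) ∂ν :=
          integral_mono_ae (integrable_of_ae_bound (hmeas _ _) hC')
            ((hYint.const_mul _).add (hYN.const_mul _)) hpt
      _ = Real.cosh c * ∫ ω, Y ω ∂ν := by
          rw [integral_add (hYint.const_mul _) (hYN.const_mul _), integral_const_mul,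
            integral_const_mul, horth, mul_zero, add_zero]
      _ ≤ Real.exp (c ^ 2 / 2) * Real.exp (b ^ 2 * varianceSeq ρ a n₀ n * ‖v‖ ^ 2 / 2) :=
          mul_le_mul (Real.cosh_le_exp_half_sq c) hYle
            (integral_nonneg fun _ => (Real.exp_pos _).le) (Real.exp_pos _).le
      _ ≤ _ := by
          rw [← Real.exp_add, varianceSeq_succ _ _ hn]
          apply Real.exp_le_exp.2
          have hV : 0 ≤ varianceSeq ρ a n₀ n := by
            clear * -
            induction n with
            | zero => simp [varianceSeq]
            | succ n ih => rw [varianceSeq]; split_ifs <;> positivity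
          have h1 : ‖v‖ ^ 2 ≤ (ρ n * ‖u‖) ^ 2 := pow_le_pow_left₀ (norm_nonneg _) hv_norm 2
          have h2 := mul_le_mul_of_nonneg_left h1 (mul_nonneg (sq_nonneg b) hV)
          rw [hc]
          nlinarith

/-- Chernoff's bound with the optimal parameter r/σ². -/
theorem measure_inner_noiseSum_ge_le (h𝓕 : Monotone 𝓕) (h𝓕Ω : ∀ n, 𝓕 n ≤ mΩ)
    (hN : IsBoundedNoise ν 𝓕 n₀ b N) (h0 : noiseSum A a N n₀ = 0) (ha : ∀ n, 0 ≤ a n)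
    (hρ : ∀ n, n₀ ≤ n → ‖(1 : Vec d →L[ℝ] Vec d) - a n • A‖ ≤ ρ n) {n : ℕ} (hn : n₀ ≤ n)
    {σ2 : ℝ} (hσ : 0 < σ2) (hV : b ^ 2 * varianceSeq ρ a n₀ n ≤ σ2) {u : Vec d} (hu : ‖u‖ = 1)
    {r : ℝ} (hr : 0 ≤ r) :
    ν.real {ω | r ≤ inner ℝ u (noiseSum A a N n ω)} ≤ Real.exp (-(r ^ 2 / (2 * σ2))) := by
  obtain ⟨h1, h2⟩ := integral_exp_inner_noiseSum_le h𝓕 h𝓕Ω hN h0 ha hρ n hn ((r / σ2) • u)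
  simp only [real_inner_smul_left] at h1 h2
  refine (ProbabilityTheory.measure_ge_le_exp_mul_mgf (t := r / σ2) r (by positivity) h1).trans ?_
  rw [norm_smul, hu, mul_one, Real.norm_of_nonneg (by positivity)] at h2
  calc Real.exp (-(r / σ2) * r) * ProbabilityTheory.mgf
        (fun ω => inner ℝ u (noiseSum A a N n ω)) ν (r / σ2)
      ≤ Real.exp (-(r / σ2) * r) * Real.exp (σ2 * (r / σ2) ^ 2 / 2) := by
        refine mul_le_mul_of_nonneg_left (h2.trans ?_) (Real.exp_pos _).le
        apply Real.exp_le_exp.2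
        gcongr
    _ = _ := by
      rw [← Real.exp_add]
      congr 1
      field_simp
      ring

/-- A norm above ε forces some coordinate to reach ε/√d in absolute value: a union of 2d
half-spaces. -/
theorem measure_norm_noiseSum_gt_le (hd : 1 ≤ d) (h𝓕 : Monotone 𝓕) (h𝓕Ω : ∀ n, 𝓕 n ≤ mΩ)
    (hN : IsBoundedNoise ν 𝓕 n₀ b N) (h0 : noiseSum A a N n₀ = 0) (ha : ∀ n, 0 ≤ a n)
    (hρ : ∀ n, n₀ ≤ n → ‖(1 : Vec d →L[ℝ] Vec d) - a n • A‖ ≤ ρ n) {n : ℕ} (hn : n₀ ≤ n)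
    {σ2 : ℝ} (hσ : 0 < σ2) (hV : b ^ 2 * varianceSeq ρ a n₀ n ≤ σ2) {ε : ℝ} (hε : 0 ≤ ε) :
    ν.real {ω | ε < ‖noiseSum A a N n ω‖} ≤ 2 * d * Real.exp (-(ε ^ 2 / (2 * d * σ2))) := by
  have hd0 : (0 : ℝ) < d := by exact_mod_cast hd
  set L := noiseSum A a N n
  set r := ε / Real.sqrt d with hr
  have hr0 : 0 ≤ r := by positivity
  have hr2 : r ^ 2 = ε ^ 2 / d := by rw [hr, div_pow, Real.sq_sqrt hd0.le]
  have hbasis : ∀ i : Fin d, ‖(EuclideanSpace.single i (1 : ℝ) : Vec d)‖ = 1 := fun i => by simp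
  have hsub : {ω | ε < ‖L ω‖} ⊆ ⋃ i ∈ (Finset.univ : Finset (Fin d)),
      ({ω | r ≤ inner ℝ (EuclideanSpace.single i (1 : ℝ) : Vec d) (L ω)} ∪
        {ω | r ≤ inner ℝ (-EuclideanSpace.single i (1 : ℝ) : Vec d) (L ω)}) := by
    intro ω hω
    by_contra hcon
    simp only [Set.mem_iUnion, Finset.mem_univ, Set.mem_union, Set.mem_ofPred_eq, exists_prop,
      true_and, not_exists, not_or, not_le, inner_neg_left, EuclideanSpace.inner_single_left,
      map_one, one_mul] at hcon
    have h1 : ‖L ω‖ ^ 2 ≤ ε ^ 2 := by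
      rw [EuclideanSpace.norm_sq_eq]
      calc ∑ i, ‖L ω i‖ ^ 2 ≤ ∑ _i : Fin d, r ^ 2 := by
            refine Finset.sum_le_sum fun i _ => ?_
            refine pow_le_pow_left₀ (norm_nonneg _) ?_ 2
            rw [Real.norm_eq_abs, abs_le]
            exact ⟨by linarith [(hcon i).2], (hcon i).1.le⟩
        _ = ε ^ 2 := by
            rw [Finset.sum_const, Finset.card_univ, Fintype.card_fin, nsmul_eq_mul, hr2]
            field_simp
    exact absurd (le_of_sq_le_sq h1 hε) (not_le.2 hω)
  refine (measureReal_mono hsub (measure_ne_top _ _)).trans ((measureReal_biUnion_finset_le _ _).trans ?_)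
  calc ∑ i : Fin d, ν.real ({ω | r ≤ inner ℝ (EuclideanSpace.single i (1 : ℝ) : Vec d) (L ω)} ∪
        {ω | r ≤ inner ℝ (-EuclideanSpace.single i (1 : ℝ) : Vec d) (L ω)})
      ≤ ∑ _i : Fin d, 2 * Real.exp (-(r ^ 2 / (2 * σ2))) := by
        refine Finset.sum_le_sum fun i _ => (measureReal_union_le _ _).trans ?_
        rw [two_mul]
        refine add_le_add ?_ ?_
        · exact measure_inner_noiseSum_ge_le h𝓕 h𝓕Ω hN h0 ha hρ hn hσ hV (hbasis i) hr0
        · exact measure_inner_noiseSum_ge_le h𝓕 h𝓕Ω hN h0 ha hρ hn hσ hV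
            (by rw [norm_neg]; exact hbasis i) hr0
    _ = _ := by
      rw [Finset.sum_const, Finset.card_univ, Fintype.card_fin, nsmul_eq_mul, hr2]
      have : ε ^ 2 / d / (2 * σ2) = ε ^ 2 / (2 * d * σ2) := by field_simp
      rw [this]
      ring

end Concentration

/-! ### From the vector iteration to the scalar recursions. -/

/-- Bernoulli gives a relative decrease of at most a/(n+1), and 1/(n+1) ≤ 2/(n+2) ≤ 2(n+2)^(-γ). For
the ratios r_n this makes r_n - r_{n+1} of order α_{n+1} r_{n+1}, whence the 2(α - β) in C_T. -/
theorem step_sub_step_succ_le {a γ : ℝ} (ha0 : 0 ≤ a) (ha1 : a ≤ 1) (hγ : γ ≤ 1)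
    (n : ℕ) : step a n - step a (n + 1) ≤ 2 * a * (step γ (n + 1) * step a (n + 1)) ∧
      step a n ≤ (1 + a) * step a (n + 1) := by
  have hn : (0 : ℝ) < n + 1 := by positivity
  have hs := step_pos a (n + 1)
  have hinv : 1 / ((n : ℝ) + 1) ≤ 2 * step γ (n + 1) := by
    have h1 : step 1 (n + 1) ≤ step γ (n + 1) := step_le_step hγ _
    refine le_trans ?_ (mul_le_mul_of_nonneg_left h1 (by norm_num))
    rw [step, Real.rpow_neg_one]
    push_cast
    rw [← div_eq_mul_inv, div_le_div_iff₀ hn (by positivity)]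
    have : (0 : ℝ) ≤ n := Nat.cast_nonneg n
    linarith
  have hr : step a n ≤ (1 + a * (1 / (n + 1))) * step a (n + 1) := by
    have h1 := rpow_one_add_le_one_add_mul_self (s := 1 / ((n : ℝ) + 1))
      (by linarith [show 0 < 1 / ((n : ℝ) + 1) by positivity]) ha0 ha1
    refine le_trans (le_of_eq ?_) (mul_le_mul_of_nonneg_right h1 hs.le)
    have h2 : ((n + 1 : ℕ) : ℝ) + 1 = (1 + 1 / ((n : ℝ) + 1)) * (n + 1) := by
      push_cast; field_simp
    unfold step
    rw [h2, Real.mul_rpow (by positivity) hn.le, ← mul_assoc, ← Real.rpow_add (by positivity)]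
    simp
  have h1 : 1 / ((n : ℝ) + 1) ≤ 1 := by
    rw [div_le_one hn]
    have : (0 : ℝ) ≤ n := Nat.cast_nonneg n
    linarith
  constructor
  · have h2 := mul_le_mul_of_nonneg_right (mul_le_mul_of_nonneg_left hinv ha0) hs.le
    linarith
  · refine hr.trans (mul_le_mul_of_nonneg_right ?_ hs.le)
    have := mul_le_mul_of_nonneg_left h1 ha0
    linarith

namespace Data

variable {d : ℕ} {P : Data d} {n₀ : ℕ}

theorem Valid.act_X₁_θstar (hP : P.Valid) : act P.X₁ P.θstar = P.b₁ := by
  rw [θstar, ← mul_apply_eq_comp, ← act_mul, Matrix.mul_nonsing_inv _ hP.posDef_X₁.isUnit_det,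
    act_one, one_apply_eq_self]

theorem Valid.act_W₂_wstar (hP : P.Valid) : act P.W₂ P.wstar = P.v₂ - act P.Γ₂ P.θstar := by
  rw [wstar, ← mul_apply_eq_comp, ← act_mul, Matrix.mul_nonsing_inv _ hP.posDef_W₂.isUnit_det,
    act_one, one_apply_eq_self]

theorem Valid.act_mul_inv_apply (hP : P.Valid) (v : Vec d) :
    act (P.W₁ * P.W₂⁻¹) (act P.W₂ v) = act P.W₁ v := by
  rw [← mul_apply_eq_comp, ← act_mul, Matrix.mul_assoc,
    Matrix.nonsing_inv_mul _ hP.posDef_W₂.isUnit_det, mul_one]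

theorem act_X₁_apply (v : Vec d) :
    act P.X₁ v = act P.Γ₁ v - act (P.W₁ * P.W₂⁻¹) (act P.Γ₂ v) := by
  rw [X₁, act_sub, sub_apply, act_mul (P.W₁ * P.W₂⁻¹), mul_apply_eq_comp]

theorem Valid.h₂_eq (hP : P.Valid) (θ w : Vec d) :
    P.h₂ θ w = -act P.Γ₂ (θ - P.θstar) - act P.W₂ (w - P.wstar) := by
  rw [h₂, map_sub, map_sub, hP.act_W₂_wstar]
  abel

/-- The equation X₁θ* = b₁, with w* substituted, says that h₁ vanishes at (θ*, w*). -/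
theorem Valid.h₁_eq (hP : P.Valid) (θ w : Vec d) :
    P.h₁ θ w = -act P.Γ₁ (θ - P.θstar) - act P.W₁ (w - P.wstar) := by
  have h1 := hP.act_X₁_θstar
  rw [act_X₁_apply, b₁] at h1
  have h2 : act P.W₁ P.wstar = act (P.W₁ * P.W₂⁻¹) P.v₂ -
      act (P.W₁ * P.W₂⁻¹) (act P.Γ₂ P.θstar) := by
    rw [← hP.act_mul_inv_apply, hP.act_W₂_wstar, map_sub]
  have h3 : P.v₁ = act P.Γ₁ P.θstar + act P.W₁ P.wstar := by
    rw [h2, ← sub_eq_zero] at *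
    rw [← neg_eq_zero, ← h1]
    abel
  rw [h₁, map_sub, map_sub]
  nth_rewrite 1 [h3]
  abel

theorem Admissible.errorRecursion (h : P.Admissible n₀) {e f ξ₁ ξ₂ Lθ Lw : ℕ → Vec d}
    (he : ∀ n, e (n + 1) = e n + step P.α n • (-act P.Γ₁ (e n) - act P.W₁ (f n) + ξ₁ n))
    (hf : ∀ n, f (n + 1) = f n + step P.β n • (-act P.Γ₂ (e n) - act P.W₂ (f n) + ξ₂ n))
    (hLθ₀ : Lθ n₀ = 0) (hLw₀ : Lw n₀ = 0)
    (hLθ : ∀ n, n₀ ≤ n → P.InRange n₀ (fun k => ‖e k‖) (fun k => ‖f k‖) n →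
      Lθ (n + 1) = ((1 : Vec d →L[ℝ] Vec d) - step P.α n • act P.X₁) (Lθ n) +
        step P.α n • (ξ₁ n - act (P.W₁ * P.W₂⁻¹) (ξ₂ n)))
    (hLw : ∀ n, n₀ ≤ n → P.InRange n₀ (fun k => ‖e k‖) (fun k => ‖f k‖) n →
      Lw (n + 1) = ((1 : Vec d →L[ℝ] Vec d) - step P.β n • act P.W₂) (Lw n) +
        step P.β n • ξ₂ n)
    (hεθ : ∀ n, n₀ ≤ n → ‖Lθ (n + 1)‖ ≤ P.εθ n) (hεw : ∀ n, n₀ ≤ n → ‖Lw (n + 1)‖ ≤ P.εw n) :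
    P.ErrorRecursion n₀ (fun n => ‖e n‖) (fun n => ‖f n‖)
      (fun n => ‖e n - Lθ n - step (P.α - P.β) (n - 1) • act (P.W₁ * P.W₂⁻¹) (f n)‖)
      (fun n => ‖f n - Lw n‖) := by
  have hαβ : 0 < P.α - P.β := by linarith [h.β_lt_α]
  set S := act (P.W₁ * P.W₂⁻¹) with hS
  have hSnorm : ∀ v, ‖S v‖ ≤ opNorm (P.W₁ * P.W₂⁻¹) * ‖v‖ := fun v => S.le_opNorm v
  have hXnorm : ∀ v, ‖act P.X₁ v‖ ≤ opNorm P.X₁ * ‖v‖ := fun v => (act P.X₁).le_opNorm v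
  have hS0 := opNorm_nonneg (P.W₁ * P.W₂⁻¹)
  have hX0 := opNorm_nonneg P.X₁
  -- The key cancellation: r_n β_n = α_n and S W₂ = W₁ remove W₁f, while Γ₁ - SΓ₂ = X₁ appears in
  -- front of e.
  have hstep : ∀ n, n₀ ≤ n → P.InRange n₀ (fun k => ‖e k‖) (fun k => ‖f k‖) n →
      e (n + 1) - Lθ (n + 1) - step (P.α - P.β) n • S (f (n + 1)) =
        ((1 : Vec d →L[ℝ] Vec d) - step P.α n • act P.X₁) (e n - Lθ n) -
          step (P.α - P.β) n • S (f n) := by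
    intro n hn hin
    have hrβ : step (P.α - P.β) n * step P.β n = step P.α n := by
      rw [step_mul_step]; ring_nf
    rw [hLθ n hn hin, he n, hf n]
    simp only [map_add, map_sub, map_smul, map_neg, sub_apply, smul_apply, one_apply_eq_self,
      act_X₁_apply, hS, h.act_mul_inv_apply, ← hrβ]
    module
  refine
    { x_nonneg := fun n => norm_nonneg _
      y_nonneg := fun n => norm_nonneg _
      z_init := fun hin => ?_
      z_succ := fun n hn hin => ?_
      x_le := fun n hn => ?_
      t_init := by simp [hLw₀]
      t_succ := fun n hn hin => ?_
      y_le := fun n hn => ?_ }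
  · simp only [Nat.add_sub_cancel]
    rw [hstep n₀ le_rfl hin, hLθ₀, sub_zero]
    refine (norm_sub_le _ _).trans (add_le_add ?_ ?_)
    · exact (ContinuousLinearMap.le_opNorm _ _).trans
        (mul_le_mul_of_nonneg_right (h.contract₁ n₀ le_rfl) (norm_nonneg _))
    · rw [norm_smul, Real.norm_of_nonneg (step_pos _ _).le]
      have := mul_le_mul_of_nonneg_left (hSnorm (f n₀)) (step_pos (P.α - P.β) n₀).le
      linarith
  · have hn' : n₀ ≤ n + 1 := by omega
    simp only [show n + 2 - 1 = n + 1 from rfl, Nat.add_sub_cancel]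
    set r := step (P.α - P.β) n
    set r' := step (P.α - P.β) (n + 1)
    set a := step P.α (n + 1) with ha
    have hr' : 0 < r' := step_pos _ _
    have hr : 0 < r := step_pos _ _
    have ha0 : 0 < a := step_pos _ _
    have hrr : r' ≤ r := step_antitone hαβ.le n.le_succ
    obtain ⟨hd1, hd2⟩ := step_sub_step_succ_le (γ := P.α) hαβ.le
      (by linarith [h.α_lt_one, h.β_pos]) h.α_lt_one.le n
    -- Reinserting the correction r S f of the previous index leaves only the increment r - r' and a
    -- term carrying the stepsize a.
    have hsplit : e (n + 2) - Lθ (n + 2) - r' • S (f (n + 2)) =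
        ((1 : Vec d →L[ℝ] Vec d) - a • act P.X₁) (e (n + 1) - Lθ (n + 1) - r • S (f (n + 1))) +
          ((r - r') • S (f (n + 1)) - (a * r) • act P.X₁ (S (f (n + 1)))) := by
      rw [hstep (n + 1) hn' hin]
      simp only [map_sub, map_smul, sub_apply, smul_apply, one_apply_eq_self]
      module
    rw [hsplit]
    refine (norm_add_le _ _).trans (add_le_add ?_ ?_)
    · exact (ContinuousLinearMap.le_opNorm _ _).trans
        (mul_le_mul_of_nonneg_right (h.contract₁ (n + 1) hn') (norm_nonneg _))
    · have hSf := hSnorm (f (n + 1))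
      have hF : 0 ≤ opNorm (P.W₁ * P.W₂⁻¹) * ‖f (n + 1)‖ := by positivity
      calc ‖(r - r') • S (f (n + 1)) - (a * r) • act P.X₁ (S (f (n + 1)))‖
          ≤ (r - r') * ‖S (f (n + 1))‖ + (a * r) * (opNorm P.X₁ * ‖S (f (n + 1))‖) := by
            refine (norm_sub_le _ _).trans (add_le_add (le_of_eq ?_) ?_)
            · rw [norm_smul, Real.norm_of_nonneg (by linarith)]
            · rw [norm_smul, Real.norm_of_nonneg (by positivity)]
              exact mul_le_mul_of_nonneg_left (hXnorm _) (by positivity)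
        _ = ((r - r') + a * r * opNorm P.X₁) * ‖S (f (n + 1))‖ := by ring
        _ ≤ (2 * (P.α - P.β) * (a * r') + a * ((1 + (P.α - P.β)) * r') * opNorm P.X₁) *
              (opNorm (P.W₁ * P.W₂⁻¹) * ‖f (n + 1)‖) := by gcongr
        _ ≤ (a * r' * P.CT) * (opNorm (P.W₁ * P.W₂⁻¹) * ‖f (n + 1)‖) := by
            refine mul_le_mul_of_nonneg_right ?_ hF
            have : 0 ≤ a * r' * ((P.α - P.β) * opNorm P.X₁) := by positivity
            unfold CT
            linarith
        _ = _ := by ring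
  · simp only [Nat.add_sub_cancel]
    have h1 : e (n + 1) = (e (n + 1) - Lθ (n + 1) - step (P.α - P.β) n • S (f (n + 1))) +
        Lθ (n + 1) + step (P.α - P.β) n • S (f (n + 1)) := by abel
    have h2 : ‖step (P.α - P.β) n • S (f (n + 1))‖ ≤
        opNorm (P.W₁ * P.W₂⁻¹) * (step (P.α - P.β) n * ‖f (n + 1)‖) := by
      rw [norm_smul, Real.norm_of_nonneg (step_pos _ _).le]
      have := mul_le_mul_of_nonneg_left (hSnorm (f (n + 1))) (step_pos (P.α - P.β) n).le
      linarith
    calc ‖e (n + 1)‖ ≤ ‖e (n + 1) - Lθ (n + 1) - step (P.α - P.β) n • S (f (n + 1))‖ +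
          ‖Lθ (n + 1)‖ + ‖step (P.α - P.β) n • S (f (n + 1))‖ := by
          conv_lhs => rw [h1]
          exact norm_add₃_le
      _ ≤ _ := add_le_add (add_le_add_right (hεθ n hn) _) h2
  · have hsplit : f (n + 1) - Lw (n + 1) =
        ((1 : Vec d →L[ℝ] Vec d) - step P.β n • act P.W₂) (f n - Lw n) -
          step P.β n • act P.Γ₂ (e n) := by
      rw [hLw n hn hin, hf n]
      simp only [map_sub, sub_apply, smul_apply, one_apply_eq_self]
      module
    rw [hsplit]
    refine (norm_sub_le _ _).trans (add_le_add ?_ ?_)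
    · exact (ContinuousLinearMap.le_opNorm _ _).trans
        (mul_le_mul_of_nonneg_right (h.contract₂ n hn) (norm_nonneg _))
    · rw [norm_smul, Real.norm_of_nonneg (step_pos _ _).le]
      exact mul_le_mul_of_nonneg_left ((act P.Γ₂).le_opNorm _) (step_pos _ _).le
  · calc ‖f (n + 1)‖ = ‖(f (n + 1) - Lw (n + 1)) + Lw (n + 1)‖ := by rw [sub_add_cancel]
      _ ≤ ‖f (n + 1) - Lw (n + 1)‖ + ‖Lw (n + 1)‖ := norm_add_le _ _
      _ ≤ _ := add_le_add_right (hεw n hn) _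

end Data

/-! ### Tail bounds with the constants of the statement. -/

theorem exists_sum_rpow_le {p : ℝ} (hp : 1 < p) {n₀ : ℕ} (hn₀ : 0 < n₀)
    (h : (n₀ : ℝ) ^ (1 - p) / (p - 1) ≤ 1) :
    ∃ c < 1, ∀ K, ∑ k ∈ Finset.range K, ((n₀ : ℝ) + k + 1) ^ (-p) ≤ c := by
  have hp1 : 0 < p - 1 := by linarith
  set g : ℕ → ℝ := fun k => ((n₀ : ℝ) + k) ^ (1 - p) / (p - 1) with hg
  have hg0 : ∀ k, 0 ≤ g k := fun k => by positivity
  have key : ∀ k : ℕ, ((n₀ : ℝ) + k + 1) ^ (-p) < g k - g (k + 1) := by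
    intro k
    have ht : (0 : ℝ) < n₀ + k := by positivity
    set t : ℝ := n₀ + k
    have hcast : ((n₀ : ℝ) + ((k + 1 : ℕ) : ℝ)) = t + 1 := by push_cast; ring
    have h1 := one_add_mul_self_lt_rpow_one_add (s := 1 / t)
      (by linarith [show 0 < 1 / t by positivity]) (by positivity) hp
    have h2 : (1 + 1 / t) ^ p = t ^ (1 - p) * (t + 1) ^ p / t := by
      have : 1 + 1 / t = (t + 1) / t := by field_simp
      rw [this, Real.div_rpow (by positivity) ht.le, Real.rpow_sub ht, Real.rpow_one]
      field_simp
    rw [h2, lt_div_iff₀ ht] at h1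
    have h3 : (t + 1) ^ (1 - p) = (t + 1) * (t + 1) ^ (-p) := by
      rw [sub_eq_add_neg, Real.rpow_add (by positivity), Real.rpow_one]
    have h4 : (t + 1) ^ p * (t + 1) ^ (-p) = 1 := by
      rw [← Real.rpow_add (by positivity)]; simp
    simp only [hg]
    rw [hcast, h3, ← sub_div, lt_div_iff₀ hp1]
    have h5 : 0 < (t + 1) ^ (-p) := by positivity
    have h6 := mul_lt_mul_of_pos_right h1 h5
    have h7 : (1 + p * (1 / t)) * t = t + p := by field_simp
    rw [h7, mul_assoc, h4, mul_one] at h6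
    linarith
  -- Keeping the first term instead of telescoping it preserves one strict Bernoulli inequality, so
  -- c < g(0) ≤ 1. This is what makes the final probability bound strict.
  refine ⟨((n₀ : ℝ) + 1) ^ (-p) + g 1, ?_, fun K => ?_⟩
  · have h0 := key 0
    have hg00 : g 0 ≤ 1 := by simpa [hg] using h
    simp only [Nat.cast_zero, add_zero] at h0
    linarith
  · have hK : ∀ K : ℕ, ∑ k ∈ Finset.range (K + 1), ((n₀ : ℝ) + k + 1) ^ (-p) ≤
        ((n₀ : ℝ) + 1) ^ (-p) + g 1 - g (K + 1) := by
      intro K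
      induction K with
      | zero => simp
      | succ K ih =>
        rw [Finset.sum_range_succ]
        have := key (K + 1)
        linarith
    rcases K with _ | K
    · simp only [Finset.range_zero, Finset.sum_empty]
      have := hg0 1
      positivity
    · linarith [hK K, hg0 (K + 1)]

namespace Data

variable {d : ℕ} {P : Data d} {n₀ : ℕ}

/-- With X the argument of the logarithm in ν, the exponent equals d² ln X, and 2d/X =
(δ/2d)(n+1)^(-p). -/
theorem Valid.exp_neg_div_le (hP : P.Valid) {L D γ : ℝ} (hL : 0 < L) (hD : 0 < D) (n : ℕ) :
    2 * d * Real.exp (-((Real.sqrt ((d : ℝ) ^ 3 * L * D) * P.ν n γ) ^ 2 /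
      (2 * d * (L / 2 * D * step γ n)))) ≤ P.δ / 2 * ((n : ℝ) + 1) ^ (-P.p) := by
  have hd := hP.dim_pos
  have hd1 : (1 : ℝ) ≤ d := by exact_mod_cast hP.one_le_dim
  have hδ := hP.δ_pos
  have hs := step_pos γ n
  have hX := hP.log_arg_pos n
  have hl := hP.one_le_log n
  set X := 4 * (d : ℝ) ^ 2 * ((n : ℝ) + 1) ^ P.p / P.δ with hXdef
  have h1 : (Real.sqrt ((d : ℝ) ^ 3 * L * D) * P.ν n γ) ^ 2 /
      (2 * d * (L / 2 * D * step γ n)) = (d : ℝ) ^ 2 * Real.log X := by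
    rw [mul_pow, Real.sq_sqrt (by positivity), hP.ν_sq, ← hXdef]
    generalize Real.log X = l
    field_simp
  have h2 : Real.exp (-((d : ℝ) ^ 2 * Real.log X)) ≤ X⁻¹ := by
    rw [← Real.exp_log hX, ← Real.exp_neg, Real.exp_log hX]
    apply Real.exp_le_exp.2
    have : 1 ≤ (d : ℝ) ^ 2 := one_le_pow₀ hd1
    nlinarith
  rw [h1]
  have hn : 0 < ((n : ℝ) + 1) ^ P.p := by positivity
  calc 2 * d * Real.exp (-((d : ℝ) ^ 2 * Real.log X)) ≤ 2 * d * X⁻¹ := by gcongr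
    _ = P.δ / 2 * ((n : ℝ) + 1) ^ (-P.p) * (1 / d) := by
      rw [hXdef, Real.rpow_neg (by positivity)]
      field_simp
      norm_num
    _ ≤ P.δ / 2 * ((n : ℝ) + 1) ^ (-P.p) * 1 := by
      gcongr
      rw [div_le_one hd]
      exact hd1
    _ = _ := mul_one _

theorem Admissible.γ_div_le₁ (h : P.Admissible n₀) (n : ℕ) (hn : n₀ ≤ n) :
    P.α / (n + 1) ≤ P.q₁ * step P.α (n + 1) := by
  have h1 := h.slow₁ n hn
  have h2 : P.α / ((n : ℝ) + 1) ≤ 2 * ((P.α - P.β / 2) / (n + 1)) := by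
    rw [mul_div_assoc']
    gcongr
    linarith [h.β_lt_α]
  linarith

theorem Admissible.γ_div_le₂ (h : P.Admissible n₀) (n : ℕ) (hn : n₀ ≤ n) :
    P.β / (n + 1) ≤ P.q₂ * step P.β (n + 1) := by
  have h1 := h.slow₂ n hn
  have h2 : P.β / ((n : ℝ) + 1) ≤ 2 * ((P.α - P.β / 2) / (n + 1)) := by
    rw [mul_div_assoc']
    gcongr
    linarith [h.β_lt_α]
  linarith

/-- Tail bound for a contracted noise sum, in terms of the constants of the statement. -/
theorem Valid.measure_noiseSum_gt_le (hP : P.Valid) {Ω : Type*} [mΩ : MeasurableSpace Ω]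
    {ν : Measure Ω} [IsProbabilityMeasure ν] {𝓕 : ℕ → MeasurableSpace Ω} (h𝓕 : Monotone 𝓕)
    (h𝓕Ω : ∀ n, 𝓕 n ≤ mΩ) {b : ℝ} {N : ℕ → Ω → Vec d} (hN : IsBoundedNoise ν 𝓕 n₀ b N)
    (hN0 : ∀ n, n < n₀ → N n = 0) {A : Mat d} {γ q L D : ℝ} (hq : 0 < q) (hγ : 0 ≤ γ)
    (hcontr : ∀ n, n₀ ≤ n →
      ‖(1 : Vec d →L[ℝ] Vec d) - step γ n • act A‖ ≤ Real.exp (-(q * step γ n)))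
    (hslow : ∀ n, n₀ ≤ n → γ / (n + 1) ≤ q * step γ (n + 1))
    (hL : 0 < L) (hbL : b ^ 2 ≤ L / 2) (hD : Real.exp q / q ≤ D) (n : ℕ) (hn : n₀ ≤ n) :
    ν.real {ω | Real.sqrt ((d : ℝ) ^ 3 * L * D) * P.ν n γ <
      ‖noiseSum (act A) (step γ) N (n + 1) ω‖} ≤ P.δ / 2 * ((n : ℝ) + 1) ^ (-P.p) := by
  have hD0 : 0 < D := lt_of_lt_of_le (by positivity) hD
  have hs := step_pos γ n
  have hν := hP.ν_pos n γ
  have hV := variance_recursion_le hq hγ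
    (varianceSeq_self (fun n => Real.exp (-(q * step γ n))) (step γ) n₀)
    (fun n hn => varianceSeq_succ (fun n => Real.exp (-(q * step γ n))) (step γ) hn) hslow n hn
  -- In the proxy σ² = (L/2) D (n+1)^(-γ), L/2 dominates b² and D dominates e^q/q.
  refine (measure_norm_noiseSum_gt_le hP.one_le_dim h𝓕 h𝓕Ω hN
    (noiseSum_eq_zero _ _ hN0 n₀ le_rfl) (fun n => (step_pos γ n).le) hcontr
    (show n₀ ≤ n + 1 by omega) (σ2 := L / 2 * D * step γ n) (by positivity) ?_
    (by positivity)).trans (hP.exp_neg_div_le hL hD0 n)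
  rw [mul_assoc]
  refine (mul_le_mul_of_nonneg_left (hV.trans ?_) (sq_nonneg b)).trans
    (mul_le_mul_of_nonneg_right hbL (by positivity))
  gcongr

end Data

/-! ### Stopped noise and the probability of the good event. -/

section Noise

variable {d : ℕ} {Ω : Type*}

theorem measurable_M₁_history (θ₀ w₀ : Ω → Vec d) (M₁ M₂ : ℕ → Ω → Vec d) (n : ℕ) :
    Measurable[history θ₀ w₀ M₁ M₂ (n + 1)] (M₁ (n + 1)) := by
  refine Measurable.mono (comap_measurable _) ?_ le_rfl
  refine le_sup_of_le_right (le_iSup₂_of_le (n + 1) (by simp) le_sup_left)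

theorem measurable_M₂_history (θ₀ w₀ : Ω → Vec d) (M₁ M₂ : ℕ → Ω → Vec d) (n : ℕ) :
    Measurable[history θ₀ w₀ M₁ M₂ (n + 1)] (M₂ (n + 1)) := by
  refine Measurable.mono (comap_measurable _) ?_ le_rfl
  refine le_sup_of_le_right (le_iSup₂_of_le (n + 1) (by simp) le_sup_right)

theorem history_mono (θ₀ w₀ : Ω → Vec d) (M₁ M₂ : ℕ → Ω → Vec d) :
    Monotone (history θ₀ w₀ M₁ M₂) := fun _ _ hmn =>
  sup_le_sup_left (biSup_mono fun _ hk => Finset.Icc_subset_Icc_right hmn hk) _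

variable {P : Data d} {θ w M₁ M₂ : ℕ → Ω → Vec d} {m₁ m₂ : ℝ}

/-- The event that the errors are in range on `[n₀, n]`. -/
def rangeEvent (P : Data d) (n₀ : ℕ) (θ w : ℕ → Ω → Vec d) (n : ℕ) : Set Ω :=
  {ω | n₀ ≤ n ∧ P.InRange n₀ (fun k => ‖θ k ω - P.θstar‖) (fun k => ‖w k ω - P.wstar‖) n}

theorem norm_add_norm_le_of_mem_rangeEvent {n₀ n : ℕ} {ω : Ω} (hω : ω ∈ rangeEvent P n₀ θ w n) :
    1 + ‖θ n ω‖ + ‖w n ω‖ ≤ P.size := by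
  obtain ⟨h1, h2⟩ := hω.2 n hω.1 le_rfl
  have h3 := norm_le_norm_sub_add (θ n ω) P.θstar
  have h4 := norm_le_norm_sub_add (w n ω) P.wstar
  unfold Data.size
  linarith

theorem rangeEvent_eq_empty {n₀ n : ℕ} (h : n < n₀) : rangeEvent P n₀ θ w n = ∅ := by
  ext ω
  simp [rangeEvent, h]

theorem indicator_one_mul_bound {B : Set Ω} {Y : Ω → ℝ} {C : ℝ} (hY : ∀ ω, |Y ω| ≤ C) (ω : Ω) :
    |B.indicator Y ω| ≤ C := by
  by_cases hω : ω ∈ B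
  · simpa [hω] using hY ω
  · simpa [hω] using (abs_nonneg _).trans (hY ω)

variable [mΩ : MeasurableSpace Ω] {μ : Measure Ω}

theorem DominatedMartingaleDifferences.history_le
    (hnoise : DominatedMartingaleDifferences μ θ w M₁ M₂ m₁ m₂) (hθ : Measurable (θ 0))
    (hw : Measurable (w 0)) (n : ℕ) : history (θ 0) (w 0) M₁ M₂ n ≤ mΩ := by
  refine sup_le (sup_le hθ.comap_le hw.comap_le) (iSup₂_le fun k hk => ?_)
  obtain ⟨j, rfl⟩ : ∃ j, k = j + 1 := ⟨k - 1, by have := (Finset.mem_Icc.1 hk).1; omega⟩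
  exact sup_le (hnoise.measurable₁ j).comap_le (hnoise.measurable₂ j).comap_le

theorem IsIterates.measurable_history (hiter : IsIterates P θ w M₁ M₂) (n : ℕ) :
    Measurable[history (θ 0) (w 0) M₁ M₂ n] (θ n) ∧
      Measurable[history (θ 0) (w 0) M₁ M₂ n] (w n) := by
  induction n with
  | zero =>
    exact ⟨(comap_measurable _).mono (le_sup_of_le_left le_sup_left) le_rfl,
      (comap_measurable _).mono (le_sup_of_le_left le_sup_right) le_rfl⟩
  | succ n ih =>
    have hle := history_mono (θ 0) (w 0) M₁ M₂ n.le_succ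
    have h1 := ih.1.mono hle le_rfl
    have h2 := ih.2.mono hle le_rfl
    have hθ : θ (n + 1) = fun ω =>
        θ n ω + step P.α n • (P.h₁ (θ n ω) (w n ω) + M₁ (n + 1) ω) :=
      funext (hiter.θ_succ n)
    have hw : w (n + 1) = fun ω =>
        w n ω + step P.β n • (P.h₂ (θ n ω) (w n ω) + M₂ (n + 1) ω) :=
      funext (hiter.w_succ n)
    rw [hθ, hw]
    unfold Data.h₁ Data.h₂
    constructor
    · have := ((((act P.Γ₁).continuous.measurable.comp h1).const_sub P.v₁).sub
        ((act P.W₁).continuous.measurable.comp h2)).add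
          (measurable_M₁_history (θ 0) (w 0) M₁ M₂ n) |>.const_smul (step P.α n)
      exact h1.add this
    · have := ((((act P.Γ₂).continuous.measurable.comp h1).const_sub P.v₂).sub
        ((act P.W₂).continuous.measurable.comp h2)).add
          (measurable_M₂_history (θ 0) (w 0) M₁ M₂ n) |>.const_smul (step P.β n)
      exact h2.add this

theorem IsIterates.measurableSet_errors_le (hiter : IsIterates P θ w M₁ M₂) (n : ℕ) (a b : ℝ) :
    MeasurableSet[history (θ 0) (w 0) M₁ M₂ n]
      {ω | ‖θ n ω - P.θstar‖ ≤ a ∧ ‖w n ω - P.wstar‖ ≤ b} := by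
  obtain ⟨h1, h2⟩ := hiter.measurable_history n
  exact MeasurableSet.inter (measurable_norm.comp (h1.sub_const P.θstar) measurableSet_Iic)
    (measurable_norm.comp (h2.sub_const P.wstar) measurableSet_Iic)

theorem IsIterates.measurableSet_rangeEvent (hiter : IsIterates P θ w M₁ M₂) (n₀ n : ℕ) :
    MeasurableSet[history (θ 0) (w 0) M₁ M₂ n] (rangeEvent P n₀ θ w n) := by
  have : rangeEvent P n₀ θ w n = {_ω | n₀ ≤ n} ∩ ⋂ k, ⋂ (_ : n₀ ≤ k), ⋂ (_ : k ≤ n),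
      {ω | ‖θ k ω - P.θstar‖ ≤ Data.CRθ * P.Rθ ∧ ‖w k ω - P.wstar‖ ≤ P.CRw * P.Rw} := by
    ext ω
    simp [rangeEvent, Data.InRange]
  rw [this]
  refine (MeasurableSet.const _).inter (MeasurableSet.iInter fun k => MeasurableSet.iInter fun _ =>
    MeasurableSet.iInter fun hk => ?_)
  exact history_mono (θ 0) (w 0) M₁ M₂ hk _ (hiter.measurableSet_errors_le k _ _)

/-- The noise `M₂`, stopped when the errors leave the range. -/
noncomputable def stoppedNoise₂ (P : Data d) (n₀ : ℕ) (θ w M₂ : ℕ → Ω → Vec d) (n : ℕ) :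
    Ω → Vec d :=
  (rangeEvent P n₀ θ w n).indicator (M₂ (n + 1))

/-- The noise `M₁ - W₁ W₂⁻¹ M₂`, stopped when the errors leave the range. -/
noncomputable def stoppedNoise₁ (P : Data d) (n₀ : ℕ) (θ w M₁ M₂ : ℕ → Ω → Vec d) (n : ℕ) :
    Ω → Vec d :=
  (rangeEvent P n₀ θ w n).indicator
    fun ω => M₁ (n + 1) ω - act (P.W₁ * P.W₂⁻¹) (M₂ (n + 1) ω)

theorem integral_cond_eq_zero {G : Set Ω} {f : Ω → ℝ} (h : ∫ ω in G, f ω ∂μ = 0) :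
    ∫ ω, f ω ∂(ProbabilityTheory.cond μ G) = 0 := by
  rw [ProbabilityTheory.cond, integral_smul_measure, h, smul_zero]

variable [IsProbabilityMeasure μ] {G : Set Ω} {n₀ : ℕ}

/-- Both the stopping event and G are known at time n: the former is absorbed into the weight Y, the
latter becomes the domain of integration, so the martingale property survives stopping and
conditioning. -/
theorem isBoundedNoise₂ (hP : P.Valid) (hiter : IsIterates P θ w M₁ M₂)
    (hnoise : DominatedMartingaleDifferences μ θ w M₁ M₂ P.m₁ P.m₂)
    (hG : MeasurableSet[history (θ 0) (w 0) M₁ M₂ n₀] G) :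
    IsBoundedNoise (ProbabilityTheory.cond μ G) (history (θ 0) (w 0) M₁ M₂) n₀
      (P.m₂ * P.size) (stoppedNoise₂ P n₀ θ w M₂) := by
  have hle := hnoise.history_le hiter.measurable_θ₀ hiter.measurable_w₀
  have hmono := history_mono (θ 0) (w 0) M₁ M₂
  have hm₂ := hP.m₂_pos
  have hsize := hP.size_pos
  refine ⟨fun n => ?_, fun n _ => ?_, fun n hn Y C u hY hYC => ?_⟩
  · exact (measurable_M₂_history _ _ _ _ n).indicator
      (hmono n.le_succ _ (hiter.measurableSet_rangeEvent n₀ n))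
  · filter_upwards [ProbabilityTheory.cond_absolutelyContinuous.ae_le (hnoise.bound₂ n)] with ω hω
    by_cases hmem : ω ∈ rangeEvent P n₀ θ w n
    · rw [stoppedNoise₂, Set.indicator_of_mem hmem]
      exact hω.trans (mul_le_mul_of_nonneg_left (norm_add_norm_le_of_mem_rangeEvent hmem) hm₂.le)
    · rw [stoppedNoise₂, Set.indicator_of_notMem hmem, norm_zero]
      positivity
  · apply integral_cond_eq_zero
    rw [← (setIntegral_mul_inner_eq_zero (hle n) (hnoise.integrable₂ n) (hnoise.condExp₂ n)
      (hY.indicator (hiter.measurableSet_rangeEvent n₀ n)) (indicator_one_mul_bound hYC) u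
      (hmono hn _ hG)).2]
    congr 1
    ext ω
    by_cases hmem : ω ∈ rangeEvent P n₀ θ w n <;> simp [stoppedNoise₂, hmem]

theorem isBoundedNoise₁ (hP : P.Valid) (hiter : IsIterates P θ w M₁ M₂)
    (hnoise : DominatedMartingaleDifferences μ θ w M₁ M₂ P.m₁ P.m₂)
    (hG : MeasurableSet[history (θ 0) (w 0) M₁ M₂ n₀] G) :
    IsBoundedNoise (ProbabilityTheory.cond μ G) (history (θ 0) (w 0) M₁ M₂) n₀
      ((P.m₁ + P.m₂ * opNorm P.W₁ * opNorm P.W₂⁻¹) * P.size)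
      (stoppedNoise₁ P n₀ θ w M₁ M₂) := by
  have hle := hnoise.history_le hiter.measurable_θ₀ hiter.measurable_w₀
  have hmono := history_mono (θ 0) (w 0) M₁ M₂
  have hm₁ := hP.m₁_pos
  have hm₂ := hP.m₂_pos
  have hsize := hP.size_pos
  have hW₁ := opNorm_nonneg P.W₁
  have hW₂ := opNorm_nonneg P.W₂⁻¹
  set S := act (P.W₁ * P.W₂⁻¹) with hS
  have hSn : ‖S‖ ≤ opNorm P.W₁ * opNorm P.W₂⁻¹ := opNorm_mul_le _ _
  refine ⟨fun n => ?_, fun n _ => ?_, fun n hn Y C u hY hYC => ?_⟩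
  · exact ((measurable_M₁_history _ _ _ _ n).sub
      (S.continuous.measurable.comp (measurable_M₂_history _ _ _ _ n))).indicator
      (hmono n.le_succ _ (hiter.measurableSet_rangeEvent n₀ n))
  · filter_upwards [ProbabilityTheory.cond_absolutelyContinuous.ae_le (hnoise.bound₁ n),
      ProbabilityTheory.cond_absolutelyContinuous.ae_le (hnoise.bound₂ n)] with ω h1 h2
    by_cases hmem : ω ∈ rangeEvent P n₀ θ w n
    · rw [stoppedNoise₁, Set.indicator_of_mem hmem]
      have hsz := norm_add_norm_le_of_mem_rangeEvent hmem
      have e1 := h1.trans (mul_le_mul_of_nonneg_left hsz hm₁.le)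
      have e2 := h2.trans (mul_le_mul_of_nonneg_left hsz hm₂.le)
      calc ‖M₁ (n + 1) ω - S (M₂ (n + 1) ω)‖
          ≤ ‖M₁ (n + 1) ω‖ + ‖S (M₂ (n + 1) ω)‖ := norm_sub_le _ _
        _ ≤ P.m₁ * P.size + (opNorm P.W₁ * opNorm P.W₂⁻¹) * (P.m₂ * P.size) :=
            add_le_add e1 ((S.le_opNorm _).trans
              (mul_le_mul hSn e2 (norm_nonneg _) (by positivity)))
        _ = _ := by ring
    · rw [stoppedNoise₁, Set.indicator_of_notMem hmem, norm_zero]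
      positivity
  · apply integral_cond_eq_zero
    have hYB := hY.indicator (hiter.measurableSet_rangeEvent n₀ n)
    have hYBC := indicator_one_mul_bound (B := rangeEvent P n₀ θ w n) hYC
    obtain ⟨i1, z1⟩ := setIntegral_mul_inner_eq_zero (hle n) (hnoise.integrable₁ n)
      (hnoise.condExp₁ n) hYB hYBC u (hmono hn _ hG)
    -- The part S M² is tested against u by testing M² against S*u.
    obtain ⟨i2, z2⟩ := setIntegral_mul_inner_eq_zero (hle n) (hnoise.integrable₂ n)
      (hnoise.condExp₂ n) hYB hYBC (ContinuousLinearMap.adjoint S u) (hmono hn _ hG)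
    have := integral_sub (i1.integrableOn (s := G)) i2.integrableOn
    rw [z1, z2, sub_zero] at this
    rw [← this]
    congr 1
    ext ω
    by_cases hmem : ω ∈ rangeEvent P n₀ θ w n
    · simp only [stoppedNoise₁, Set.indicator_of_mem hmem, inner_sub_right,
        ContinuousLinearMap.adjoint_inner_left]
      ring
    · simp [stoppedNoise₁, hmem]

/-- The event that the noise sums stay below their thresholds. -/
def smallNoiseEvent (P : Data d) (n₀ : ℕ) (θ w M₁ M₂ : ℕ → Ω → Vec d) : Set Ω :=
  {ω | ∀ n, n₀ ≤ n →
    ‖noiseSum (act P.X₁) (step P.α) (stoppedNoise₁ P n₀ θ w M₁ M₂) (n + 1) ω‖ ≤ P.εθ n ∧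
    ‖noiseSum (act P.W₂) (step P.β) (stoppedNoise₂ P n₀ θ w M₂) (n + 1) ω‖ ≤ P.εw n}

/-- Each of the two noise sums fails at time n with probability at most (δ/2)(n+1)^(-p); summing
over n ≥ n₀ gives at most δc with c < 1. -/
theorem measureReal_smallNoiseEvent_compl_lt (h : P.Admissible n₀)
    (hsum : (n₀ : ℝ) ^ (1 - P.p) / (P.p - 1) ≤ 1) (hiter : IsIterates P θ w M₁ M₂)
    (hnoise : DominatedMartingaleDifferences μ θ w M₁ M₂ P.m₁ P.m₂)
    (hG : MeasurableSet[history (θ 0) (w 0) M₁ M₂ n₀] G) (hGpos : μ G ≠ 0) :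
    (ProbabilityTheory.cond μ G).real (smallNoiseEvent P n₀ θ w M₁ M₂)ᶜ < P.δ := by
  have hle := hnoise.history_le hiter.measurable_θ₀ hiter.measurable_w₀
  have hmono := history_mono (θ 0) (w 0) M₁ M₂
  have hν := ProbabilityTheory.cond_isProbabilityMeasure (μ := μ) hGpos
  set ν := ProbabilityTheory.cond μ G
  have hsize := h.size_pos
  have hδ := h.δ_pos
  have hCθ : 1 ≤ P.Cθ := one_le_prodConst _ _
  have hCw : 1 ≤ P.Cw := one_le_prodConst _ _
  have hbθ : 0 ≤ (P.m₁ + P.m₂ * opNorm P.W₁ * opNorm P.W₂⁻¹) * P.size := by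
    have := h.m₁_pos
    have := h.m₂_pos
    have := opNorm_nonneg P.W₁
    have := opNorm_nonneg P.W₂⁻¹
    positivity
  have hbw : 0 ≤ P.m₂ * P.size := by
    have := h.m₂_pos
    positivity
  set badθ : ℕ → Set Ω := fun n => {ω | P.εθ n <
    ‖noiseSum (act P.X₁) (step P.α) (stoppedNoise₁ P n₀ θ w M₁ M₂) (n + 1) ω‖}
  set badw : ℕ → Set Ω := fun n => {ω | P.εw n <
    ‖noiseSum (act P.W₂) (step P.β) (stoppedNoise₂ P n₀ θ w M₂) (n + 1) ω‖}
  have hθ : ∀ n, n₀ ≤ n → ν.real (badθ n) ≤ P.δ / 2 * ((n : ℝ) + 1) ^ (-P.p) :=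
    h.measure_noiseSum_gt_le hmono hle (isBoundedNoise₁ h.toValid hiter hnoise hG)
      (fun n hn => by rw [stoppedNoise₁, rangeEvent_eq_empty hn, Set.indicator_empty]; rfl)
      h.q₁_pos h.α_pos.le h.contract₁ h.γ_div_le₁ h.Lθ_pos
      (by
        have : P.Lθ / 2 = (P.Cθ * ((P.m₁ + P.m₂ * opNorm P.W₁ * opNorm P.W₂⁻¹) * P.size)) ^ 2 := by
          unfold Data.Lθ; ring
        rw [this]
        exact pow_le_pow_left₀ hbθ (le_mul_of_one_le_left hbθ hCθ) 2) h.exp_div_le_Dθ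
  have hw : ∀ n, n₀ ≤ n → ν.real (badw n) ≤ P.δ / 2 * ((n : ℝ) + 1) ^ (-P.p) :=
    h.measure_noiseSum_gt_le hmono hle (isBoundedNoise₂ h.toValid hiter hnoise hG)
      (fun n hn => by rw [stoppedNoise₂, rangeEvent_eq_empty hn, Set.indicator_empty]; rfl)
      h.q₂_pos h.β_pos.le h.contract₂ h.γ_div_le₂ h.Lw_pos
      (by
        have : P.Lw / 2 = (P.Cw * (P.m₂ * P.size)) ^ 2 := by unfold Data.Lw; ring
        rw [this]
        exact pow_le_pow_left₀ hbw (le_mul_of_one_le_left hbw hCw) 2) h.exp_div_le_Dw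
  obtain ⟨c, hc1, hc⟩ := exists_sum_rpow_le h.one_lt_p (by have := h.three_le; omega) hsum
  have hc0 : 0 ≤ c := by simpa using hc 0
  have hsub : (smallNoiseEvent P n₀ θ w M₁ M₂)ᶜ ⊆ ⋃ k, (badθ (n₀ + k) ∪ badw (n₀ + k)) := by
    intro ω hω
    simp only [smallNoiseEvent, Set.mem_compl_iff, Set.mem_ofPred_eq, not_forall] at hω
    obtain ⟨n, hn, hω⟩ := hω
    refine Set.mem_iUnion.2 ⟨n - n₀, ?_⟩
    rw [Nat.add_sub_cancel' hn]
    by_contra hcon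
    simp only [badθ, badw, Set.mem_union, Set.mem_ofPred_eq, not_or, not_lt] at hcon
    exact hω hcon
  have hunion : ν (⋃ k, (badθ (n₀ + k) ∪ badw (n₀ + k))) ≤ ENNReal.ofReal (P.δ * c) := by
    refine (measure_iUnion_le _).trans (ENNReal.tsum_le_of_sum_range_le fun K => ?_)
    have hk : ∀ k ∈ Finset.range K, ν (badθ (n₀ + k) ∪ badw (n₀ + k)) ≤
        ENNReal.ofReal (P.δ * ((n₀ : ℝ) + k + 1) ^ (-P.p)) := by
      intro k _
      rw [← ofReal_measureReal (measure_ne_top _ _)]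
      apply ENNReal.ofReal_le_ofReal
      have e1 := hθ (n₀ + k) (by omega)
      have e2 := hw (n₀ + k) (by omega)
      push_cast at e1 e2
      refine (measureReal_union_le _ _).trans ?_
      linarith
    refine (Finset.sum_le_sum hk).trans ?_
    rw [← ENNReal.ofReal_sum_of_nonneg fun k _ => by positivity, ← Finset.mul_sum]
    exact ENNReal.ofReal_le_ofReal (mul_le_mul_of_nonneg_left (hc K) hδ.le)
  have : ν.real (smallNoiseEvent P n₀ θ w M₁ M₂)ᶜ ≤ P.δ * c :=
    ENNReal.toReal_le_of_le_ofReal (by positivity) ((measure_mono hsub).trans hunion)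
  nlinarith

/-- There is no circularity: the recursions are required only in range, where stopped and true noise
agree, and `inRange` then removes the restriction. -/
theorem errors_le_of_mem_smallNoiseEvent (h : P.Admissible n₀) (hiter : IsIterates P θ w M₁ M₂)
    {ω : Ω} (hω : ω ∈ smallNoiseEvent P n₀ θ w M₁ M₂) (hθ₀ : ‖θ n₀ ω - P.θstar‖ ≤ P.Rθ)
    (hw₀ : ‖w n₀ ω - P.wstar‖ ≤ P.Rw) (n : ℕ) (hn : n₀ ≤ n) :
    ‖θ n ω - P.θstar‖ ≤
        P.A₅ n₀ ‖θ n₀ ω - P.θstar‖ ‖w n₀ ω - P.wstar‖ * P.ν n P.α ∧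
      ‖w n ω - P.wstar‖ ≤
        P.A₄ n₀ ‖θ n₀ ω - P.θstar‖ ‖w n₀ ω - P.wstar‖ * P.ν n P.β := by
  -- The range event is empty before n₀, so the sums are still 0 there.
  have hzero : ∀ (A : Vec d →L[ℝ] Vec d) (a : ℕ → ℝ) (F : ℕ → Ω → Vec d),
      noiseSum A a (fun n => (rangeEvent P n₀ θ w n).indicator (F n)) n₀ ω = 0 := fun A a F => by
    rw [noiseSum_eq_zero A a (fun k hk => by rw [rangeEvent_eq_empty hk, Set.indicator_empty]; rfl)
      n₀ le_rfl]
    rfl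
  have hr := h.errorRecursion (e := fun k => θ k ω - P.θstar) (f := fun k => w k ω - P.wstar)
    (ξ₁ := fun k => M₁ (k + 1) ω) (ξ₂ := fun k => M₂ (k + 1) ω)
    (Lθ := fun k => noiseSum (act P.X₁) (step P.α) (stoppedNoise₁ P n₀ θ w M₁ M₂) k ω)
    (Lw := fun k => noiseSum (act P.W₂) (step P.β) (stoppedNoise₂ P n₀ θ w M₂) k ω)
    (fun k => by rw [hiter.θ_succ, h.h₁_eq]; abel)
    (fun k => by rw [hiter.w_succ, h.h₂_eq]; abel)
    (hzero _ _ _) (hzero _ _ _)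
    (fun k hk hin => by
      have hmem : ω ∈ rangeEvent P n₀ θ w k := ⟨hk, hin⟩
      simp only [noiseSum, stoppedNoise₁, Set.indicator_of_mem hmem])
    (fun k hk hin => by
      have hmem : ω ∈ rangeEvent P n₀ θ w k := ⟨hk, hin⟩
      simp only [noiseSum, stoppedNoise₂, Set.indicator_of_mem hmem])
    (fun k hk => (hω k hk).1) (fun k hk => (hω k hk).2)
  have hin := hr.inRange h hθ₀ hw₀
  exact ⟨hr.x_le_A₅ h hin hn, hr.y_le_A₄ h hin hn⟩

end Noise

end TwoTimescale

/-! ### Assembly. -/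

theorem theorem2 {d : ℕ} (hd : 1 ≤ d) (P : TwoTimescale.Data d)
    (hW₂ : TwoTimescale.IsPosDef P.W₂) (hX₁ : TwoTimescale.IsPosDef P.X₁)
    (hβ : 0 < P.β) (hβα : P.β < P.α) (hα : P.α < 1)
    (hm₁ : 0 < P.m₁) (hm₂ : 0 < P.m₂) (hRθ : 0 < P.Rθ) (hRw : 0 < P.Rw)
    (hp : 1 < P.p) (hδ0 : 0 < P.δ) (hδ1 : P.δ < 1)
    (hKθ : TwoTimescale.IsDecayIndex P.α P.q₁ P.Kθ)
    (hKw : TwoTimescale.IsDecayIndex P.β P.q₂ P.Kw)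
    {Ω : Type*} [MeasurableSpace Ω] (μ : MeasureTheory.Measure Ω)
    [MeasureTheory.IsProbabilityMeasure μ]
    (θ w M₁ M₂ : ℕ → Ω → TwoTimescale.Vec d)
    (hiter : TwoTimescale.IsIterates P θ w M₁ M₂)
    (hnoise : TwoTimescale.DominatedMartingaleDifferences μ θ w M₁ M₂ P.m₁ P.m₂)
    (n₀ : ℕ) (hn₀ : P.N ≤ (n₀ : ℝ))
    (G : Set Ω)
    (hG : G = {ω | ‖θ n₀ ω - P.θstar‖ ≤ P.Rθ ∧ ‖w n₀ ω - P.wstar‖ ≤ P.Rw})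
    (hGpos : μ G ≠ 0) :
    1 - P.δ < (ProbabilityTheory.cond μ G).real
      {ω | ∀ n : ℕ, n₀ ≤ n →
        ‖θ n ω - P.θstar‖ ≤
          P.A₅ n₀ ‖θ n₀ ω - P.θstar‖ ‖w n₀ ω - P.wstar‖ * P.ν n P.α ∧
        ‖w n ω - P.wstar‖ ≤
          P.A₄ n₀ ‖θ n₀ ω - P.θstar‖ ‖w n₀ ω - P.wstar‖ * P.ν n P.β} := by
  have hP : P.Valid := ⟨hd, hW₂, hX₁, hβ, hβα, hα, hm₁, hm₂, hRθ, hRw, hp, hδ0, hδ1, hKθ.1, hKw.1⟩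
  have h := hP.admissible hn₀
  have hGmeas : @MeasurableSet Ω (TwoTimescale.history (θ 0) (w 0) M₁ M₂ n₀) G :=
    hG ▸ hiter.measurableSet_errors_le n₀ _ _
  have hν := ProbabilityTheory.cond_isProbabilityMeasure (μ := μ) hGpos
  have hbad := TwoTimescale.measureReal_smallNoiseEvent_compl_lt h (hP.one_le_mul_rpow hn₀)
    hiter hnoise hGmeas hGpos
  have hGc : (ProbabilityTheory.cond μ G).real Gᶜ = 0 := by
    rw [MeasureTheory.measureReal_eq_zero_iff]
    exact ProbabilityTheory.ae_cond_mem
      (hnoise.history_le hiter.measurable_θ₀ hiter.measurable_w₀ n₀ _ hGmeas)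
  set E : Set Ω := {ω | ∀ n : ℕ, n₀ ≤ n →
    ‖θ n ω - P.θstar‖ ≤
      P.A₅ n₀ ‖θ n₀ ω - P.θstar‖ ‖w n₀ ω - P.wstar‖ * P.ν n P.α ∧
    ‖w n ω - P.wstar‖ ≤
      P.A₄ n₀ ‖θ n₀ ω - P.θstar‖ ‖w n₀ ω - P.wstar‖ * P.ν n P.β}
  -- Measurability of the target event is not needed: subadditivity of this cover bounds its measure
  -- from below.
  have hcover : (Set.univ : Set Ω) ⊆
      E ∪ (Gᶜ ∪ (TwoTimescale.smallNoiseEvent P n₀ θ w M₁ M₂)ᶜ) := by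
    intro ω _
    by_cases hωG : ω ∈ G
    · by_cases hω : ω ∈ TwoTimescale.smallNoiseEvent P n₀ θ w M₁ M₂
      · rw [hG] at hωG
        exact Or.inl (TwoTimescale.errors_le_of_mem_smallNoiseEvent h hiter hω hωG.1 hωG.2)
      · exact Or.inr (Or.inr hω)
    · exact Or.inr (Or.inl hωG)
  have h1 := MeasureTheory.measureReal_mono (μ := ProbabilityTheory.cond μ G) hcover
  rw [MeasureTheory.probReal_univ] at h1
  have h2 := h1.trans ((MeasureTheory.measureReal_union_le _ _).trans
    (add_le_add_right (MeasureTheory.measureReal_union_le _ _) _))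
  linarith
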